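/- **Definitions.** For a reduced ring $R$ let $K(R)$ be its total ring of fractions, $R^{\mathrm N}$ the integral closure of $R$ in $K(R)$, and $\mathfrak c=\operatorname{Ann}_R(R^{\mathrm N}/R)$ the conductor, which is an ideal of both $R$ and $R^{\mathrm N}$. A reduced local ring $R$ has *hereditary surjective trace* if $R$ is normal (that is, $R=R^{\mathrm N}$), or if there are a prime $\mathfrak p\subset R$ minimal over $\mathfrak c$ and a prime $\mathfrak q\subset R^{\mathrm N}$ minimal over $\mathfrak c$ with $\mathfrak q\cap R=\mathfrak p$ such that (i) the trace $\operatorname{Tr}\colon K(R^{\mathrm N}/\mathfrak q)\to K(R/\mathfrak p)$ restricts to a surjection $(R^{\mathrm N}/\mathfrak q)^{\mathrm N}\to(R/\mathfrak p)^{\mathrm N}$, and (ii) $R/\mathfrak p$ has hereditary surjective trace. Here the recursion is required to end after finitely many steps. The ring $R$ has the *stronger variant* of hereditary surjective trace if, recursively, (i) holds and $R/\mathfrak p$ has the stronger variant for *every* such pair $(\mathfrak p,\mathfrak q)$ (a condition that is empty if $R$ is normal). A scheme has hereditary surjective trace (resp. the stronger variant) if it is reduced and all its local rings have this property. **Lemma.**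 Let $X$ be a reduced scheme of finite type over an algebraically closed field $k$ of characteristic zero. Let $A\subseteq k$ be a finitely generated $\mathbb Z$-subalgebra and $X_A$ a scheme of finite type over $A$ with $X_A\times_{\operatorname{Spec}A}\operatorname{Spec}k\cong X$. Then there is a dense open subset $U\subseteq\operatorname{Spec}A$ such that for every closed point $s\in U$ the fibre $X_s=X_A\times_{\operatorname{Spec} A}\operatorname{Spec}\kappa(s)$ has hereditary surjective trace, and even the stronger variant. -/

import Mathlib

open CategoryTheory CategoryTheory.Limits AlgebraicGeometry

universe u

/-- The normalization `Rᴺ` of a (reduced) ring `R`: the integral closure of `R` in its total ring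
of fractions `K(R)`. (`FractionRing R` is the localization of `R` at all nonzerodivisors.) -/
noncomputable abbrev Normalization (R : Type u) [CommRing R] : Subalgebra R (FractionRing R) :=
  integralClosure R (FractionRing R)

/-- The conductor `𝔠 = Ann_R (Rᴺ / R)`, as an ideal of `R`. -/
noncomputable def conductorIdeal (R : Type u) [CommRing R] : Ideal R :=
  Module.annihilator R
    (Normalization R ⧸ LinearMap.range (Algebra.linearMap R (Normalization R)))

/-- The conductor as an ideal of `Rᴺ`. -/
noncomputable def conductorIdealNorm (R : Type u) [CommRing R] : Ideal (Normalization R) :=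
  (conductorIdeal R).map (algebraMap R (Normalization R))

/-- For an extension of domains `A ⊆ B`, the field trace `K(B) → K(A)` restricts to a surjective
map `Bᴺ → Aᴺ`. -/
def NormalizedTraceSurjective (A B : Type u) [CommRing A] [IsDomain A] [CommRing B] [IsDomain B]
    [Algebra A B] [FaithfulSMul A B] : Prop :=
  letI : Algebra (FractionRing A) (FractionRing B) := FractionRing.liftAlgebra A (FractionRing B)
  Algebra.trace (FractionRing A) (FractionRing B) '' (Normalization B : Set (FractionRing B)) =
    (Normalization A : Set (FractionRing A))

/-- Hereditary surjective trace for a reduced local ring `R`. The components `C_i` of `C_red` are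
the `V(𝔭)` for `𝔭 ⊂ R` minimal over the conductor, the components `B_i` of `B_red` are the `V(𝔮)`
for `𝔮 ⊂ Rᴺ` minimal over the conductor, and `B_i` dominates `C_i` iff `𝔮 ∩ R = 𝔭`.
The recursion has to stop after finitely many steps, whence an inductive predicate. -/
inductive HereditarySurjectiveTrace : ∀ (R : Type u) [CommRing R], Prop
  | of_normal (R : Type u) [CommRing R] (h : IsIntegrallyClosed R) :
      HereditarySurjectiveTrace R
  | step (R : Type u) [CommRing R] (𝔭 : Ideal R) (𝔮 : Ideal (Normalization R))
      [𝔭.IsPrime] [𝔮.IsPrime] [𝔮.LiesOver 𝔭]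
      (h𝔭 : 𝔭 ∈ (conductorIdeal R).minimalPrimes)
      (h𝔮 : 𝔮 ∈ (conductorIdealNorm R).minimalPrimes)
      (trace_surjective : NormalizedTraceSurjective (R ⧸ 𝔭) (Normalization R ⧸ 𝔮))
      (hereditary : HereditarySurjectiveTrace (R ⧸ 𝔭)) :
      HereditarySurjectiveTrace R

/-- The stronger variant: both conditions are required for every component `C_i` of `C_red` and
every component `B_i` of `B_red` dominating it. (If `R` is normal the conductor is the unit ideal
and there is no component.) -/
inductive StrongHereditarySurjectiveTrace : ∀ (R : Type u) [CommRing R], Prop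
  | mk (R : Type u) [CommRing R]
      (trace_surjective : ∀ (𝔭 : Ideal R) (𝔮 : Ideal (Normalization R))
        [𝔭.IsPrime] [𝔮.IsPrime] [𝔮.LiesOver 𝔭],
        𝔭 ∈ (conductorIdeal R).minimalPrimes → 𝔮 ∈ (conductorIdealNorm R).minimalPrimes →
        NormalizedTraceSurjective (R ⧸ 𝔭) (Normalization R ⧸ 𝔮))
      (hereditary : ∀ (𝔭 : Ideal R) (𝔮 : Ideal (Normalization R))
        [𝔭.IsPrime] [𝔮.IsPrime] [𝔮.LiesOver 𝔭],
        𝔭 ∈ (conductorIdeal R).minimalPrimes → 𝔮 ∈ (conductorIdealNorm R).minimalPrimes →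
        StrongHereditarySurjectiveTrace (R ⧸ 𝔭)) :
      StrongHereditarySurjectiveTrace R

/-- A scheme has hereditary surjective trace if it is reduced and all its local rings have it. -/
def AlgebraicGeometry.Scheme.HasHereditarySurjectiveTrace (X : Scheme.{u}) : Prop :=
  IsReduced X ∧ ∀ x : X, HereditarySurjectiveTrace (X.presheaf.stalk x)

/-- The stronger variant of hereditary surjective trace for a scheme. -/
def AlgebraicGeometry.Scheme.HasStrongHereditarySurjectiveTrace (X : Scheme.{u}) : Prop :=
  IsReduced X ∧ ∀ x : X, StrongHereditarySurjectiveTrace (X.presheaf.stalk x)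

/-- A model of the `k`-scheme `f : X ⟶ Spec k`, as used for reduction to positive characteristic:
a finitely generated `ℤ`-subalgebra `A ⊆ k` and a scheme `𝒳` of finite type over `A`, together
with an identification `X = 𝒳 ×_A k`. Its reductions are the fibres of `𝒳 ⟶ Spec A` over the
closed points of `Spec A`. -/
structure ArithmeticModel {k : Type u} [Field k] {X : Scheme.{u}}
    (f : X ⟶ Spec (CommRingCat.of k)) where
  A : Subalgebra ℤ k
  fg : A.FG
  total : Scheme.{u}
  toBase : total ⟶ Spec (CommRingCat.of A)
  locallyOfFiniteType : LocallyOfFiniteType toBase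
  quasiCompact : QuasiCompact toBase
  fromGeneric : X ⟶ total
  isPullback : IsPullback fromGeneric f toBase (Spec.map (CommRingCat.ofHom (algebraMap A k)))

/-! If `B` over `A` is a finite extension of domains whose field degree `n` is invertible in `A`,
then any `y` in the normalization of `A` is the trace of `y / n`, so the trace is surjective on
normalizations. It therefore suffices to keep the degrees in the recursion prime to the residue
characteristic. If the field extension is generated by elements of degree at most `r`, its degree is
a product of numbers at most `r`, and invertibility of `r!` is enough
(`normalizedTraceSurjective_of_natDegree_le`).

A uniform `r` comes from a generic presentation. A finitely generated domain over a domain `Z` of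
characteristic zero is, up to denominators, an integral extension of a polynomial ring generated by
one element `θ` with equation `F`. In every fibre where finitely many elements survive,
interpolation at the roots of `F` shows that `F'(θ)` multiplies integral fractions into the ring and
that these have degree at most `deg F`. This is `BoundsNormalization`; it is glued over components
to treat reduced algebras.

For the recursion, a regular `d` multiplying the normalization into the ring `E` lies in the
conductor, so a prime minimal over the conductor is associated to `E / d` and its quotient has
smaller dimension. By generic flatness, such primes come from annihilators in the fibres of `D / P`
for finitely many primes `P`; as these fibres are reduced, they are minimal primes there. Each
minimal prime is the annihilator of the value at `θ` of a divisor of `F`, and the divisors have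
bounded total degree. Hence all components that occur are members of one algebraic family over a
larger base `Z[X_j]`.

The parameter of a given component need not be generic in the larger base. The inductive statement
`FibresHaveStrongTrace` therefore concerns all fields over an arbitrary noetherian base in which
some fixed `N` is nonzero. The stratification `exists_natCast_ne_zero_imp` reduces it to a generic
statement over domains of characteristic zero: strata of positive characteristic only contribute to
`N`. Induction on dimension then gives the affine result, and a finite affine cover of the model
gives the theorem. -/

section

/-! ### Generic flatness, in terms of the vanishing of Tor -/

open TensorProduct in
/-- Vanishing of `Tor₁(κ, M)`: for every surjection `g : L → M` the kernel stays a submodule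
after base change to `κ`. -/
def TorVanishes (Z κ : Type u) [CommRing Z] [CommRing κ] [Algebra Z κ] (M : Type u)
    [AddCommGroup M] [Module Z M] : Prop :=
  ∀ (L : Type u) [AddCommGroup L] [Module Z L] (g : L →ₗ[Z] M), Function.Surjective g →
    Function.Injective ((LinearMap.ker g).subtype.lTensor κ)

namespace TorVanishes

open TensorProduct

variable {Z κ : Type u} [CommRing Z] [CommRing κ] [Algebra Z κ]

lemma lTensor_injective {M L N : Type u} [AddCommGroup M] [Module Z M] [AddCommGroup L]
    [Module Z L] [AddCommGroup N] [Module Z N] (h : TorVanishes Z κ M) (i : N →ₗ[Z] L)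
    (g : L →ₗ[Z] M) (hi : Function.Injective i) (hg : Function.Surjective g)
    (e : Function.Exact i g) : Function.Injective (i.lTensor κ) := by
  have h1 := h L g hg
  have hr : ∀ x, i x ∈ LinearMap.ker g := fun x => (e (i x)).2 ⟨x, rfl⟩
  let j : N ≃ₗ[Z] LinearMap.ker g := LinearEquiv.ofBijective (i.codRestrict _ hr)
    ⟨fun x y hxy => hi (congrArg Subtype.val hxy), fun y => by
      obtain ⟨x, hx⟩ := (e y.1).1 y.2
      exact ⟨x, Subtype.ext hx⟩⟩
  have : i = (LinearMap.ker g).subtype ∘ₗ j.toLinearMap := by ext; rfl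
  rw [this, LinearMap.lTensor_comp]
  exact h1.comp (LinearEquiv.lTensor κ j).injective

lemma of_equiv {M M' : Type u} [AddCommGroup M] [Module Z M] [AddCommGroup M'] [Module Z M']
    (h : TorVanishes Z κ M) (e : M ≃ₗ[Z] M') : TorVanishes Z κ M' := by
  intro L _ _ g hg
  refine h.lTensor_injective _ (e.symm.toLinearMap ∘ₗ g) (Submodule.injective_subtype _)
    (e.symm.surjective.comp hg) ?_
  intro x
  simp

/-- The inclusion of `ker p` into `L` factors through `L' = ker (g ∘ p)`. The successive quotients
are `M'` and `M''`, so both steps stay injective. -/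
lemma of_exact {M M' M'' : Type u} [AddCommGroup M] [Module Z M] [AddCommGroup M'] [Module Z M']
    [AddCommGroup M''] [Module Z M''] (f : M' →ₗ[Z] M) (g : M →ₗ[Z] M'')
    (hf : Function.Injective f) (hg : Function.Surjective g) (e : Function.Exact f g)
    (h' : TorVanishes Z κ M') (h'' : TorVanishes Z κ M'') : TorVanishes Z κ M := by
  intro L _ _ p hp
  let L' := LinearMap.ker (g ∘ₗ p)
  have h1 := h'' L (g ∘ₗ p) (hg.comp hp)
  let q : L' →ₗ[Z] LinearMap.range f := (p ∘ₗ L'.subtype).codRestrict _ fun x => (e _).1 x.2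
  have hq : Function.Surjective q := by
    rintro ⟨_, y, rfl⟩
    obtain ⟨x, hx⟩ := hp (f y)
    refine ⟨⟨x, ?_⟩, Subtype.ext hx⟩
    change g (p x) = 0
    rw [hx]
    exact (e _).2 ⟨y, rfl⟩
  have hle : LinearMap.ker p ≤ L' := fun x hx => by
    change g (p x) = 0
    rw [show p x = 0 from hx, map_zero]
  have h2 := (h'.of_equiv (LinearEquiv.ofInjective f hf)).lTensor_injective
    (Submodule.inclusion hle) q (Submodule.inclusion_injective hle) hq (by
      intro x
      constructor
      · intro hx
        exact ⟨⟨x.1, congrArg Subtype.val hx⟩, rfl⟩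
      · rintro ⟨y, rfl⟩
        exact Subtype.ext y.2)
  have : (LinearMap.ker p).subtype = L'.subtype ∘ₗ Submodule.inclusion hle := by ext; rfl
  rw [this, LinearMap.lTensor_comp]
  exact h1.comp h2

lemma of_subsingleton {M : Type u} [AddCommGroup M] [Module Z M] [Subsingleton M] :
    TorVanishes Z κ M := by
  intro L _ _ g hg
  have : LinearMap.ker g = ⊤ := by
    ext x; simp [Subsingleton.elim (g x) 0]
  refine (LinearEquiv.lTensor κ (LinearEquiv.ofBijective (LinearMap.ker g).subtype
    ⟨Submodule.injective_subtype _, fun x => ⟨⟨x, this ▸ trivial⟩, rfl⟩⟩)).injective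

/-- A section of `g` yields a retraction of `L` onto the kernel, and retractions survive base
change. -/
lemma of_projective {M : Type u} [AddCommGroup M] [Module Z M] [Module.Projective Z M] :
    TorVanishes Z κ M := by
  intro L _ _ g hg
  obtain ⟨s, hs⟩ := Module.projective_lifting_property g LinearMap.id hg
  have hs' : ∀ x, g (s x) = x := fun x => LinearMap.congr_fun hs x
  let r : L →ₗ[Z] LinearMap.ker g := (LinearMap.id - s ∘ₗ g).codRestrict _ fun x => by
    simp [hs']
  have hr : r ∘ₗ (LinearMap.ker g).subtype = LinearMap.id := by
    ext x
    have : g x.1 = 0 := x.2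
    simp [r, this]
  have h2 : (r.lTensor κ) ∘ₗ ((LinearMap.ker g).subtype.lTensor κ) = LinearMap.id := by
    rw [← LinearMap.lTensor_comp, hr, LinearMap.lTensor_id]
  exact Function.LeftInverse.injective (g := r.lTensor κ) fun x => LinearMap.congr_fun h2 x

/-- Multiplication by `f` maps `L` into the kernel and acts there as the scalar `f`, which is
invertible over `κ`. -/
lemma of_smul_eq_zero {M : Type u} [AddCommGroup M] [Module Z M] (f : Z)
    (hf : IsUnit (algebraMap Z κ f)) (h : ∀ x : M, f • x = 0) : TorVanishes Z κ M := by
  intro L _ _ g hg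
  let r : L →ₗ[Z] LinearMap.ker g := (LinearMap.lsmul Z L f).codRestrict _ fun x => by
    simp [h]
  have hr : r ∘ₗ (LinearMap.ker g).subtype = f • LinearMap.id := by
    ext x
    rfl
  have h2 : (r.lTensor κ) ∘ₗ ((LinearMap.ker g).subtype.lTensor κ) = f • LinearMap.id := by
    rw [← LinearMap.lTensor_comp, hr, LinearMap.lTensor_smul, LinearMap.lTensor_id]
  intro x y hxy
  have h3 : f • x = f • y := by
    rw [← LinearMap.id_apply (R := Z) x, ← LinearMap.id_apply (R := Z) y, ← LinearMap.smul_apply,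
      ← LinearMap.smul_apply, ← h2, LinearMap.comp_apply, LinearMap.comp_apply, hxy]
  rw [← algebraMap_smul κ f x, ← algebraMap_smul κ f y] at h3
  exact hf.smul_left_cancel.1 h3

/-- An element of `κ ⊗ N 0` that dies in `κ ⊗ L` dies in some `κ ⊗ N i`, where `L` is the union of
the chain `N`. -/
lemma exists_lTensor_inclusion_eq_zero {L : Type u} [AddCommGroup L] [Module Z L]
    (N : ℕ →o Submodule Z L) (hN : ∀ x, ∃ i, x ∈ N i) (x : κ ⊗[Z] N 0)
    (hx : (N 0).subtype.lTensor κ x = 0) :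
    ∃ i, (Submodule.inclusion (N.monotone (Nat.zero_le i))).lTensor κ x = 0 := by
  classical
  let F : ∀ i j, i ≤ j → N i →ₗ[Z] N j := fun i j hij => Submodule.inclusion (N.monotone hij)
  have : DirectedSystem (fun i => N i) fun i j h => F i j h :=
    ⟨fun i x => rfl, fun _ _ _ _ _ _ => rfl⟩
  let G := Module.DirectLimit (fun i => N i) F
  let φ : G →ₗ[Z] L := Module.DirectLimit.lift Z ℕ _ F (fun i => (N i).subtype)
    (fun i j hij x => rfl)
  have hφ : Function.Injective φ :=
    Module.DirectLimit.lift_injective _ _ fun i => Submodule.injective_subtype _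
  have hφ' : Function.Surjective φ := fun y => by
    obtain ⟨i, hi⟩ := hN y
    exact ⟨Module.DirectLimit.of Z ℕ (fun i => N i) F i ⟨y, hi⟩,
      Module.DirectLimit.lift_of (R := Z) (G := fun i => N i) (f := F) (P := L) _ _ _⟩
  let e := LinearEquiv.ofBijective φ ⟨hφ, hφ'⟩
  have he : e.toLinearMap = φ := LinearMap.ext fun _ => rfl
  have h0 : (Module.DirectLimit.of Z ℕ _ F 0).lTensor κ x = 0 := by
    apply (LinearEquiv.lTensor κ e).injective
    refine Eq.trans ?_ (map_zero _).symm
    refine Eq.trans ?_ hx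
    have : (N 0).subtype = e.toLinearMap ∘ₗ Module.DirectLimit.of Z ℕ _ F 0 := by
      ext y
      rw [he, LinearMap.comp_apply]
      exact (Module.DirectLimit.lift_of (R := Z) (G := fun i => N i) (f := F)
        (fun i => (N i).subtype) (fun _ _ _ _ => rfl) y).symm
    rw [this, LinearMap.lTensor_comp]
    rfl
  have : DirectedSystem (fun i => κ ⊗[Z] N i) fun i j h => (F i j h).lTensor κ :=
    ⟨fun i x => by
      change LinearMap.lTensor κ (LinearMap.id) x = x
      simp, fun _ _ _ _ _ x => by
      rw [← LinearMap.comp_apply, ← LinearMap.lTensor_comp]; rfl⟩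
  have h1 : directLimitRight F κ ((Module.DirectLimit.of Z ℕ _ F 0).lTensor κ x) =
      Module.DirectLimit.of Z ℕ _ (fun i j h => (F i j h).lTensor κ) 0 x := by
    refine x.induction_on (by simp) (by simp) ?_
    intro x y hx hy
    rw [map_add, map_add, map_add, hx, hy]
  rw [h0, map_zero] at h1
  obtain ⟨j, _, hj⟩ := Module.DirectLimit.of.zero_exact h1.symm
  exact ⟨j, hj⟩

/-- The preimages of the filtration climb from `ker g` to `L`. Each inclusion has a graded piece as
quotient, hence stays injective, and tensor products commute with the union of the chain. -/
lemma of_filtration {D M : Type u} [CommRing D] [Algebra Z D] [AddCommGroup M] [Module Z M]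
    [Module D M] [IsScalarTower Z D M] (N : ℕ →o Submodule D M) (h0 : N 0 = ⊥)
    (hN : ∀ x, ∃ i, x ∈ N i)
    (h : ∀ i, TorVanishes Z κ (N (i + 1) ⧸ (N i).comap (N (i + 1)).subtype)) :
    TorVanishes Z κ M := by
  intro L _ _ g hg
  let P : ℕ →o Submodule Z L := ⟨fun i => ((N i).restrictScalars Z).comap g,
    fun i j hij x hx => N.monotone hij hx⟩
  have hP0 : P 0 = LinearMap.ker g := by
    ext x
    change g x ∈ N 0 ↔ g x = 0
    rw [h0, Submodule.mem_bot]
  have hstep : ∀ i, Function.Injective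
      ((Submodule.inclusion (P.monotone (Nat.le_succ i))).lTensor κ) := by
    intro i
    let q : P (i + 1) →ₗ[Z] (N (i + 1) ⧸ (N i).comap (N (i + 1)).subtype) :=
      ((Submodule.mkQ ((N i).comap (N (i + 1)).subtype)).restrictScalars Z) ∘ₗ
      ((g ∘ₗ (P (i + 1)).subtype).codRestrict ((N (i + 1)).restrictScalars Z) fun x => x.2)
    refine (h i).lTensor_injective _ q (Submodule.inclusion_injective _) ?_ ?_
    · intro y
      obtain ⟨⟨y, hy⟩, rfl⟩ := Submodule.mkQ_surjective _ y
      obtain ⟨x, hx⟩ := hg y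
      exact ⟨⟨x, by change g x ∈ N (i + 1); rwa [hx]⟩,
        congrArg (Submodule.mkQ ((N i).comap (N (i + 1)).subtype)) (Subtype.ext hx)⟩
    · intro x
      have : q x = 0 ↔ g x.1 ∈ N i := by
        change (Submodule.mkQ ((N i).comap (N (i + 1)).subtype)) _ = 0 ↔ _
        rw [Submodule.mkQ_apply, Submodule.Quotient.mk_eq_zero]
        rfl
      rw [this]
      constructor
      · intro hx
        exact ⟨⟨x.1, hx⟩, rfl⟩
      · rintro ⟨y, rfl⟩
        exact y.2
  have hall : ∀ i, Function.Injective
      ((Submodule.inclusion (P.monotone (Nat.zero_le i))).lTensor κ) := by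
    intro i
    induction i with
    | zero =>
      change Function.Injective (LinearMap.lTensor κ LinearMap.id)
      rw [LinearMap.lTensor_id]
      exact fun _ _ => id
    | succ i ih =>
      have : Submodule.inclusion (P.monotone (Nat.zero_le (i + 1))) =
        Submodule.inclusion (P.monotone (Nat.le_succ i)) ∘ₗ
        Submodule.inclusion (P.monotone (Nat.zero_le i)) := rfl
      rw [this, LinearMap.lTensor_comp]
      exact (hstep i).comp ih
  rw [← hP0]
  refine (injective_iff_map_eq_zero _).2 fun x hx => ?_
  obtain ⟨i, hi⟩ := exists_lTensor_inclusion_eq_zero P (fun x => hN (g x)) x hx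
  exact (injective_iff_map_eq_zero _).1 (hall i) x hi

end TorVanishes

/-- Generic flatness for all finite modules over the `Z`-algebra `D`. -/
def GenericallyFlat (Z D : Type u) [CommRing Z] [CommRing D] [Algebra Z D] : Prop :=
  ∀ (M : Type u) [AddCommGroup M] [Module Z M] [Module D M] [IsScalarTower Z D M]
    [Module.Finite D M], ∃ f : Z, f ≠ 0 ∧ ∀ (κ : Type u) [Field κ] [Algebra Z κ],
      algebraMap Z κ f ≠ 0 → TorVanishes Z κ M

namespace GenericallyFlat

/-- Generic flatness can be tested on quotients by primes. -/
lemma of_prime {Z D : Type u} [CommRing Z] [IsDomain Z] [CommRing D] [Algebra Z D]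
    [IsNoetherianRing D]
    (h : ∀ p : Ideal D, p.IsPrime → ∃ f : Z, f ≠ 0 ∧ ∀ (κ : Type u) [Field κ] [Algebra Z κ],
      algebraMap Z κ f ≠ 0 → TorVanishes Z κ (D ⧸ p)) : GenericallyFlat Z D := by
  intro M _ _ _ _ hM
  suffices H : ∃ f : Z, f ≠ 0 ∧ ∀ (κ : Type u) [Field κ] [Algebra Z κ] [Module Z M]
      [IsScalarTower Z D M], algebraMap Z κ f ≠ 0 → TorVanishes Z κ M by
    obtain ⟨f, hf, H⟩ := H
    exact ⟨f, hf, fun κ _ _ h => H κ h⟩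
  refine IsNoetherianRing.induction_on_isQuotientEquivQuotientPrime D
    (motive := fun N _ _ _ => ∃ f : Z, f ≠ 0 ∧ ∀ (κ : Type u) [Field κ] [Algebra Z κ] [Module Z N]
      [IsScalarTower Z D N], algebraMap Z κ f ≠ 0 → TorVanishes Z κ N) hM ?_ ?_ ?_
  · intro N _ _ _ _
    exact ⟨1, one_ne_zero, fun κ _ _ _ _ _ => TorVanishes.of_subsingleton⟩
  · intro N _ _ _ p e
    obtain ⟨f, hf, H⟩ := h p.1 p.2
    exact ⟨f, hf, fun κ _ _ _ _ hκ => (H κ hκ).of_equiv (e.symm.restrictScalars Z)⟩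
  · intro N₁ _ _ _ N₂ _ _ _ N₃ _ _ _ i g hi hg e ⟨f₁, hf₁, H₁⟩ ⟨f₂, hf₂, H₂⟩
    refine ⟨f₁ * f₂, mul_ne_zero hf₁ hf₂, fun κ _ _ _ _ hκ => ?_⟩
    rw [map_mul] at hκ
    let : Module Z N₁ := Module.compHom N₁ (algebraMap Z D)
    let : Module Z N₃ := Module.compHom N₃ (algebraMap Z D)
    have : IsScalarTower Z D N₁ := IsScalarTower.of_algebraMap_smul fun _ _ => rfl
    have : IsScalarTower Z D N₃ := IsScalarTower.of_algebraMap_smul fun _ _ => rfl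
    exact TorVanishes.of_exact (i.restrictScalars Z) (g.restrictScalars Z) hi hg e
      (H₁ κ (left_ne_zero_of_mul hκ)) (H₂ κ (right_ne_zero_of_mul hκ))

lemma self (Z : Type u) [CommRing Z] [IsDomain Z] [IsNoetherianRing Z] :
    GenericallyFlat Z Z := by
  refine of_prime fun p hp => ?_
  by_cases h : p = ⊥
  · subst h
    exact ⟨1, one_ne_zero, fun κ _ _ _ =>
      (TorVanishes.of_projective (M := Z)).of_equiv (Submodule.quotEquivOfEqBot ⊥ rfl).symm⟩
  · obtain ⟨f, hf, hf0⟩ := Submodule.exists_mem_ne_zero_of_ne_bot h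
    refine ⟨f, hf0, fun κ _ _ hκ => TorVanishes.of_smul_eq_zero f hκ.isUnit fun x => ?_⟩
    obtain ⟨x, rfl⟩ := Ideal.Quotient.mk_surjective x
    rw [Algebra.smul_def, Ideal.Quotient.algebraMap_eq, ← map_mul, Ideal.Quotient.eq_zero_iff_mem]
    exact Ideal.mul_mem_right _ _ hf

lemma of_surjective {Z D D' : Type u} [CommRing Z] [CommRing D] [CommRing D'] [Algebra Z D]
    [Algebra Z D'] (φ : D →ₐ[Z] D') (hφ : Function.Surjective φ) (h : GenericallyFlat Z D) :
    GenericallyFlat Z D' := by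
  intro M _ _ _ _ _
  let : Module D M := Module.compHom M φ.toRingHom
  have : IsScalarTower Z D M := IsScalarTower.of_algebraMap_smul fun r x => by
    change φ (algebraMap Z D r) • x = r • x
    rw [φ.commutes, algebraMap_smul]
  have : Module.Finite D M := by
    let := φ.toRingHom.toAlgebra
    have : IsScalarTower D D' M := IsScalarTower.of_algebraMap_smul fun r x => rfl
    have : Module.Finite D D' := Module.Finite.of_surjective (Algebra.linearMap D D') hφ
    exact Module.Finite.trans D' M
  exact h M

-- Filter `D[X] ⧸ p` by degree. The graded pieces are `D` modulo the ideals of leading coefficients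
-- of `p`; this chain of ideals is stationary, so finitely many `f i` take care of all pieces.
open Polynomial in
lemma polynomial {Z D : Type u} [CommRing Z] [IsDomain Z] [CommRing D] [Algebra Z D]
    [IsNoetherianRing D] (h : GenericallyFlat Z D) : GenericallyFlat Z D[X] := by
  classical
  refine of_prime fun p _ => ?_
  obtain ⟨n, hn⟩ := monotone_stabilizes_iff_noetherian.2 ‹IsNoetherianRing D›
    ⟨p.leadingCoeffNth, fun _ _ => p.leadingCoeffNth_mono⟩
  choose f hf0 hf using fun i => h (D ⧸ p.leadingCoeffNth i)
  refine ⟨∏ i ∈ Finset.range (n + 1), f i, Finset.prod_ne_zero_iff.2 fun i _ => hf0 i,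
    fun κ _ _ hκ => ?_⟩
  rw [map_prod, Finset.prod_ne_zero_iff] at hκ
  have key : ∀ i, TorVanishes Z κ (D ⧸ p.leadingCoeffNth i) := by
    intro i
    rcases le_total i n with hi | hi
    · exact hf i κ (hκ i (by simpa [Nat.lt_succ_iff] using hi))
    · have : p.leadingCoeffNth n = p.leadingCoeffNth i := hn i hi
      rw [← this]
      exact hf n κ (hκ n (by simp))
  let q : D[X] →ₗ[D] D[X] ⧸ p := (Ideal.Quotient.mkₐ D p).toLinearMap
  let N : ℕ →o Submodule D (D[X] ⧸ p) := ⟨fun i => (degreeLT D i).map q,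
    fun i j hij => Submodule.map_mono (degreeLT_mono hij)⟩
  refine TorVanishes.of_filtration N ?_ ?_ fun i => ?_
  · change (degreeLT D 0).map q = ⊥
    rw [Submodule.eq_bot_iff]
    rintro _ ⟨x, hx, rfl⟩
    have : x = 0 := by
      have := mem_degreeLT.1 hx
      rwa [Nat.cast_zero, Nat.WithBot.lt_zero_iff, degree_eq_bot] at this
    rw [this, map_zero]
  · intro x
    obtain ⟨x, rfl⟩ := Ideal.Quotient.mk_surjective x
    exact ⟨x.natDegree + 1, x, mem_degreeLT.2 (degree_le_natDegree.trans_lt (by exact_mod_cast Nat.lt_succ_self _)), rfl⟩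
  · have hmem : ∀ c : D, q (C c * X ^ i) ∈ N (i + 1) := fun c =>
      ⟨_, mem_degreeLT.2 ((degree_C_mul_X_pow_le i c).trans_lt (by exact_mod_cast Nat.lt_succ_self _)), rfl⟩
    -- Sending `c` to the class of `c X ^ i` covers the graded piece; its kernel is the ideal of
    -- leading coefficients in degree `i`.
    let ρ : D →ₗ[D] (N (i + 1) ⧸ (N i).comap (N (i + 1)).subtype) :=
      (Submodule.mkQ _) ∘ₗ (LinearMap.codRestrict (N (i + 1)) (q ∘ₗ monomial i) (fun c => by
        rw [LinearMap.comp_apply, ← C_mul_X_pow_eq_monomial]; exact hmem c))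
    have hρ0 : ∀ c, ρ c = 0 ↔ q (monomial i c) ∈ N i := fun c => by
      change (Submodule.mkQ _ _) = 0 ↔ _
      rw [Submodule.mkQ_apply, Submodule.Quotient.mk_eq_zero]
      rfl
    have hsplit : ∀ x ∈ degreeLT D (i + 1), x - monomial i (x.coeff i) ∈ degreeLT D i := by
      intro x hx
      rw [mem_degreeLT, degree_lt_iff_coeff_zero] at hx ⊢
      intro m hm
      rw [coeff_sub, coeff_monomial]
      split_ifs with h1
      · subst h1; simp
      · rw [hx m (by omega), sub_zero]
    have hρ : Function.Surjective ρ := by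
      intro y
      obtain ⟨⟨_, x, hx, rfl⟩, rfl⟩ := Submodule.mkQ_surjective _ y
      refine ⟨x.coeff i, ?_⟩
      change (Submodule.mkQ _ _) = Submodule.mkQ _ _
      rw [eq_comm, ← sub_eq_zero, ← map_sub, Submodule.mkQ_apply, Submodule.Quotient.mk_eq_zero]
      exact ⟨_, hsplit x hx, map_sub q _ _⟩
    have hker : LinearMap.ker ρ = p.leadingCoeffNth i := by
      ext c
      have hmem_nth : c ∈ p.leadingCoeffNth i ↔ ∃ x, (x.degree ≤ (i : WithBot ℕ) ∧ x ∈ p) ∧ x.coeff i = c := by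
        simp only [Ideal.leadingCoeffNth, Ideal.degreeLE, Submodule.mem_map, lcoeff_apply,
          Submodule.mem_inf, mem_degreeLE, Ideal.mem_ofPolynomial]
      rw [LinearMap.mem_ker, hρ0, hmem_nth]
      constructor
      · rintro ⟨x, hx, hxc⟩
        refine ⟨monomial i c - x, ⟨?_, ?_⟩, ?_⟩
        · exact (degree_sub_le _ _).trans
            (max_le (degree_monomial_le _ _) (mem_degreeLT.1 hx).le)
        · rw [← Ideal.Quotient.eq_zero_iff_mem, map_sub, sub_eq_zero]
          exact hxc.symm
        · rw [coeff_sub, coeff_monomial,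
            if_pos rfl, coeff_eq_zero_of_degree_lt (mem_degreeLT.1 hx), sub_zero]
      · rintro ⟨x, ⟨hdeg, hx⟩, rfl⟩
        have hq : q x = 0 := Ideal.Quotient.eq_zero_iff_mem.2 hx
        have h1 := hsplit x (mem_degreeLT.2 (hdeg.trans_lt (by exact_mod_cast Nat.lt_succ_self _)))
        refine ⟨monomial i (x.coeff i) - x, ?_, ?_⟩
        · rw [← neg_sub]
          exact neg_mem h1
        · rw [map_sub, hq, sub_zero]
    have e := (Submodule.quotEquivOfEq _ _ hker.symm).trans (ρ.quotKerEquivOfSurjective hρ)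
    exact (key i).of_equiv (e.restrictScalars Z)

lemma mvPolynomial (Z : Type u) [CommRing Z] [IsDomain Z] [IsNoetherianRing Z] (n : ℕ) :
    GenericallyFlat Z (MvPolynomial (Fin n) Z) := by
  induction n with
  | zero =>
    exact (self Z).of_surjective (MvPolynomial.isEmptyAlgEquiv Z (Fin 0)).symm.toAlgHom
      (MvPolynomial.isEmptyAlgEquiv Z (Fin 0)).symm.surjective
  | succ n ih =>
    exact ih.polynomial.of_surjective (MvPolynomial.finSuccEquiv Z n).symm.toAlgHom
      (MvPolynomial.finSuccEquiv Z n).symm.surjective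

lemma of_finiteType (Z D : Type u) [CommRing Z] [IsDomain Z] [IsNoetherianRing Z] [CommRing D]
    [Algebra Z D] [Algebra.FiniteType Z D] : GenericallyFlat Z D := by
  obtain ⟨n, φ, hφ⟩ := Algebra.FiniteType.iff_quotient_mvPolynomial''.1 ‹Algebra.FiniteType Z D›
  exact (mvPolynomial Z n).of_surjective φ hφ

end GenericallyFlat

/-! ### Colon ideals and associated primes of fibres -/

section Fibre

open TensorProduct

variable {Z D : Type u} [CommRing Z] [CommRing D] [Algebra Z D]

/-- The extension of an ideal of `D` to the fibre `κ ⊗ D`. -/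
noncomputable abbrev Ideal.fibre (κ : Type u) [CommRing κ] [Algebra Z κ] (I : Ideal D) :
    Ideal (κ ⊗[Z] D) :=
  I.map (Algebra.TensorProduct.includeRight (R := Z) (A := κ) (B := D))

/-- Generically, formation of the colon ideal `(I : a)` commutes with passing to the fibre. -/
lemma exists_mem_fibre_colon [IsDomain Z] [IsNoetherianRing Z] [Algebra.FiniteType Z D]
    (I : Ideal D) (a : D) (P : Ideal D) (hP : ∀ x, x ∈ P ↔ a * x ∈ I) :
    ∃ f : Z, f ≠ 0 ∧ ∀ (κ : Type u) [Field κ] [Algebra Z κ], algebraMap Z κ f ≠ 0 →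
      ∀ e : κ ⊗[Z] D, (1 ⊗ₜ a) * e ∈ I.fibre κ → e ∈ P.fibre κ := by
  obtain ⟨f, hf, H⟩ := GenericallyFlat.of_finiteType Z D (D ⧸ (I ⊔ Ideal.span {a}))
  refine ⟨f, hf, fun κ _ _ hκ e he => ?_⟩
  -- Multiplication by `a` gives an exact sequence `0 → D/P → D/I → D/(I + a) → 0`. Vanishing of Tor
  -- for the last term keeps the first map injective in the fibre.
  let μ : (D ⧸ P) →ₗ[Z] (D ⧸ I) := (Submodule.mapQ P I (LinearMap.mulLeft D a)
    (fun x hx => (hP x).1 hx)).restrictScalars Z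
  let π : (D ⧸ I) →ₗ[Z] (D ⧸ (I ⊔ Ideal.span {a})) :=
    ((Ideal.Quotient.factorₐ Z (le_sup_left : I ≤ I ⊔ Ideal.span {a}))).toLinearMap
  have hμ : Function.Injective μ := by
    refine (injective_iff_map_eq_zero _).2 fun x hx => ?_
    obtain ⟨x, rfl⟩ := Ideal.Quotient.mk_surjective x
    exact Ideal.Quotient.eq_zero_iff_mem.2 ((hP x).2 (Ideal.Quotient.eq_zero_iff_mem.1 hx))
  have hπ : Function.Surjective π := Ideal.Quotient.factor_surjective (le_sup_left : I ≤ I ⊔ Ideal.span {a})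
  have hex : Function.Exact μ π := by
    intro x
    obtain ⟨x, rfl⟩ := Ideal.Quotient.mk_surjective x
    change Ideal.Quotient.mk (I ⊔ Ideal.span {a}) x = 0 ↔ _
    rw [Ideal.Quotient.eq_zero_iff_mem, sup_comm, Ideal.mem_span_singleton_sup]
    constructor
    · rintro ⟨y, b, hb, rfl⟩
      refine ⟨Ideal.Quotient.mk P y, ?_⟩
      change Ideal.Quotient.mk I (a * y) = _
      rw [Ideal.Quotient.eq, mul_comm]
      simpa using hb
    · rintro ⟨y, hy⟩
      obtain ⟨y, rfl⟩ := Ideal.Quotient.mk_surjective y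
      replace hy : Ideal.Quotient.mk I (a * y) = Ideal.Quotient.mk I x := hy
      rw [eq_comm, Ideal.Quotient.eq] at hy
      exact ⟨y, _, hy, by ring⟩
  have hinj := (H κ hκ).lTensor_injective μ π hμ hπ hex
  let eI := Algebra.TensorProduct.tensorQuotientEquiv (R := Z) Z D κ I
  let eP := Algebra.TensorProduct.tensorQuotientEquiv (R := Z) Z D κ P
  have hcomm : ∀ e : κ ⊗[Z] D, μ.lTensor κ (eP.symm (Ideal.Quotient.mk _ e)) =
      eI.symm (Ideal.Quotient.mk _ ((1 ⊗ₜ a) * e)) := by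
    intro e
    refine e.induction_on (by simp) (fun c x => ?_) fun x y hx hy => ?_
    · rw [Algebra.TensorProduct.tmul_mul_tmul, one_mul]
      rfl
    · rw [mul_add, map_add, map_add, map_add, map_add, map_add, hx, hy]
  have h1 : eP.symm (Ideal.Quotient.mk _ e) = 0 := by
    apply hinj
    rw [hcomm, Ideal.Quotient.eq_zero_iff_mem.2 he, map_zero, map_zero]
  rw [← Ideal.Quotient.eq_zero_iff_mem]
  exact (map_eq_zero_iff eP.symm eP.symm.injective).1 h1

/-- Generically, a prime that is the annihilator of an element of the fibre of `D ⧸ I` is the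
annihilator of an element of the fibre of `D ⧸ P`, for `P` in a finite set of primes. -/
lemma exists_finset_primes_of_colon [IsDomain Z] [IsNoetherianRing Z] [Algebra.FiniteType Z D]
    (I : Ideal D) :
    ∃ f : Z, f ≠ 0 ∧ ∃ S : Set (Ideal D), S.Finite ∧ (∀ P ∈ S, P.IsPrime ∧ I ≤ P) ∧
      ∀ (κ : Type u) [Field κ] [Algebra Z κ], algebraMap Z κ f ≠ 0 →
      ∀ p : Ideal (κ ⊗[Z] D), p.IsPrime → ∀ e, (∀ x, x ∈ p ↔ x * e ∈ I.fibre κ) →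
        ∃ P ∈ S, ∃ e', ∀ x, x ∈ p ↔ x * e' ∈ P.fibre κ := by
  have : IsNoetherianRing D := Algebra.FiniteType.isNoetherianRing Z D
  induction I using IsNoetherian.induction with
  | hgt I ih =>
    by_cases htop : I = ⊤
    · refine ⟨1, one_ne_zero, ∅, Set.finite_empty, by simp, fun κ _ _ _ p hp e he => ?_⟩
      refine (hp.ne_top ?_).elim
      rw [Ideal.eq_top_iff_one, he, htop, Ideal.fibre, Ideal.map_top]
      trivial
    have : Nontrivial (D ⧸ I) := Ideal.Quotient.nontrivial_iff.2 htop
    obtain ⟨P, hP⟩ := associatedPrimes.nonempty D (D ⧸ I)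
    obtain ⟨hPp, x, hx⟩ := (isAssociatedPrime_iff ..).1 hP
    obtain ⟨a, rfl⟩ := Ideal.Quotient.mk_surjective x
    have hPa : ∀ x, x ∈ P ↔ a * x ∈ I := by
      intro x
      rw [hx, Submodule.mem_colon_singleton, Submodule.mem_bot, Algebra.smul_def,
        Ideal.Quotient.algebraMap_eq, ← map_mul, Ideal.Quotient.eq_zero_iff_mem, mul_comm]
    have haI : a ∉ I := fun h => hPp.ne_top ((Ideal.eq_top_iff_one _).2 (by simpa [hPa] using h))
    have hlt : I < I ⊔ Ideal.span {a} := by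
      refine lt_of_le_of_ne le_sup_left fun h => haI ?_
      rw [h]
      exact Ideal.mem_sup_right (Ideal.mem_span_singleton_self a)
    obtain ⟨f₁, hf₁, S, hS, hSP, H₁⟩ := ih _ hlt
    obtain ⟨f₂, hf₂, H₂⟩ := exists_mem_fibre_colon (Z := Z) I a P hPa
    refine ⟨f₁ * f₂, mul_ne_zero hf₁ hf₂, insert P S, hS.insert P, ?_, ?_⟩
    · rintro Q (rfl | hQ)
      · exact ⟨hPp, fun x hx => (hPa x).2 (Ideal.mul_mem_left _ _ hx)⟩
      · exact ⟨(hSP Q hQ).1, hlt.le.trans (hSP Q hQ).2⟩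
    intro κ _ _ hκ p hp e he
    rw [map_mul] at hκ
    -- Either `p` is still the annihilator of `e` modulo `I + (a)`, and the induction applies, or
    -- some `t` outside `p` moves `e` into `I + (a)`.
    by_cases h : ∀ x, x ∈ p ↔ x * e ∈ Ideal.fibre κ (I ⊔ Ideal.span {a})
    · obtain ⟨Q, hQ, H⟩ := H₁ κ (left_ne_zero_of_mul hκ) p hp e h
      exact ⟨Q, Set.mem_insert_of_mem _ hQ, H⟩
    have : ∃ t, t ∉ p ∧ t * e ∈ Ideal.fibre κ (I ⊔ Ideal.span {a}) := by
      by_contra! hcon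
      refine h fun x => ⟨fun hx => Ideal.map_mono le_sup_left ((he x).1 hx), fun hx => ?_⟩
      by_contra hxp
      exact hcon x hxp hx
    obtain ⟨t, ht, hte⟩ := this
    rw [Ideal.fibre, Ideal.map_sup, Ideal.map_span, Set.image_singleton, sup_comm,
      Ideal.mem_span_singleton_sup] at hte
    obtain ⟨e', b, hb, hte⟩ := hte
    refine ⟨P, Set.mem_insert _ _, e', fun x => ?_⟩
    -- As `p` is prime and `t ∉ p`, it is also the annihilator of `t * e`, which is `a * e'` modulo
    -- `I`; cancelling `a` replaces `I` by `P = (I : a)`.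
    have h1 : x ∈ p ↔ x * t ∈ p := ⟨fun h => Ideal.mul_mem_right _ _ h, fun h =>
      (hp.mem_or_mem h).resolve_right ht⟩
    rw [h1, he, mul_assoc, ← hte, mul_add, Ideal.add_mem_iff_left _ (Ideal.mul_mem_left _ _ hb)]
    constructor
    · intro h
      refine H₂ κ (right_ne_zero_of_mul hκ) _ ?_
      convert h using 1
      change (1 ⊗ₜ a) * _ = x * (e' * (1 ⊗ₜ a))
      ring
    · intro h
      have : ∀ y : κ ⊗[Z] D, y ∈ P.fibre κ → y * (1 ⊗ₜ a) ∈ Ideal.fibre κ I := by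
        intro y hy
        refine Submodule.span_induction (p := fun y _ => y * (1 ⊗ₜ a) ∈ Ideal.fibre κ I) ?_ ?_ ?_ ?_ hy
        · rintro _ ⟨z, hz, rfl⟩
          have := Ideal.mem_map_of_mem (Algebra.TensorProduct.includeRight (R := Z) (A := κ))
            ((hPa z).1 hz)
          rw [map_mul, mul_comm] at this
          exact this
        · simp
        · intro y z _ _ hy hz
          rw [add_mul]
          exact add_mem hy hz
        · intro r y _ hy
          rw [smul_eq_mul, mul_assoc]
          exact Ideal.mul_mem_left _ _ hy
      have := this _ h
      rwa [mul_assoc] at this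

end Fibre

end

/-! ### Degree bounds and surjectivity of the trace -/

section

open Polynomial in
/-- A multiplicative property of natural numbers holding for `1, …, r` holds for the degree of a
field extension generated by finitely many elements of degree at most `r`. -/
lemma IntermediateField.finrank_adjoin_finset_of_natDegree_le {L M : Type u} [Field L] [Field M]
    [Algebra L M] (r : ℕ) (P : ℕ → Prop) (h1 : P 1) (hmul : ∀ a b, P a → P b → P (a * b))
    (hle : ∀ j, 1 ≤ j → j ≤ r → P j) (S : Finset M)
    (hS : ∀ c ∈ S, ∃ χ : L[X], χ.Monic ∧ χ.natDegree ≤ r ∧ aeval c χ = 0) :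
    P (Module.finrank L (IntermediateField.adjoin L (S : Set M))) := by
  classical
  induction S using Finset.induction_on with
  | empty =>
    rw [Finset.coe_empty, IntermediateField.adjoin_empty, IntermediateField.finrank_bot]
    exact h1
  | insert c S _ ih =>
    have ih := ih fun c hc => hS c (Finset.mem_insert_of_mem hc)
    obtain ⟨χ, hχ, hdeg, hroot⟩ := hS c (Finset.mem_insert_self c S)
    set F := IntermediateField.adjoin L (S : Set M)
    have hroot' : aeval c (χ.map (algebraMap L F)) = 0 := by rwa [aeval_map_algebraMap]
    have hint : IsIntegral F c := ⟨_, hχ.map _, by rwa [← aeval_def]⟩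
    -- Each simple step of the tower has degree between `1` and `r`, since an equation of `c` over
    -- `L` is also one over `F`. The full degree, by contrast, may well exceed `r`.
    have h2 : Module.finrank F (IntermediateField.adjoin F {c}) ≤ r := by
      rw [IntermediateField.adjoin.finrank hint]
      refine (natDegree_le_of_dvd (minpoly.dvd F c hroot') (hχ.map _).ne_zero).trans ?_
      rwa [natDegree_map]
    have h3 : 1 ≤ Module.finrank F (IntermediateField.adjoin F {c}) := by
      rw [IntermediateField.adjoin.finrank hint]
      exact minpoly.natDegree_pos hint
    have h4 := hmul _ _ ih (hle _ h3 h2)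
    rw [Module.finrank_mul_finrank] at h4
    have h5 : (IntermediateField.adjoin F {c}).restrictScalars L =
        IntermediateField.adjoin L ((insert c S : Finset M) : Set M) := by
      rw [IntermediateField.adjoin_adjoin_left, Finset.coe_insert, Set.union_singleton]
    rw [← h5]
    exact h4

open Polynomial in
/-- If a finite extension of domains `A ⊆ B` is such that each element of `B` has a multiple of
degree at most `r` over `A`, and `r!` is invertible, then the normalized trace is surjective. -/
lemma normalizedTraceSurjective_of_natDegree_le {A B : Type u} [CommRing A] [IsDomain A]
    [CommRing B] [IsDomain B] [Algebra A B] [FaithfulSMul A B] [Module.Finite A B] (r : ℕ)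
    (hr : IsUnit ((r.factorial : ℕ) : A))
    (h : ∀ b : B, ∃ a : A, a ≠ 0 ∧ ∃ χ : A[X], χ.Monic ∧ χ.natDegree ≤ r ∧ aeval (a • b) χ = 0) :
    NormalizedTraceSurjective A B := by
  classical
  unfold NormalizedTraceSurjective
  let _ : Algebra (FractionRing A) (FractionRing B) :=
    FractionRing.liftAlgebra A (FractionRing B)
  choose a ha hχ using h
  obtain ⟨T, hT⟩ := Module.Finite.fg_top (R := A) (M := B)
  let S : Finset (FractionRing B) := T.image fun b => algebraMap B (FractionRing B) (a b • b)
  have hfin : IsUnit ((Module.finrank (FractionRing A)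
      (IntermediateField.adjoin (FractionRing A) (S : Set (FractionRing B))) : ℕ) : A) := by
    refine IntermediateField.finrank_adjoin_finset_of_natDegree_le r (fun n => IsUnit (n : A))
      (by simp) (fun a b ha hb => by rw [Nat.cast_mul]; exact ha.mul hb) ?_ S ?_
    · intro j h1 h2
      obtain ⟨c, hc⟩ := Nat.dvd_factorial h1 h2
      rw [hc, Nat.cast_mul] at hr
      exact isUnit_of_mul_isUnit_left hr
    · intro c hc
      obtain ⟨b, -, rfl⟩ := Finset.mem_image.1 hc
      obtain ⟨χ, h1, h2, h3⟩ := hχ b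
      refine ⟨χ.map (algebraMap A _), h1.map _, (natDegree_map_le).trans h2, ?_⟩
      rw [aeval_map_algebraMap, aeval_algebraMap_apply, h3, map_zero]
  have htop : IntermediateField.adjoin (FractionRing A) (S : Set (FractionRing B)) = ⊤ := by
    set F := IntermediateField.adjoin (FractionRing A) (S : Set (FractionRing B))
    have hA : ∀ x : A, algebraMap A (FractionRing B) x ∈ F := fun x => by
      rw [IsScalarTower.algebraMap_apply A (FractionRing A) (FractionRing B)]
      exact F.algebraMap_mem _
    have hB : ∀ b : B, algebraMap B (FractionRing B) b ∈ F := by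
      intro b
      have hb : b ∈ Submodule.span A (T : Set B) := hT ▸ trivial
      induction hb using Submodule.span_induction with
      | mem b hb =>
        have h1 : algebraMap B (FractionRing B) (a b • b) ∈ F :=
          IntermediateField.subset_adjoin _ _ (Finset.mem_coe.2 (Finset.mem_image_of_mem _ hb))
        rw [Algebra.smul_def, map_mul, ← IsScalarTower.algebraMap_apply] at h1
        have h2 : algebraMap A (FractionRing B) (a b) ≠ 0 := by
          rw [Ne, FaithfulSMul.algebraMap_eq_zero_iff]
          exact ha b
        have := F.mul_mem (F.inv_mem (hA (a b))) h1
        rwa [inv_mul_cancel_left₀ h2] at this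
      | zero => rw [map_zero]; exact F.zero_mem
      | add x y _ _ hx hy => rw [map_add]; exact F.add_mem hx hy
      | smul c x _ hx =>
        rw [Algebra.smul_def, map_mul, ← IsScalarTower.algebraMap_apply]
        exact F.mul_mem (hA c) hx
    rw [eq_top_iff]
    intro x _
    obtain ⟨x, y, _, rfl⟩ := IsFractionRing.div_surjective (A := B) x
    exact F.div_mem (hB x) (hB y)
  rw [htop, IntermediateField.finrank_top'] at hfin
  set n := Module.finrank (FractionRing A) (FractionRing B)
  have hn : 0 < n := by
    rcases Nat.eq_zero_or_pos n with h0 | h0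
    · rw [h0, Nat.cast_zero] at hfin
      exact (not_isUnit_zero hfin).elim
    · exact h0
  have : FiniteDimensional (FractionRing A) (FractionRing B) := Module.finite_of_finrank_pos hn
  obtain ⟨v, hv⟩ := hfin.exists_left_inv
  refine Set.Subset.antisymm ?_ ?_
  · rintro _ ⟨x, hx, rfl⟩
    have hx' : IsIntegral B x := hx
    have : IsIntegral A x := isIntegral_trans x hx'
    exact Algebra.isIntegral_trace this
  · intro y hy
    have hy' : IsIntegral A y := hy
    -- The preimage is `y / n`, with `v` the inverse of the degree `n` in `A`.
    refine ⟨algebraMap _ _ (v • y), ?_, ?_⟩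
    · have h1 : IsIntegral A (algebraMap (FractionRing A) (FractionRing B) (v • y)) :=
        (hy'.smul v).algebraMap
      exact h1.tower_top (A := B)
    · rw [Algebra.trace_algebraMap, ← Nat.cast_smul_eq_nsmul A, smul_smul, mul_comm]
      change (v * (n : A)) • y = y
      rw [hv, one_smul]

/-! ### Uniform bounds on normalizations and the primes minimal over the conductor -/

open Polynomial in
/-- The element `d` of `E` multiplies elements of localizations of `E` that are integral over `E`
into `E`, and such elements have degree at most `r` over `E`. -/
def BoundsNormalization (E : Type u) [CommRing E] (d : E) (r : ℕ) : Prop :=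
  ∀ (Q : Type u) [CommRing Q] [Algebra E Q] (M : Submonoid E) [IsLocalization M Q] (z : Q),
    IsIntegral E z → (∃ e, algebraMap E Q e = algebraMap E Q d * z) ∧
      ∃ χ : E[X], χ.Monic ∧ χ.natDegree ≤ r ∧ aeval z χ = 0

namespace BoundsNormalization

variable {E R : Type u} [CommRing E] [CommRing R] [Algebra E R]

/-- A denominator `m` from `M` turns integrality over `R` into integrality over `E`. The total
fraction ring of `R` is itself a localization of `E`, so the bound applies to it. -/
lemma exists_smul_integral {d : E} {r : ℕ} (h : BoundsNormalization E d r)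
    (M : Submonoid E) [IsLocalization M R] (z : FractionRing R) (hz : IsIntegral R z) :
    ∃ m ∈ M, (∃ e, algebraMap E (FractionRing R) e = algebraMap E _ d * algebraMap E _ m * z) ∧
      ∃ χ : Polynomial E, χ.Monic ∧ χ.natDegree ≤ r ∧ Polynomial.aeval (m • z) χ = 0 := by
  obtain ⟨m, hm⟩ := IsIntegral.exists_multiple_integral_of_isLocalization M z hz
  have := IsLocalization.localization_localization_isLocalization M (nonZeroDivisors R)
    (FractionRing R)
  obtain ⟨⟨e, he⟩, hχ⟩ := h (FractionRing R)
    (IsLocalization.localizationLocalizationSubmodule M (nonZeroDivisors R)) _ hm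
  refine ⟨m, m.2, ⟨e, ?_⟩, hχ⟩
  rw [he, Submonoid.smul_def, Algebra.smul_def, mul_assoc]

lemma exists_algebraMap_eq {d : E} {r : ℕ} (h : BoundsNormalization E d r)
    (M : Submonoid E) [IsLocalization M R] (z : FractionRing R) (hz : IsIntegral R z) :
    ∃ ρ : R, algebraMap R (FractionRing R) ρ = algebraMap E _ d * z := by
  obtain ⟨m, hm, ⟨e, he⟩, -⟩ := h.exists_smul_integral M z hz
  obtain ⟨v, hv⟩ := (IsLocalization.map_units R ⟨m, hm⟩).exists_left_inv
  refine ⟨v * algebraMap E R e, ?_⟩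
  have hv' := congrArg (algebraMap R (FractionRing R)) hv
  rw [map_mul, map_one, ← IsScalarTower.algebraMap_apply] at hv'
  rw [map_mul, ← IsScalarTower.algebraMap_apply, he]
  linear_combination (algebraMap E (FractionRing R) d * z) * hv'

lemma algebraMap_mem_nonZeroDivisors {d : E} (hd : d ∈ nonZeroDivisors E)
    (M : Submonoid E) [IsLocalization M R] : algebraMap E R d ∈ nonZeroDivisors R :=
  IsLocalization.map_nonZeroDivisors_le M R ⟨d, hd, rfl⟩

/-- Multiplication by the regular element `d` embeds the normalization into the noetherian ring `R`.
-/
lemma finite_normalization [IsNoetherianRing E] {d : E} {r : ℕ} (h : BoundsNormalization E d r)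
    (hd : d ∈ nonZeroDivisors E) (M : Submonoid E) [IsLocalization M R] :
    Module.Finite R (Normalization R) := by
  have : IsNoetherianRing R := IsLocalization.isNoetherianRing M R ‹_›
  have hdR := algebraMap_mem_nonZeroDivisors (R := R) hd M
  have hu := IsLocalization.map_units (FractionRing R) (⟨_, hdR⟩ : nonZeroDivisors R)
  have hinj : Function.Injective (Algebra.linearMap R (FractionRing R)) :=
    IsFractionRing.injective R (FractionRing R)
  let μ : Normalization R →ₗ[R] LinearMap.range (Algebra.linearMap R (FractionRing R)) :=
    LinearMap.codRestrict _ ((LinearMap.lsmul R _ (algebraMap E R d)) ∘ₗ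
      (Normalization R).val.toLinearMap) fun z => by
      obtain ⟨ρ, hρ⟩ := h.exists_algebraMap_eq M z.1 z.2
      refine ⟨ρ, ?_⟩
      change algebraMap R _ ρ = algebraMap E R d • z.1
      rw [hρ, Algebra.smul_def, ← IsScalarTower.algebraMap_apply]
  have hμ : Function.Injective μ := by
    intro x y hxy
    have := congrArg Subtype.val hxy
    replace this : algebraMap E R d • x.1 = algebraMap E R d • y.1 := this
    rw [Algebra.smul_def, Algebra.smul_def] at this
    exact Subtype.ext (hu.mul_left_cancel this)
  exact Module.Finite.of_injective μ hμ

/-- A minimal prime of the conductor of a localization of `E` is an associated prime of `E ⧸ d`. -/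
lemma exists_colon_of_mem_minimalPrimes [IsNoetherianRing E] {d : E} {r : ℕ}
    (h : BoundsNormalization E d r) (hd : d ∈ nonZeroDivisors E) (M : Submonoid E)
    [IsLocalization M R] (p : Ideal R) (hp : p ∈ (conductorIdeal R).minimalPrimes) :
    ∃ e, ∀ x, x ∈ p.comap (algebraMap E R) ↔ x * e ∈ Ideal.span {d} := by
  have : IsNoetherianRing R := IsLocalization.isNoetherianRing M R ‹_›
  have := h.finite_normalization (R := R) hd M
  have hdR := algebraMap_mem_nonZeroDivisors (R := R) hd M
  -- The conductor is the annihilator of the finite module `Rᴺ / R`, so `p` is the annihilator of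
  -- the class of some `z`.
  have hass := Module.associatedPrimes.minimalPrimes_annihilator_subset_associatedPrimes R _ hp
  obtain ⟨hpp, x, hx⟩ := (isAssociatedPrime_iff ..).1 hass
  obtain ⟨z, rfl⟩ := Submodule.mkQ_surjective _ x
  have hinj : Function.Injective (algebraMap R (FractionRing R)) :=
    IsFractionRing.injective R (FractionRing R)
  have hmem : ∀ y : R, y ∈ p ↔ ∃ ρ : R, algebraMap R (FractionRing R) ρ = algebraMap R _ y * z := by
    intro y
    rw [hx, Submodule.mem_colon_singleton, Submodule.mem_bot, ← map_smul, Submodule.mkQ_apply,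
      Submodule.Quotient.mk_eq_zero, LinearMap.mem_range]
    refine exists_congr fun ρ => ?_
    rw [Subtype.ext_iff, ← Algebra.smul_def]
    rfl
  obtain ⟨m, hm, ⟨e, he⟩, -⟩ := h.exists_smul_integral M z.1 z.2
  -- Here `e = d m z`, so `a z ∈ R` means `a e ∈ d E` up to a factor from `M`.
  have hloc : ∀ a : E, a ∈ p.comap (algebraMap E R) ↔ ∃ μ ∈ M, μ * a * e ∈ Ideal.span {d} := by
    intro a
    rw [Ideal.mem_comap, hmem]
    constructor
    · rintro ⟨ρ, hρ⟩
      have h1 : algebraMap E R a * algebraMap E R e =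
          algebraMap E R d * (algebraMap E R m * ρ) := by
        apply hinj
        simp only [map_mul, ← IsScalarTower.algebraMap_apply E R (FractionRing R)] at hρ ⊢
        rw [he, hρ]
        ring
      obtain ⟨⟨s, t⟩, hst⟩ := IsLocalization.surj M (algebraMap E R m * ρ)
      have h2 : algebraMap E R (t * a * e) = algebraMap E R (d * s) := by
        simp only [map_mul] at hst ⊢
        linear_combination (algebraMap E R t) * h1 + algebraMap E R d * hst
      obtain ⟨c, hc⟩ := (IsLocalization.eq_iff_exists M R).1 h2
      refine ⟨c * t, M.mul_mem c.2 t.2, Ideal.mem_span_singleton.2 ⟨c * s, ?_⟩⟩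
      linear_combination hc
    · rintro ⟨μ, hμ, h1⟩
      obtain ⟨s, hs⟩ := Ideal.mem_span_singleton.1 h1
      obtain ⟨v, hv⟩ := (IsLocalization.map_units R (⟨μ * m, M.mul_mem hμ hm⟩ : M)).exists_left_inv
      refine ⟨v * algebraMap E R s, ?_⟩
      have hu := IsLocalization.map_units (FractionRing R) (⟨_, hdR⟩ : nonZeroDivisors R)
      refine hu.mul_left_cancel ?_
      have hv' := congrArg (algebraMap R (FractionRing R)) hv
      have hs' := congrArg (algebraMap E (FractionRing R)) hs
      simp only [map_mul, map_one, ← IsScalarTower.algebraMap_apply E R (FractionRing R)]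
        at hv' hs' ⊢
      rw [he] at hs'
      linear_combination (algebraMap E (FractionRing R) d * algebraMap E (FractionRing R) a * z.1) * hv' - (algebraMap R (FractionRing R) v) * hs'
  -- The contracted prime is finitely generated, so one factor `μ` serves all its elements and can
  -- be absorbed into `e`.
  have hfg : ∃ μ ∈ M, ∀ a ∈ p.comap (algebraMap E R), μ * a * e ∈ Ideal.span {d} := by
    have key : ∀ I : Ideal E, I.FG → I ≤ p.comap (algebraMap E R) →
        ∃ μ ∈ M, ∀ a ∈ I, μ * a * e ∈ Ideal.span {d} := by
      intro I hI
      refine Submodule.fg_induction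
        (motive := fun I _ => I ≤ p.comap (algebraMap E R) →
          ∃ μ ∈ M, ∀ a ∈ I, μ * a * e ∈ Ideal.span {d}) ?_ ?_ I hI
      · intro x hx
        obtain ⟨μ, hμ, h1⟩ := (hloc x).1 (hx (Submodule.mem_span_singleton_self x))
        refine ⟨μ, hμ, fun a ha => ?_⟩
        obtain ⟨c, rfl⟩ := Ideal.mem_span_singleton'.1 ha
        convert Ideal.mul_mem_left _ c h1 using 1
        ring
      · intro I₁ I₂ _ _ h₁ h₂ hle
        obtain ⟨μ₁, hμ₁, h₁⟩ := h₁ (le_sup_left.trans hle)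
        obtain ⟨μ₂, hμ₂, h₂⟩ := h₂ (le_sup_right.trans hle)
        refine ⟨μ₁ * μ₂, M.mul_mem hμ₁ hμ₂, fun a ha => ?_⟩
        obtain ⟨x, hx, y, hy, rfl⟩ := Submodule.mem_sup.1 ha
        convert add_mem (Ideal.mul_mem_left _ μ₂ (h₁ x hx)) (Ideal.mul_mem_left _ μ₁ (h₂ y hy))
          using 1
        ring
    exact key _ (IsNoetherian.noetherian _) le_rfl
  obtain ⟨μ, hμ, h1⟩ := hfg
  refine ⟨μ * e, fun x => ⟨fun hx => ?_, fun hx => (hloc x).2 ⟨μ, hμ, ?_⟩⟩⟩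
  · convert h1 x hx using 1; ring
  · convert hx using 1; ring

/-- A class modulo `q` lifts to some `z` in the normalization. A multiple `m z`, with `m` a unit of
`R`, has an equation of degree at most `r` over `E`, which is reduced modulo `q`. -/
lemma normalizedTraceSurjective [IsNoetherianRing E] {d : E} {r : ℕ}
    (h : BoundsNormalization E d r) (hd : d ∈ nonZeroDivisors E)
    (hr : IsUnit ((r.factorial : ℕ) : E)) (M : Submonoid E)
    [IsLocalization M R] (p : Ideal R) (q : Ideal (Normalization R)) [p.IsPrime] [q.IsPrime]
    [q.LiesOver p] : NormalizedTraceSurjective (R ⧸ p) (Normalization R ⧸ q) := by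
  have := h.finite_normalization (R := R) hd M
  refine normalizedTraceSurjective_of_natDegree_le r ?_ fun b => ?_
  · have := hr.map ((Ideal.Quotient.mk p).comp (algebraMap E R))
    rwa [map_natCast] at this
  · obtain ⟨z, rfl⟩ := Ideal.Quotient.mk_surjective b
    obtain ⟨m, hm, -, χ, h1, h2, h3⟩ := h.exists_smul_integral M z.1 z.2
    have hu : IsUnit (Ideal.Quotient.mk p (algebraMap E R m)) :=
      (IsLocalization.map_units R ⟨m, hm⟩).map _
    refine ⟨_, hu.ne_zero, χ.map ((Ideal.Quotient.mk p).comp (algebraMap E R)), h1.map _,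
      Polynomial.natDegree_map_le.trans h2, ?_⟩
    have h4 : Polynomial.aeval (algebraMap E R m • z) (χ.map (algebraMap E R)) = 0 := by
      apply Subtype.val_injective
      have := Polynomial.aeval_algHom_apply (Normalization R).val (algebraMap E R m • z)
        (χ.map (algebraMap E R))
      refine Eq.trans this.symm ?_
      rw [Polynomial.aeval_map_algebraMap]
      have : (Normalization R).val (algebraMap E R m • z) = m • z.1 := algebraMap_smul R m z.1
      rw [this, h3]
      rfl
    have h5 := congrArg (Ideal.Quotient.mk q) h4
    rw [map_zero, Polynomial.aeval_def, Polynomial.eval₂_map, Polynomial.hom_eval₂] at h5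
    rw [Polynomial.aeval_def, Polynomial.eval₂_map]
    exact h5

end BoundsNormalization

end

/-! ### Generically monogenic integral extensions of normal domains -/

section

/-- A ring homomorphism on `S` extends along `j : S → E` if each element of `E` is multiplied into
the image of `j` by a power of an element which becomes invertible. -/
lemma exists_ringHom_of_pow_mul_eq {S E T : Type*} [CommRing S] [CommRing E] [CommRing T]
    (j : S →+* E) (φ : S →+* T) (w : S) (hw : IsUnit (φ w)) (hker : ∀ s, j s = 0 → φ s = 0)
    (h : ∀ e, ∃ (k : ℕ) (s : S), j w ^ k * e = j s) :
    ∃ ψ : E →+* T, ∀ s, ψ (j s) = φ s := by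
  choose k s hs using h
  obtain ⟨u, hu⟩ := hw.exists_left_inv
  have huk : ∀ n, u ^ n * φ w ^ n = 1 := fun n => by rw [← mul_pow, hu, one_pow]
  have key : ∀ e k' s', j w ^ k' * e = j s' → φ w ^ k' * (u ^ k e * φ (s e)) = φ s' := by
    intro e k' s' h'
    have h1 : j (w ^ k' * s e - w ^ k e * s') = 0 := by
      rw [map_sub, map_mul, map_mul, map_pow, map_pow, ← hs, ← h']
      ring
    have h2 := hker _ h1
    rw [map_sub, map_mul, map_mul, map_pow, map_pow] at h2
    linear_combination (u ^ k e) * h2 + φ s' * huk (k e)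
  have cancel : ∀ n (a b : T), φ w ^ n * a = φ w ^ n * b → a = b := fun n a b hab => by
    have := congrArg (u ^ n * ·) hab
    simp only [← mul_assoc, huk, one_mul] at this
    exact this
  refine ⟨⟨⟨⟨fun e => u ^ k e * φ (s e), ?_⟩, ?_⟩, ?_, ?_⟩, ?_⟩
  · simpa using key 1 0 1 (by simp)
  · intro x y
    apply cancel (k x + k y)
    rw [key (x * y) (k x + k y) (s x * s y) (by
      rw [map_mul, ← hs, ← hs]; ring), map_mul]
    linear_combination (-φ (s y) * u ^ k y * φ w ^ k y) * φ (s x) * huk (k x) -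
      φ (s x) * φ (s y) * huk (k y)
  · simpa using key 0 0 0 (by simp)
  · intro x y
    apply cancel (k x + k y)
    change φ w ^ (k x + k y) * (u ^ k (x + y) * φ (s (x + y))) = _
    rw [key (x + y) (k x + k y) (w ^ k y * s x + w ^ k x * s y) (by
      rw [map_add, map_mul, map_mul, ← hs, ← hs, map_pow, map_pow]; ring), map_add, map_mul,
      map_mul, map_pow, map_pow]
    linear_combination (-φ w ^ k y) * φ (s x) * huk (k x) - (φ w ^ k x) * φ (s y) * huk (k y)
  · intro s'
    simpa using key (j s') 0 s' (by simp)

open Polynomial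

/-- `E` is, up to inverting `w`, generated over `A` by one element `θ` with minimal polynomial
`F`, and `F'(θ)` is regular. -/
structure GenericallyMonogenic (A E : Type u) [CommRing A] [CommRing E] [Algebra A E] (θ : E)
    (F : A[X]) (w : A) : Prop where
  monic : F.Monic
  aeval_eq_zero : aeval θ F = 0
  dvd_of_aeval_eq_zero : ∀ B : A[X], aeval θ B = 0 → F ∣ B
  exists_pow_smul_eq : ∀ e : E, ∃ (k : ℕ) (B : A[X]), w ^ k • e = aeval θ B
  eq_zero_of_smul_eq_zero : ∀ e : E, w • e = 0 → e = 0
  derivative_mem : aeval θ (derivative F) ∈ nonZeroDivisors E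
  ne_zero : w ≠ 0

/-- Lagrange interpolation: every summand but the `i`-th vanishes at `t i`. With all `c j = 1` this
evaluates the derivative of the product of the `X - t j`. -/
lemma Polynomial.eval_sum_prod_erase {I R : Type*} [DecidableEq I] [Fintype I] [CommRing R]
    (c t : I → R) (i : I) :
    eval (t i) (∑ j, C (c j) * ∏ l ∈ Finset.univ.erase j, (X - C (t l))) =
      c i * ∏ l ∈ Finset.univ.erase i, (t i - t l) := by
  rw [eval_finsetSum, Finset.sum_eq_single i]
  · simp [eval_prod]
  · intro j _ hj
    rw [eval_mul, eval_prod, Finset.prod_eq_zero (i := i), mul_zero]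
    · exact Finset.mem_erase.2 ⟨hj.symm, Finset.mem_univ _⟩
    · simp
  · simp

lemma Polynomial.derivative_prod_X_sub_C {I R : Type*} [DecidableEq I] [Fintype I] [CommRing R]
    (t : I → R) : derivative (∏ i, (X - C (t i))) =
      ∑ j, C 1 * ∏ l ∈ Finset.univ.erase j, (X - C (t l)) := by
  rw [derivative_prod_finset]
  simp

namespace GenericallyMonogenic

variable {A E : Type u} [CommRing A] [CommRing E] [Algebra A E] {θ : E}
    {F : A[X]} {w : A}

lemma eq_zero_of_pow_smul_eq_zero (h : GenericallyMonogenic A E θ F w) (k : ℕ) (e : E)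
    (he : w ^ k • e = 0) : e = 0 := by
  induction k with
  | zero => simpa using he
  | succ k ih =>
    rw [pow_succ', mul_smul] at he
    exact ih (h.eq_zero_of_smul_eq_zero _ he)

/-- Regularity of `F'(θ)` says that `F ∣ F' B` forces `F ∣ B`, also over `K` after clearing
denominators. For `B = F / gcd(F, F')` this makes the gcd a unit. -/
lemma separable (h : GenericallyMonogenic A E θ F w) (K : Type*) [IsDomain A] [Field K]
    [Algebra A K] [IsFractionRing A K] : (F.map (algebraMap A K)).Separable := by
  have hinj := IsFractionRing.injective A K
  have key : ∀ B : K[X], F.map (algebraMap A K) ∣ (derivative F).map (algebraMap A K) * B →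
      F.map (algebraMap A K) ∣ B := by
    intro B hB
    obtain ⟨b, hb, hB0⟩ := IsLocalization.integerNormalization_spec (nonZeroDivisors A) B
    have hb0 : algebraMap A K b ≠ 0 := by
      rw [Ne, map_eq_zero_iff _ hinj]
      exact nonZeroDivisors.ne_zero hb
    set B0 := IsLocalization.integerNormalization (nonZeroDivisors A) B
    have hB0' : B0.map (algebraMap A K) = C (algebraMap A K b) * B := by
      rw [hB0, ← smul_eq_C_mul, algebraMap_smul]
    have h1 : F ∣ derivative F * B0 := by
      rw [← map_dvd_map _ hinj h.monic, Polynomial.map_mul, hB0', mul_left_comm]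
      exact hB.mul_left _
    obtain ⟨G, hG⟩ := h1
    have h2 : aeval θ B0 = 0 := by
      refine (mem_nonZeroDivisors_iff.1 h.derivative_mem).1 _ ?_
      rw [← map_mul, hG, map_mul, h.aeval_eq_zero, zero_mul]
    have h3 := (map_dvd_map _ hinj h.monic).2 (h.dvd_of_aeval_eq_zero _ h2)
    rw [hB0'] at h3
    have hu : IsUnit (C (algebraMap A K b)) := isUnit_C.2 hb0.isUnit
    exact hu.dvd_mul_left.1 h3
  classical
  rw [separable_def, ← EuclideanDomain.gcd_isUnit_iff]
  set f := F.map (algebraMap A K)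
  have hf : f.Monic := h.monic.map _
  obtain ⟨C', hC⟩ := EuclideanDomain.gcd_dvd_left f (derivative f)
  obtain ⟨D', hD⟩ := EuclideanDomain.gcd_dvd_right f (derivative f)
  set H := EuclideanDomain.gcd f (derivative f)
  have h1 : f ∣ C' := key C' (by
    rw [← derivative_map]
    refine ⟨D', ?_⟩
    calc derivative f * C' = (H * D') * C' := by rw [← hD]
      _ = (H * C') * D' := by ring
      _ = f * D' := by rw [← hC])
  obtain ⟨G, hG⟩ := h1
  have h2 : f * (H * G) = f * 1 := by
    calc f * (H * G) = H * (f * G) := by ring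
      _ = H * C' := by rw [← hG]
      _ = f * 1 := by rw [← hC, mul_one]
  exact IsUnit.of_mul_eq_one _ (mul_left_cancel₀ hf.ne_zero h2)

section Embeddings

variable {Ω : Type u} [Field Ω] [Algebra A Ω]

/-- Evaluation of `A[X]` at the root `t` kills the kernel of evaluation at `θ`, which is generated
by `F`. It extends to `E` because `w` becomes invertible in `Ω`. -/
lemma exists_algHom [FaithfulSMul A Ω] (h : GenericallyMonogenic A E θ F w) (t : Ω)
    (ht : aeval t F = 0) : ∃ ε : E →ₐ[A] Ω, ε θ = t := by
  have hker : ∀ s : A[X], (aeval θ).toRingHom s = 0 → (aeval t).toRingHom s = 0 := by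
    intro s hs
    obtain ⟨G, rfl⟩ := h.dvd_of_aeval_eq_zero s hs
    change aeval t _ = 0
    rw [map_mul, ht, zero_mul]
  obtain ⟨ψ, hψ⟩ := exists_ringHom_of_pow_mul_eq (aeval θ : A[X] →ₐ[A] E).toRingHom
    (aeval t : A[X] →ₐ[A] Ω).toRingHom (C w) (by
      change IsUnit (aeval t (C w))
      rw [aeval_C]
      refine IsUnit.mk0 _ ?_
      rw [Ne, FaithfulSMul.algebraMap_eq_zero_iff]
      exact h.ne_zero) hker (fun e => by
      obtain ⟨k, B, hB⟩ := h.exists_pow_smul_eq e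
      refine ⟨k, B, ?_⟩
      change aeval θ (C w) ^ k * e = aeval θ B
      rw [← hB, aeval_C, Algebra.smul_def, map_pow])
  refine ⟨⟨ψ, fun a => ?_⟩, ?_⟩
  · have := hψ (C a)
    change ψ (aeval θ (C a)) = aeval t (C a) at this
    rw [aeval_C, aeval_C] at this
    exact this
  · have := hψ X
    change ψ (aeval θ X) = aeval t X at this
    rw [aeval_X, aeval_X] at this
    exact this

lemma algHom_apply (ε : E →ₐ[A] Ω) (B : A[X]) : ε (aeval θ B) = aeval (ε θ) B :=
  (aeval_algHom_apply ε θ B).symm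

lemma algHom_eq_zero_iff [FaithfulSMul A Ω] (h : GenericallyMonogenic A E θ F w) (ε : E →ₐ[A] Ω)
    {k : ℕ} {e : E} {B : A[X]} (hB : w ^ k • e = aeval θ B) :
    ε e = 0 ↔ aeval (ε θ) B = 0 := by
  rw [← algHom_apply, ← hB, map_smul, Algebra.smul_def, mul_eq_zero, or_iff_right]
  rw [map_pow]
  refine pow_ne_zero _ ?_
  rw [Ne, FaithfulSMul.algebraMap_eq_zero_iff]
  exact h.ne_zero

lemma algHom_injective [FaithfulSMul A Ω] (h : GenericallyMonogenic A E θ F w) :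
    Function.Injective fun ε : E →ₐ[A] Ω => ε θ := by
  intro ε ε' hεε
  ext e
  obtain ⟨k, B, hB⟩ := h.exists_pow_smul_eq e
  have h0 : algebraMap A Ω (w ^ k) ≠ 0 := by
    rw [map_pow]
    refine pow_ne_zero _ ?_
    rw [Ne, FaithfulSMul.algebraMap_eq_zero_iff]
    exact h.ne_zero
  refine mul_left_cancel₀ h0 ?_
  rw [← Algebra.smul_def, ← Algebra.smul_def, ← map_smul, ← map_smul, hB, algHom_apply,
    algHom_apply]
  exact congrArg (fun t => aeval t B) hεε

lemma finite_algHom [FaithfulSMul A Ω] (h : GenericallyMonogenic A E θ F w) :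
    Finite (E →ₐ[A] Ω) := by
  classical
  refine Finite.of_injective (β := (F.map (algebraMap A Ω)).roots.toFinset)
    (fun ε => ⟨ε θ, ?_⟩) fun ε ε' hεε => h.algHom_injective (congrArg Subtype.val hεε)
  rw [Multiset.mem_toFinset, mem_roots (h.monic.map _).ne_zero, IsRoot.def, eval_map_algebraMap,
    ← algHom_apply, h.aeval_eq_zero, map_zero]

lemma map_eq_prod [FaithfulSMul A Ω] [Fintype (E →ₐ[A] Ω)] (h : GenericallyMonogenic A E θ F w)
    (hs : (F.map (algebraMap A Ω)).Splits) (hsep : (F.map (algebraMap A Ω)).Separable) :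
    F.map (algebraMap A Ω) = ∏ ε : E →ₐ[A] Ω, (X - C (ε θ)) := by
  classical
  have h1 : (F.map (algebraMap A Ω)).roots =
      (Finset.univ : Finset (E →ₐ[A] Ω)).val.map fun ε => ε θ := by
    refine (Multiset.Nodup.ext (nodup_roots hsep)
      (Multiset.Nodup.map h.algHom_injective Finset.univ.nodup)).2 fun t => ?_
    rw [mem_roots (h.monic.map _).ne_zero, IsRoot.def, eval_map_algebraMap, Multiset.mem_map]
    constructor
    · intro ht
      obtain ⟨ε, hε⟩ := h.exists_algHom t ht
      exact ⟨ε, Finset.mem_univ _, hε⟩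
    · rintro ⟨ε, -, rfl⟩
      rw [← algHom_apply, h.aeval_eq_zero, map_zero]
  rw [hs.eq_prod_roots_of_monic (h.monic.map _), h1, Multiset.map_map]
  rfl

/-- If `w ^ k • e = B(θ)`, then `B` vanishes at all the distinct roots of `F`, so `F ∣ B`. Thus `E`
embeds into a finite power of the field `Ω`. -/
lemma eq_zero_of_forall_algHom [FaithfulSMul A Ω] (h : GenericallyMonogenic A E θ F w)
    (hs : (F.map (algebraMap A Ω)).Splits) (hsep : (F.map (algebraMap A Ω)).Separable)
    (e : E) (he : ∀ ε : E →ₐ[A] Ω, ε e = 0) : e = 0 := by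
  have := h.finite_algHom (Ω := Ω)
  have := Fintype.ofFinite (E →ₐ[A] Ω)
  obtain ⟨k, B, hB⟩ := h.exists_pow_smul_eq e
  have h1 : F ∣ B := by
    rw [← map_dvd_map _ (FaithfulSMul.algebraMap_injective A Ω) h.monic, h.map_eq_prod hs hsep]
    refine Finset.prod_dvd_of_coprime ?_ fun ε _ => ?_
    · intro ε _ ε' _ hne
      exact pairwise_coprime_X_sub_C h.algHom_injective hne
    · rw [dvd_iff_isRoot, IsRoot.def, eval_map_algebraMap]
      exact (h.algHom_eq_zero_iff ε hB).1 (he ε)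
  obtain ⟨G, rfl⟩ := h1
  refine h.eq_zero_of_pow_smul_eq_zero k e ?_
  rw [hB, map_mul, h.aeval_eq_zero, zero_mul]

/-- A Galois-invariant polynomial with integral coefficients has coefficients in the normal
domain `A`. -/
lemma _root_.Polynomial.exists_map_eq_of_fixed (K : Type*) [IsDomain A] [IsIntegrallyClosed A]
    [Field K] [Algebra A K] [IsFractionRing A K] [Algebra K Ω] [IsScalarTower A K Ω]
    [FiniteDimensional K Ω] [IsGalois K Ω] (P : Polynomial Ω)
    (hint : P ∈ lifts (algebraMap (integralClosure A Ω) Ω))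
    (hfix : ∀ σ : Ω ≃ₐ[K] Ω, P.map σ.toRingHom = P) : ∃ P₀ : A[X], P₀.map (algebraMap A Ω) = P := by
  rw [← mem_lifts, lifts_iff_coeff_lifts]
  rw [lifts_iff_coeff_lifts] at hint
  intro n
  have h1 : P.coeff n ∈ Set.range (algebraMap K Ω) := by
    rw [IsGalois.mem_range_algebraMap_iff_fixed]
    intro σ
    conv_rhs => rw [← hfix σ, coeff_map]
    rfl
  obtain ⟨c, hc⟩ := h1
  obtain ⟨⟨b, hb⟩, hbc⟩ := hint n
  replace hbc : b = P.coeff n := hbc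
  have h2 : IsIntegral A c := by
    rw [← isIntegral_algebraMap_iff (algebraMap K Ω).injective, hc, ← hbc]
    exact hb
  obtain ⟨a, ha⟩ := IsIntegrallyClosed.isIntegral_iff.1 h2
  exact ⟨a, by rw [IsScalarTower.algebraMap_apply A K Ω, ha, hc]⟩

/-- Let `ζ ε` be the image of `z` under the embedding `ε`. The polynomials `H = ∑ ζ ε ∏_{ε' ≠ ε} (X
- ε' θ)` and `χ = ∏ (X - ζ ε)` are Galois invariant with integral coefficients, so they come from
the normal domain `A`. At `ε θ` the value of `H` is `F'(ε θ) ζ ε`, whence `H(θ) = F'(θ) z`; moreover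
`χ(z) = 0`. -/
lemma boundsNormalization_aux (K : Type*) [IsDomain A] [IsIntegrallyClosed A]
    [Field K] [Algebra A K] [IsFractionRing A K] [Algebra K Ω] [IsScalarTower A K Ω]
    [FiniteDimensional K Ω] [IsGalois K Ω] [FaithfulSMul A Ω] [Algebra.IsIntegral A E]
    (h : GenericallyMonogenic A E θ F w)
    (hs : (F.map (algebraMap A Ω)).Splits) (hsep : (F.map (algebraMap A Ω)).Separable) :
    BoundsNormalization E (aeval θ (derivative F)) F.natDegree := by
  classical
  intro Q _ _ M _ z hz
  have := h.finite_algHom (Ω := Ω)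
  have := Fintype.ofFinite (E →ₐ[A] Ω)
  have hprod := h.map_eq_prod hs hsep
  -- Only the embeddings that make `M` invertible extend to the localization `Q`.
  let Good : (E →ₐ[A] Ω) → Prop := fun ε => ∀ m : M, IsUnit (ε m)
  let εQ : ∀ ε, Good ε → Q →+* Ω := fun ε hε => IsLocalization.lift (M := M) (g := ε.toRingHom) hε
  have hεQ : ∀ ε hε e, εQ ε hε (algebraMap E Q e) = ε e := fun ε hε e =>
    IsLocalization.lift_eq (M := M) hε e
  have hzero : ∀ q : Q, (∀ ε hε, εQ ε hε q = 0) → q = 0 := by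
    intro q hq
    obtain ⟨a, m, rfl⟩ := IsLocalization.exists_mk'_eq M q
    have ha : ∀ ε, Good ε → ε a = 0 := fun ε hε => by
      rw [← hεQ ε hε, ← IsLocalization.mk'_spec Q a m, map_mul, hq ε hε, zero_mul]
    -- Every other embedding kills some element of `M`. Multiplying by the product of these
    -- elements, a unit of `Q`, makes the remaining embeddings irrelevant.
    have hbad : ∀ ε : E →ₐ[A] Ω, ∃ n : M, ¬ Good ε → ε n = 0 := by
      intro ε
      by_cases hε : Good ε
      · exact ⟨1, fun h => (h hε).elim⟩
      · obtain ⟨n, hn⟩ := not_forall.1 hε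
        exact ⟨n, fun _ => by simpa using hn⟩
    choose n hn using hbad
    rw [IsLocalization.mk'_eq_zero_iff]
    refine ⟨∏ ε, n ε, h.eq_zero_of_forall_algHom hs hsep _ fun ε => ?_⟩
    rw [map_mul, Submonoid.coe_finsetProd, map_prod]
    by_cases hε : Good ε
    · rw [ha ε hε, mul_zero]
    · rw [Finset.prod_eq_zero (Finset.mem_univ ε) (hn ε hε), zero_mul]
  -- The default `0` is integral and compatible with the Galois action, and identities in `Q` are
  -- never tested at those embeddings. Keeping them in the product fixes the degree at `deg F`.
  let ζ : (E →ₐ[A] Ω) → Ω := fun ε => if hε : Good ε then εQ ε hε z else 0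
  have hζint : ∀ ε, IsIntegral A (ζ ε) := by
    intro ε
    by_cases hε : Good ε
    · simp only [ζ, dif_pos hε]
      let _ : Algebra E Ω := ε.toRingHom.toAlgebra
      have : IsScalarTower A E Ω := IsScalarTower.of_algebraMap_eq fun a => (ε.commutes a).symm
      have h1 : IsIntegral E (εQ ε hε z) :=
        hz.map (⟨εQ ε hε, hεQ ε hε⟩ : Q →ₐ[E] Ω)
      exact isIntegral_trans _ h1
    · simp only [ζ, dif_neg hε]
      exact isIntegral_zero
  have hθint : ∀ ε : E →ₐ[A] Ω, IsIntegral A (ε θ) := fun ε =>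
    (Algebra.IsIntegral.isIntegral θ).map ε
  have hlift : ∀ c : Ω, IsIntegral A c → C c ∈ lifts (algebraMap (integralClosure A Ω) Ω) :=
    fun c hc => C_mem_lifts _ (⟨c, hc⟩ : integralClosure A Ω)
  have hliftX : ∀ c : Ω, IsIntegral A c → X - C c ∈ lifts (algebraMap (integralClosure A Ω) Ω) :=
    fun c hc => by
      rw [sub_eq_add_neg, ← C_neg]
      exact add_mem (X_mem_lifts _) (hlift _ hc.neg)
  let τ : (Ω ≃ₐ[K] Ω) → (E →ₐ[A] Ω) ≃ (E →ₐ[A] Ω) := fun σ =>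
    { toFun := fun ε => ((σ.restrictScalars A : Ω ≃ₐ[A] Ω) : Ω →ₐ[A] Ω).comp ε
      invFun := fun ε => ((σ.symm.restrictScalars A : Ω ≃ₐ[A] Ω) : Ω →ₐ[A] Ω).comp ε
      left_inv := fun ε => AlgHom.ext fun e => σ.symm_apply_apply (ε e)
      right_inv := fun ε => AlgHom.ext fun e => σ.apply_symm_apply (ε e) }
  have hτ : ∀ σ ε e, τ σ ε e = σ (ε e) := fun σ ε e => rfl
  have hζτ : ∀ σ ε, ζ (τ σ ε) = σ (ζ ε) := by
    intro σ ε
    have hiff : Good (τ σ ε) ↔ Good ε := forall_congr' fun m => by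
      rw [hτ, isUnit_iff_ne_zero, isUnit_iff_ne_zero, Ne, Ne, map_eq_zero]
    by_cases hε : Good ε
    · simp only [ζ, dif_pos hε, dif_pos (hiff.2 hε)]
      have : εQ (τ σ ε) (hiff.2 hε) = (σ : Ω →+* Ω).comp (εQ ε hε) := by
        refine IsLocalization.ringHom_ext M (RingHom.ext fun e => ?_)
        rw [RingHom.comp_apply, RingHom.comp_apply, RingHom.comp_apply, hεQ, hεQ]
        rfl
      rw [this]
      rfl
    · simp only [ζ, dif_neg hε, dif_neg (fun h => hε (hiff.1 h)), map_zero]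
  let H : Polynomial Ω := ∑ ε, C (ζ ε) * ∏ ε' ∈ Finset.univ.erase ε, (X - C (ε' θ))
  let χ : Polynomial Ω := ∏ ε, (X - C (ζ ε))
  obtain ⟨H₀, hH₀⟩ : ∃ P₀ : A[X], P₀.map (algebraMap A Ω) = H := by
    refine exists_map_eq_of_fixed K H ?_ fun σ => ?_
    · exact sum_mem fun ε _ => mul_mem (hlift _ (hζint ε)) (prod_mem fun ε' _ => hliftX _ (hθint ε'))
    · simp only [H, Polynomial.map_sum, Polynomial.map_mul, Polynomial.map_prod,
        Polynomial.map_sub, map_X, map_C]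
      refine Fintype.sum_equiv (τ σ) _ _ fun ε => ?_
      rw [hζτ]
      congr 1
      refine Finset.prod_equiv (τ σ) (fun i => by simp) fun i _ => ?_
      rw [hτ]
      rfl
  obtain ⟨χ₀, hχ₀⟩ : ∃ P₀ : A[X], P₀.map (algebraMap A Ω) = χ := by
    refine exists_map_eq_of_fixed K χ ?_ fun σ => ?_
    · exact prod_mem fun ε' _ => hliftX _ (hζint ε')
    · simp only [χ, Polynomial.map_prod, Polynomial.map_sub, map_X, map_C]
      refine Fintype.prod_equiv (τ σ) _ _ fun ε => ?_
      rw [hζτ]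
      rfl
  have hinj := FaithfulSMul.algebraMap_injective A Ω
  have hcomp : ∀ ε hε, (εQ ε hε).comp ((algebraMap E Q).comp (algebraMap A E)) = algebraMap A Ω :=
    fun ε hε => RingHom.ext fun a => (hεQ ε hε _).trans (ε.commutes a)
  refine ⟨⟨aeval θ H₀, ?_⟩, χ₀.map (algebraMap A E), ?_, ?_, ?_⟩
  · rw [← sub_eq_zero]
    refine hzero _ fun ε hε => ?_
    rw [map_sub, map_mul, hεQ, hεQ, algHom_apply, algHom_apply, ← eval_map_algebraMap, hH₀,
      ← eval_map_algebraMap, ← derivative_map, hprod, derivative_prod_X_sub_C,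
      eval_sum_prod_erase (fun _ => 1) (fun ε : E →ₐ[A] Ω => ε θ),
      eval_sum_prod_erase ζ (fun ε : E →ₐ[A] Ω => ε θ)]
    simp only [ζ, dif_pos hε]
    ring
  · refine Monic.map _ (monic_of_injective hinj ?_)
    rw [hχ₀]
    exact monic_prod_X_sub_C _ _
  · refine natDegree_map_le.trans ?_
    rw [← natDegree_map_eq_of_injective hinj, hχ₀, natDegree_finsetProd_X_sub_C_eq_card,
      ← natDegree_map_eq_of_injective hinj F, hprod, natDegree_finsetProd_X_sub_C_eq_card]
  · refine hzero _ fun ε hε => ?_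
    rw [aeval_def, eval₂_map, hom_eval₂, hcomp, ← Polynomial.eval_map, hχ₀, eval_prod]
    refine Finset.prod_eq_zero (Finset.mem_univ ε) ?_
    simp only [ζ, dif_pos hε, eval_sub, eval_X, eval_C, sub_self]

/-- The kernels of the embeddings intersect in zero, so `P` is one of them, `ker ε`. Let `F = μ G`
with `μ` the minimal polynomial of `ε θ`. Up to a power of `w`, elements of `P` are values at `θ` of
multiples of `μ`, so `G(θ)` kills them at every root of `F`; conversely `G(ε θ) ≠ 0` because `F` is
separable. -/
lemma exists_factor_of_mem_minimalPrimes_aux [IsDomain A] [IsIntegrallyClosed A]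
    [FaithfulSMul A Ω] [Algebra.IsIntegral A E] (h : GenericallyMonogenic A E θ F w)
    (hs : (F.map (algebraMap A Ω)).Splits) (hsep : (F.map (algebraMap A Ω)).Separable)
    (P : Ideal E) (hP : P ∈ minimalPrimes E) :
    ∃ G : A[X], G ∣ F ∧ ∀ x, x ∈ P ↔ x * aeval θ G = 0 := by
  classical
  have := h.finite_algHom (Ω := Ω)
  have := Fintype.ofFinite (E →ₐ[A] Ω)
  have hPp : P.IsPrime := hP.1.1
  have hle : (Finset.univ : Finset (E →ₐ[A] Ω)).inf (fun ε => RingHom.ker ε) ≤ P := by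
    intro x hx
    rw [h.eq_zero_of_forall_algHom hs hsep x fun ε =>
      (Finset.inf_le (f := fun ε => RingHom.ker ε) (Finset.mem_univ ε) : _ ≤ RingHom.ker ε) hx]
    exact zero_mem _
  obtain ⟨ε, -, hε⟩ := (Ideal.IsPrime.inf_le' hPp).1 hle
  have hεP : P = RingHom.ker ε :=
    le_antisymm (hP.2 ⟨RingHom.ker_isPrime ε.toRingHom, bot_le⟩ hε) hε
  have hint : IsIntegral A (ε θ) := (Algebra.IsIntegral.isIntegral θ).map ε
  have hroot : ∀ ε' : E →ₐ[A] Ω, aeval (ε' θ) F = 0 := fun ε' => by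
    rw [← algHom_apply, h.aeval_eq_zero, map_zero]
  obtain ⟨G, hG⟩ := minpoly.isIntegrallyClosed_dvd hint (hroot ε)
  refine ⟨G, ⟨_, hG.trans (mul_comm _ _)⟩, fun x => ?_⟩
  rw [hεP]
  constructor
  · intro hx
    obtain ⟨k, B, hB⟩ := h.exists_pow_smul_eq x
    refine h.eq_zero_of_forall_algHom hs hsep _ fun ε' => ?_
    rw [map_mul, algHom_apply]
    have h1 : aeval (ε' θ) (minpoly A (ε θ)) * aeval (ε' θ) G = 0 := by
      rw [← map_mul, ← hG, hroot]
    rcases mul_eq_zero.1 h1 with h1 | h1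
    · obtain ⟨D, rfl⟩ := minpoly.isIntegrallyClosed_dvd hint ((h.algHom_eq_zero_iff ε hB).1 hx)
      rw [(h.algHom_eq_zero_iff ε' hB).2 (by rw [map_mul, h1, zero_mul]), zero_mul]
    · rw [h1, mul_zero]
  · intro hx
    have h1 := congrArg ε hx
    rw [map_mul, map_zero, algHom_apply, mul_eq_zero] at h1
    refine h1.resolve_right fun h2 => ?_
    obtain ⟨a, b, hab⟩ := hsep
    have h3 := congrArg (eval (ε θ)) hab
    rw [eval_add, eval_mul, eval_mul, eval_map_algebraMap, hroot, mul_zero, zero_add,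
      derivative_map, eval_map_algebraMap, hG, derivative_mul, map_add, map_mul, map_mul, h2,
      minpoly.aeval, mul_zero, zero_mul, add_zero, mul_zero, eval_one] at h3
    exact zero_ne_one h3

end Embeddings

variable [IsDomain A]

lemma exists_splitting (h : GenericallyMonogenic A E θ F w) :
    let K := FractionRing A
    let Ω := SplittingField (F.map (algebraMap A K))
    (F.map (algebraMap A Ω)).Splits ∧ (F.map (algebraMap A Ω)).Separable ∧ IsGalois K Ω ∧
      FaithfulSMul A Ω := by
  intro K Ω
  have hsep := h.separable K
  have heq : F.map (algebraMap A Ω) = (F.map (algebraMap A K)).map (algebraMap K Ω) := by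
    rw [Polynomial.map_map, ← IsScalarTower.algebraMap_eq]
  rw [heq]
  exact ⟨SplittingField.splits _, hsep.map, IsGalois.of_separable_splitting_field hsep,
    (faithfulSMul_iff_algebraMap_injective A Ω).2 (by
      rw [IsScalarTower.algebraMap_eq A K Ω]
      exact (algebraMap K Ω).injective.comp (IsFractionRing.injective A K))⟩

lemma isReduced (h : GenericallyMonogenic A E θ F w) : _root_.IsReduced E := by
  obtain ⟨hs, hsep, -, _⟩ := h.exists_splitting
  exact ⟨fun e he => h.eq_zero_of_forall_algHom hs hsep e fun ε => (he.map ε).eq_zero⟩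

lemma boundsNormalization [IsIntegrallyClosed A] [Algebra.IsIntegral A E]
    (h : GenericallyMonogenic A E θ F w) :
    BoundsNormalization E (aeval θ (derivative F)) F.natDegree := by
  obtain ⟨hs, hsep, hg, _⟩ := h.exists_splitting
  exact h.boundsNormalization_aux (FractionRing A) hs hsep

lemma exists_factor_of_mem_minimalPrimes [IsIntegrallyClosed A] [Algebra.IsIntegral A E]
    (h : GenericallyMonogenic A E θ F w) (P : Ideal E) (hP : P ∈ minimalPrimes E) :
    ∃ G : A[X], G ∣ F ∧ ∀ x, x ∈ P ↔ x * aeval θ G = 0 := by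
  obtain ⟨hs, hsep, hg, _⟩ := h.exists_splitting
  exact h.exists_factor_of_mem_minimalPrimes_aux hs hsep P hP

end GenericallyMonogenic

end

/-! ### Fibres of a generic presentation -/

section

open Polynomial TensorProduct

namespace BoundsNormalization

variable {E : Type u} [CommRing E]

lemma mul_left {d : E} {r : ℕ} (h : BoundsNormalization E d r) (c : E) :
    BoundsNormalization E (c * d) r := by
  intro Q _ _ M _ z hz
  obtain ⟨⟨e, he⟩, hχ⟩ := h Q M z hz
  exact ⟨⟨c * e, by rw [map_mul, he, map_mul, mul_assoc]⟩, hχ⟩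

end BoundsNormalization

/-- The divisors of a polynomial of bounded total degree have bounded total degree. -/
lemma MvPolynomial.totalDegree_le_of_dvd {σ R : Type*} [CommRing R] [IsDomain R]
    {p q : MvPolynomial σ R} (h : p ∣ q) (hq : q ≠ 0) : p.totalDegree ≤ q.totalDegree := by
  obtain ⟨c, rfl⟩ := h
  rw [totalDegree_mul_of_isDomain (left_ne_zero_of_mul hq) (right_ne_zero_of_mul hq)]
  exact Nat.le_add_right _ _

/-- The kernel of a homomorphism that is surjective up to inverting `w` commutes with base change to
a fibre in which `w` is regular modulo the kernel. -/
lemma mem_fibre_of_map_eq_zero {Z D G κ : Type u} [CommRing Z] [CommRing D] [CommRing G] [Field κ]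
    [Algebra Z D] [Algebra Z G] [Algebra Z κ] (φ : D →ₐ[Z] G) (w : D)
    (hφ : ∀ g : G, ∃ (k : ℕ) (B : D), φ w ^ k * g = φ B) (N : Ideal D)
    (hN : ∀ x, φ x = 0 → x ∈ N)
    (hw : ∀ e : κ ⊗[Z] D, (1 ⊗ₜ w) * e ∈ N.fibre κ → e ∈ N.fibre κ) (e : κ ⊗[Z] D)
    (he : Algebra.TensorProduct.map (AlgHom.id Z κ) φ e = 0) : e ∈ N.fibre κ := by
  let I := N.fibre (Z := Z) κ
  let u : (κ ⊗[Z] D) ⧸ I := Ideal.Quotient.mk I (1 ⊗ₜ w)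
  -- Once `w` is inverted, the map from `D` factors through `G`. This gives `τ` with `τ ∘ (1 ⊗ φ) =
  -- π`, so `e` dies in `Λ`, and regularity of `w` brings it back into the ideal.
  let Λ := Localization.Away u
  let π : κ ⊗[Z] D →ₐ[Z] Λ := (IsScalarTower.toAlgHom Z _ Λ).comp (Ideal.Quotient.mkₐ Z I)
  let φ' : D →ₐ[Z] Λ := π.comp Algebra.TensorProduct.includeRight
  obtain ⟨ψ, hψ⟩ := exists_ringHom_of_pow_mul_eq φ.toRingHom φ'.toRingHom w
    (IsLocalization.Away.algebraMap_isUnit u) (fun s hs => by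
      change algebraMap _ Λ (Ideal.Quotient.mk I (1 ⊗ₜ s)) = 0
      rw [Ideal.Quotient.eq_zero_iff_mem.2, map_zero]
      exact Ideal.mem_map_of_mem _ (hN s hs)) hφ
  let ψ' : G →ₐ[Z] Λ := ⟨ψ, fun z => by
    have := hψ (algebraMap Z _ z)
    change ψ (φ _) = φ' _ at this
    rw [AlgHom.commutes, AlgHom.commutes] at this
    exact this⟩
  let τ : κ ⊗[Z] G →ₐ[Z] Λ := Algebra.TensorProduct.lift
    (π.comp Algebra.TensorProduct.includeLeft) ψ' (fun _ _ => Commute.all _ _)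
  have hτ : τ.comp (Algebra.TensorProduct.map (AlgHom.id Z κ) φ) = π := by
    refine Algebra.TensorProduct.ext ?_ ?_
    · ext c
      change τ (c ⊗ₜ φ 1) = _
      rw [map_one, Algebra.TensorProduct.lift_tmul, map_one, mul_one]
    · refine AlgHom.ext fun B => ?_
      change τ (1 ⊗ₜ φ B) = φ' B
      rw [Algebra.TensorProduct.lift_tmul, map_one, one_mul]
      exact hψ B
  have h1 : π e = 0 := by rw [← hτ, AlgHom.comp_apply, he, map_zero]
  obtain ⟨⟨_, k, rfl⟩, hk⟩ := (IsLocalization.map_eq_zero_iff (Submonoid.powers u) Λ _).1 h1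
  have h2 : (1 ⊗ₜ w) ^ k * e ∈ I := by
    rw [← Ideal.Quotient.eq_zero_iff_mem, map_mul, map_pow]
    exact hk
  clear hk
  induction k with
  | zero => simpa using h2
  | succ k ih =>
    rw [pow_succ', mul_assoc] at h2
    exact ih (hw _ h2)

/-- A presentation, over the generic point of `Spec Z`, of the `Z`-algebra `G` as an integral
extension of a polynomial ring, generated up to inverting `w` by one element `θ`. -/
structure GenericPresentation (Z G : Type u) [CommRing Z] [CommRing G] [Algebra Z G] (m : ℕ)
    [Algebra (MvPolynomial (Fin m) Z) G] (θ : G) (F : (MvPolynomial (Fin m) Z)[X])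
    (w : MvPolynomial (Fin m) Z) (S : Finset G) : Prop where
  adjoin_eq_top : Algebra.adjoin Z (S : Set G) = ⊤
  integral : ∀ x ∈ S, ∃ z : Z, z ≠ 0 ∧ ∃ P : (MvPolynomial (Fin m) Z)[X],
    P.leadingCoeff = MvPolynomial.C z ∧ aeval x P = 0
  leadingCoeff_eq : ∃ z : Z, z ≠ 0 ∧ F.leadingCoeff = MvPolynomial.C z
  aeval_eq_zero : aeval θ F = 0
  dvd_of_aeval_eq_zero : ∀ q : (MvPolynomial (Fin m) Z)[X], aeval θ q = 0 →
    ∃ z : Z, z ≠ 0 ∧ F ∣ C (MvPolynomial.C z) * q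
  exists_pow_smul_eq : ∀ e : G, ∃ (k : ℕ) (B : (MvPolynomial (Fin m) Z)[X]),
    w ^ k • e = aeval θ B
  smul_ne_zero : algebraMap _ G w ≠ 0
  derivative_ne_zero : aeval θ (derivative F) ≠ 0

namespace GenericPresentation

section Fibre

variable {Z G : Type u} [CommRing Z] [CommRing G] [Algebra Z G] {m : ℕ}
    [Algebra (MvPolynomial (Fin m) Z) G] [IsScalarTower Z (MvPolynomial (Fin m) Z) G]
    {θ : G} {F : (MvPolynomial (Fin m) Z)[X]} {w : MvPolynomial (Fin m) Z} {S : Finset G}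
    {κ : Type u} [Field κ] [Algebra Z κ]

variable (Z κ m) in
/-- The base change map `Z[Y][T] ⊗ κ → κ[Y][T]`. -/
noncomputable def fibreMap : κ ⊗[Z] (MvPolynomial (Fin m) Z)[X] →ₐ[Z] (MvPolynomial (Fin m) κ)[X] :=
  Algebra.TensorProduct.lift (IsScalarTower.toAlgHom Z κ _)
    ⟨mapRingHom (MvPolynomial.map (algebraMap Z κ)), fun z => by
      rw [IsScalarTower.algebraMap_apply Z (MvPolynomial (Fin m) Z) (MvPolynomial (Fin m) Z)[X],
        IsScalarTower.algebraMap_apply Z κ (MvPolynomial (Fin m) κ)[X],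
        IsScalarTower.algebraMap_apply κ (MvPolynomial (Fin m) κ) (MvPolynomial (Fin m) κ)[X]]
      simp [MvPolynomial.algebraMap_eq]⟩ (fun _ _ => Commute.all _ _)

lemma fibreMap_tmul (c : κ) (B : (MvPolynomial (Fin m) Z)[X]) :
    fibreMap Z m κ (c ⊗ₜ B) = C (MvPolynomial.C c) * B.map (MvPolynomial.map (algebraMap Z κ)) := by
  rw [fibreMap, Algebra.TensorProduct.lift_tmul]
  rfl

lemma fibreMap_surjective : Function.Surjective (fibreMap Z m κ) := by
  have hC : ∀ p : MvPolynomial (Fin m) κ, C p ∈ (fibreMap Z m κ).range := by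
    intro p
    induction p using MvPolynomial.induction_on with
    | C a => exact ⟨a ⊗ₜ 1, (fibreMap_tmul _ _).trans (by simp)⟩
    | add p q hp hq => rw [C_add]; exact add_mem hp hq
    | mul_X p n hp =>
      rw [C_mul]
      exact mul_mem hp ⟨1 ⊗ₜ C (MvPolynomial.X n), (fibreMap_tmul _ _).trans (by simp)⟩
  intro p
  change p ∈ (fibreMap Z m κ).range
  induction p using Polynomial.induction_on' with
  | add p q hp hq => exact add_mem hp hq
  | monomial n a =>
    rw [← C_mul_X_pow_eq_monomial]
    have hX : (X : (MvPolynomial (Fin m) κ)[X]) ∈ (fibreMap Z m κ).range :=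
      ⟨1 ⊗ₜ X, (fibreMap_tmul _ _).trans (by simp)⟩
    exact mul_mem (hC a) (pow_mem hX n)

variable [Algebra (MvPolynomial (Fin m) κ) (κ ⊗[Z] G)]
  [IsScalarTower κ (MvPolynomial (Fin m) κ) (κ ⊗[Z] G)]

variable (Z G m κ) in
/-- The structure map of the fibre as an algebra over the polynomial ring is the base change of
that of `G`. -/
def Compatible : Prop := ∀ a : MvPolynomial (Fin m) Z,
  algebraMap (MvPolynomial (Fin m) κ) (κ ⊗[Z] G) (MvPolynomial.map (algebraMap Z κ) a) =
    1 ⊗ₜ algebraMap _ G a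

lemma aeval_map (hc : Compatible Z G m κ) (x : G) (B : (MvPolynomial (Fin m) Z)[X]) :
    aeval ((1 : κ) ⊗ₜ[Z] x) (B.map (MvPolynomial.map (algebraMap Z κ))) = 1 ⊗ₜ aeval x B := by
  rw [aeval_def, eval₂_map, aeval_def]
  have h1 : (algebraMap (MvPolynomial (Fin m) κ) (κ ⊗[Z] G)).comp
      (MvPolynomial.map (algebraMap Z κ)) =
      (Algebra.TensorProduct.includeRight (R := Z) (A := κ) (B := G)).toRingHom.comp
        (algebraMap _ G) := RingHom.ext hc
  rw [h1]
  exact (hom_eval₂ B (algebraMap _ G)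
    (Algebra.TensorProduct.includeRight (R := Z) (A := κ) (B := G)).toRingHom x).symm

lemma aeval_fibreMap (hc : Compatible Z G m κ) (x : G) (e : κ ⊗[Z] (MvPolynomial (Fin m) Z)[X]) :
    aeval ((1 : κ) ⊗ₜ[Z] x) (fibreMap Z m κ e) =
      Algebra.TensorProduct.map (AlgHom.id Z κ) ((aeval x).restrictScalars Z) e := by
  induction e using TensorProduct.induction_on with
  | zero => simp
  | add a b ha hb => rw [map_add, map_add, ha, hb, map_add]
  | tmul c B =>
    rw [fibreMap_tmul, map_mul, aeval_C, aeval_map hc, Algebra.TensorProduct.map_tmul,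
      ← MvPolynomial.algebraMap_eq, ← IsScalarTower.algebraMap_apply,
      Algebra.TensorProduct.algebraMap_apply, Algebra.TensorProduct.tmul_mul_tmul, one_mul, mul_one]
    rfl

lemma exists_pow_smul_eq_fibre (h : GenericPresentation Z G m θ F w S) (hc : Compatible Z G m κ)
    (e : κ ⊗[Z] G) : ∃ (k : ℕ) (B : (MvPolynomial (Fin m) κ)[X]),
      MvPolynomial.map (algebraMap Z κ) w ^ k • e = aeval (1 ⊗ₜ θ) B := by
  induction e using TensorProduct.induction_on with
  | zero => exact ⟨0, 0, by simp⟩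
  | add a b ha hb =>
    obtain ⟨k, B, hB⟩ := ha
    obtain ⟨l, D, hD⟩ := hb
    refine ⟨k + l, C (MvPolynomial.map (algebraMap Z κ) w ^ l) * B +
      C (MvPolynomial.map (algebraMap Z κ) w ^ k) * D, ?_⟩
    rw [map_add, map_mul, map_mul, ← hB, ← hD, aeval_C, aeval_C, ← Algebra.smul_def,
      ← Algebra.smul_def, smul_smul, smul_smul, smul_add, ← pow_add, ← pow_add, add_comm l k]
  | tmul c g =>
    obtain ⟨k, B, hB⟩ := h.exists_pow_smul_eq g
    refine ⟨k, fibreMap Z m κ (c ⊗ₜ B), ?_⟩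
    rw [aeval_fibreMap hc, Algebra.TensorProduct.map_tmul, Algebra.smul_def, ← map_pow, hc,
      Algebra.TensorProduct.tmul_mul_tmul, one_mul, ← Algebra.smul_def, hB]
    rfl

/-- The equations of the generators have leading coefficients in `Z`, and these become units of `κ`.
-/
lemma isIntegral_fibre (h : GenericPresentation Z G m θ F w S) (hc : Compatible Z G m κ)
    (hκ : ∀ x ∈ S, ∃ z : Z, algebraMap Z κ z ≠ 0 ∧ ∃ P : (MvPolynomial (Fin m) Z)[X],
      P.leadingCoeff = MvPolynomial.C z ∧ aeval x P = 0) :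
    Algebra.IsIntegral (MvPolynomial (Fin m) κ) (κ ⊗[Z] G) := by
  have hx : ∀ x : G, _root_.IsIntegral (MvPolynomial (Fin m) κ) ((1 : κ) ⊗ₜ[Z] x) := by
    intro x
    have hx : x ∈ Algebra.adjoin Z (S : Set G) := h.adjoin_eq_top ▸ trivial
    induction hx using Algebra.adjoin_induction with
    | mem x hx =>
      obtain ⟨z, hz, P, hP, hPx⟩ := hκ x hx
      set P' := P.map (MvPolynomial.map (algebraMap Z κ))
      have h0 : MvPolynomial.map (algebraMap Z κ) P.leadingCoeff ≠ 0 := by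
        rw [hP, MvPolynomial.map_C]
        exact (map_ne_zero_iff _ (MvPolynomial.C_injective _ _)).2 hz
      have hl : P'.leadingCoeff = MvPolynomial.C (algebraMap Z κ z) := by
        rw [leadingCoeff_map_of_leadingCoeff_ne_zero _ h0, hP, MvPolynomial.map_C]
      refine ⟨C (MvPolynomial.C (algebraMap Z κ z)⁻¹) * P', ?_, ?_⟩
      · rw [Monic, leadingCoeff_mul, leadingCoeff_C, hl, ← MvPolynomial.C_mul, inv_mul_cancel₀ hz,
          MvPolynomial.C_1]
      · rw [← aeval_def, map_mul, aeval_map hc, hPx, tmul_zero, mul_zero]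
    | algebraMap z =>
      rw [← mul_one (algebraMap Z G z), ← Algebra.smul_def, tmul_smul]
      have : (1 : κ) ⊗ₜ[Z] (1 : G) = 1 := rfl
      rw [this, ← algebraMap_smul κ, ← Algebra.algebraMap_eq_smul_one,
        IsScalarTower.algebraMap_apply κ (MvPolynomial (Fin m) κ)]
      exact isIntegral_algebraMap
    | add x y _ _ hx hy => rw [tmul_add]; exact hx.add hy
    | mul x y _ _ hx hy =>
      have : (1 : κ) ⊗ₜ[Z] (x * y) = (1 ⊗ₜ x) * (1 ⊗ₜ y) := by
        rw [Algebra.TensorProduct.tmul_mul_tmul, one_mul]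
      rw [this]
      exact hx.mul hy
  refine ⟨fun e => ?_⟩
  induction e using TensorProduct.induction_on with
  | zero => exact isIntegral_zero
  | add a b ha hb => exact ha.add hb
  | tmul c g =>
    have : c ⊗ₜ[Z] g = algebraMap (MvPolynomial (Fin m) κ) (κ ⊗[Z] G) (MvPolynomial.C c) *
        1 ⊗ₜ g := by
      rw [← MvPolynomial.algebraMap_eq, ← IsScalarTower.algebraMap_apply,
        Algebra.TensorProduct.algebraMap_apply, Algebra.TensorProduct.tmul_mul_tmul]
      simp
    rw [this]
    exact isIntegral_algebraMap.mul (hx g)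

/-- The kernel of evaluation at `θ`. -/
noncomputable def kernel (Z : Type u) {G : Type u} [CommRing Z] [CommRing G] (m : ℕ)
    [Algebra (MvPolynomial (Fin m) Z) G] (θ : G) : Ideal (MvPolynomial (Fin m) Z)[X] :=
  RingHom.ker (aeval θ : (MvPolynomial (Fin m) Z)[X] →ₐ[MvPolynomial (Fin m) Z] G)

/-- An element of `κ[Y][T]` vanishing at `θ` lies in the extension of the kernel of `Z[Y][T] → G`,
provided `w` is regular modulo this ideal. -/
lemma mem_fibre_kernel (h : GenericPresentation Z G m θ F w S)
    (hw : ∀ e : κ ⊗[Z] (MvPolynomial (Fin m) Z)[X],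
      (1 ⊗ₜ C w) * e ∈ (kernel Z m θ).fibre κ → e ∈ (kernel Z m θ).fibre κ)
    (e : κ ⊗[Z] (MvPolynomial (Fin m) Z)[X])
    (he : Algebra.TensorProduct.map (AlgHom.id Z κ) ((aeval θ).restrictScalars Z) e = 0) :
    e ∈ (kernel Z m θ).fibre κ := by
  let φ : (MvPolynomial (Fin m) Z)[X] →ₐ[Z] G := (aeval θ).restrictScalars Z
  have hφ : ∀ g : G, ∃ (k : ℕ) (B : (MvPolynomial (Fin m) Z)[X]), φ (C w) ^ k * g = φ B := by
    intro g
    obtain ⟨k, B, hB⟩ := h.exists_pow_smul_eq g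
    refine ⟨k, B, ?_⟩
    change aeval θ (C w) ^ k * g = aeval θ B
    rw [← hB, aeval_C, Algebra.smul_def, map_pow]
  have hN : ∀ x, φ x = 0 → x ∈ kernel Z m θ := fun x hx => RingHom.mem_ker.2 hx
  exact mem_fibre_of_map_eq_zero φ (C w) hφ _ hN hw e he

/-- Over fibres at which finitely many elements stay regular, `G` is generically monogenic. -/
lemma genericallyMonogenic (h : GenericPresentation Z G m θ F w S) (hc : Compatible Z G m κ)
    (hw : ∀ e : κ ⊗[Z] (MvPolynomial (Fin m) Z)[X],
      (1 ⊗ₜ C w) * e ∈ (kernel Z m θ).fibre κ → e ∈ (kernel Z m θ).fibre κ)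
    (hwG : ∀ e : κ ⊗[Z] G, (1 ⊗ₜ algebraMap _ G w) * e = 0 → e = 0)
    (hF : ∀ e : κ ⊗[Z] G, (1 ⊗ₜ aeval θ (derivative F)) * e = 0 → e = 0)
    (hw0 : MvPolynomial.map (algebraMap Z κ) w ≠ 0)
    (z : Z) (hz : algebraMap Z κ z ≠ 0) (hFz : F.leadingCoeff = MvPolynomial.C z)
    (T : Set (MvPolynomial (Fin m) Z)[X]) (hT : Ideal.span T = kernel Z m θ)
    (hTκ : ∀ q ∈ T, ∃ z : Z, algebraMap Z κ z ≠ 0 ∧ F ∣ C (MvPolynomial.C z) * q) :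
    GenericallyMonogenic (MvPolynomial (Fin m) κ) (κ ⊗[Z] G) (1 ⊗ₜ θ)
      (C (MvPolynomial.C (algebraMap Z κ z)⁻¹) * F.map (MvPolynomial.map (algebraMap Z κ)))
      (MvPolynomial.map (algebraMap Z κ) w) := by
  have hunit : ∀ z : Z, algebraMap Z κ z ≠ 0 →
      IsUnit (C (MvPolynomial.C (algebraMap Z κ z)) : (MvPolynomial (Fin m) κ)[X]) :=
    fun z hz => (hz.isUnit.map MvPolynomial.C).map C
  have hunit' : IsUnit (C (MvPolynomial.C (algebraMap Z κ z)⁻¹) : (MvPolynomial (Fin m) κ)[X]) :=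
    ((inv_ne_zero hz).isUnit.map MvPolynomial.C).map C
  have hreg : ∀ (x : κ ⊗[Z] G), (∀ e, x * e = 0 → e = 0) → x ∈ nonZeroDivisors (κ ⊗[Z] G) :=
    fun x hx => mem_nonZeroDivisors_iff.2 ⟨hx, fun e he => hx e (by rwa [mul_comm])⟩
  refine ⟨?_, ?_, ?_, h.exists_pow_smul_eq_fibre hc, ?_, ?_, hw0⟩
  · have h0 : MvPolynomial.map (algebraMap Z κ) F.leadingCoeff ≠ 0 := by
      rw [hFz, MvPolynomial.map_C]
      exact (map_ne_zero_iff _ (MvPolynomial.C_injective _ _)).2 hz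
    rw [Monic, leadingCoeff_mul, leadingCoeff_C, leadingCoeff_map_of_leadingCoeff_ne_zero _ h0, hFz,
      MvPolynomial.map_C, ← MvPolynomial.C_mul, inv_mul_cancel₀ hz, MvPolynomial.C_1]
  · rw [map_mul, aeval_map hc, h.aeval_eq_zero, tmul_zero, mul_zero]
  · intro B hB
    rw [hunit'.mul_left_dvd]
    obtain ⟨e, rfl⟩ := fibreMap_surjective (Z := Z) B
    rw [aeval_fibreMap hc] at hB
    have h1 := h.mem_fibre_kernel hw e hB
    rw [← Ideal.mem_span_singleton]
    -- The generators of the kernel are divisible by `F` up to constants that become units of `κ`,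
    -- so the extended kernel lies in the ideal of the image of `F`.
    have h2 : (kernel Z m θ).fibre κ ≤
        (Ideal.span {F.map (MvPolynomial.map (algebraMap Z κ))}).comap (fibreMap Z m κ) := by
      rw [Ideal.fibre, Ideal.map_le_iff_le_comap, ← hT, Ideal.span_le]
      intro q hq
      obtain ⟨y, hy, D, hD⟩ := hTκ q hq
      change fibreMap Z m κ (1 ⊗ₜ q) ∈ Ideal.span {F.map (MvPolynomial.map (algebraMap Z κ))}
      rw [fibreMap_tmul, MvPolynomial.C_1, C_1, one_mul, Ideal.mem_span_singleton,
        ← (hunit y hy).dvd_mul_left]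
      refine ⟨D.map (MvPolynomial.map (algebraMap Z κ)), ?_⟩
      rw [← Polynomial.map_mul, ← hD, Polynomial.map_mul, Polynomial.map_C, MvPolynomial.map_C]
    exact h2 h1
  · intro e he
    rw [Algebra.smul_def, hc] at he
    exact hwG e he
  · rw [derivative_C_mul, map_mul, derivative_map, aeval_map hc, aeval_C]
    refine mul_mem ?_ (hreg _ hF)
    refine IsUnit.mem_nonZeroDivisors ?_
    exact ((inv_ne_zero hz).isUnit.map MvPolynomial.C).map _

end Fibre

end GenericPresentation

lemma MvPolynomial.finSuccEquiv_map {R T : Type*} [CommRing R] [CommRing T] (f : R →+* T) (m : ℕ)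
    (p : MvPolynomial (Fin (m + 1)) R) :
    finSuccEquiv T m (map f p) = (finSuccEquiv R m p).map (map f) := by
  induction p using MvPolynomial.induction_on with
  | C a => simp [finSuccEquiv_apply]
  | add p q hp hq => simp only [map_add, hp, hq, Polynomial.map_add]
  | mul_X p n hp =>
    rw [map_mul, map_mul, hp, map_mul, Polynomial.map_mul, map_X]
    congr 1
    refine Fin.cases ?_ (fun i => ?_) n <;> simp [finSuccEquiv_X_zero, finSuccEquiv_X_succ]

lemma MvPolynomial.aeval_finSuccEquiv {R B : Type*} [CommRing R] [CommRing B] [Algebra R B] {m : ℕ}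
    [Algebra (MvPolynomial (Fin m) R) B] [IsScalarTower R (MvPolynomial (Fin m) R) B] (t : B)
    (p : MvPolynomial (Fin (m + 1)) R) :
    Polynomial.aeval t (finSuccEquiv R m p) =
      aeval (Fin.cons t fun i => algebraMap (MvPolynomial (Fin m) R) B (X i)) p := by
  induction p using MvPolynomial.induction_on with
  | C a =>
    rw [← MvPolynomial.algebraMap_eq, AlgEquiv.commutes, AlgHom.commutes,
      IsScalarTower.algebraMap_apply R (MvPolynomial (Fin m) R) (MvPolynomial (Fin m) R)[X],
      AlgHom.commutes, ← IsScalarTower.algebraMap_apply]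
  | add p q hp hq => simp only [map_add, hp, hq]
  | mul_X p n hp =>
    rw [map_mul, map_mul, hp, map_mul]
    congr 1
    refine Fin.cases ?_ (fun i => ?_) n <;> simp [finSuccEquiv_X_zero, finSuccEquiv_X_succ]

/-- A polynomial over a fibre dividing the fibre of `F` takes values that are combinations of finitely
many elements, which are independent of the fibre. -/
lemma exists_sum_tmul_eq_aeval {Z G : Type u} [CommRing Z] [CommRing G] [Algebra Z G] {m : ℕ}
    [Algebra (MvPolynomial (Fin m) Z) G] [IsScalarTower Z (MvPolynomial (Fin m) Z) G] (θ : G)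
    (F : (MvPolynomial (Fin m) Z)[X]) :
    ∃ (J : Type) (_ : Fintype J) (g : J → G), ∀ (κ : Type u) [Field κ] [Algebra Z κ]
      [Algebra (MvPolynomial (Fin m) κ) (κ ⊗[Z] G)]
      [IsScalarTower κ (MvPolynomial (Fin m) κ) (κ ⊗[Z] G)],
      GenericPresentation.Compatible Z G m κ → F.map (MvPolynomial.map (algebraMap Z κ)) ≠ 0 →
      ∀ D : (MvPolynomial (Fin m) κ)[X], D ∣ F.map (MvPolynomial.map (algebraMap Z κ)) →
        ∃ c : J → κ, aeval ((1 : κ) ⊗ₜ[Z] θ) D = ∑ j, c j ⊗ₜ g j := by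
  classical
  let p := (MvPolynomial.finSuccEquiv Z m).symm F
  let v : Fin (m + 1) → G := Fin.cons θ fun i => algebraMap (MvPolynomial (Fin m) Z) G (MvPolynomial.X i)
  have hfin : {α : Fin (m + 1) →₀ ℕ | α.degree ≤ p.totalDegree}.Finite :=
    Finsupp.finite_of_degree_le _
  have := hfin.fintype
  refine ⟨{α : Fin (m + 1) →₀ ℕ | α.degree ≤ p.totalDegree}, this,
    fun α => α.1.prod fun i n => v i ^ n, ?_⟩
  intro κ _ _ _ _ hc hF D hD
  let q := (MvPolynomial.finSuccEquiv κ m).symm D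
  have hp : (MvPolynomial.finSuccEquiv κ m).symm (F.map (MvPolynomial.map (algebraMap Z κ))) =
      MvPolynomial.map (algebraMap Z κ) p := by
    rw [AlgEquiv.symm_apply_eq, MvPolynomial.finSuccEquiv_map, AlgEquiv.apply_symm_apply]
  -- Total degree in all `m + 1` variables is additive over a field, so every divisor is bounded by
  -- `F`. Hence the monomials indexed by `J` do not depend on `κ`.
  have hdeg : q.totalDegree ≤ p.totalDegree := by
    refine (MvPolynomial.totalDegree_le_of_dvd (map_dvd (MvPolynomial.finSuccEquiv κ m).symm hD)
      ((map_ne_zero_iff _ (MvPolynomial.finSuccEquiv κ m).symm.injective).2 hF)).trans ?_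
    rw [hp]
    exact Finset.sup_mono (MvPolynomial.support_map_subset _ _)
  have heval : aeval ((1 : κ) ⊗ₜ[Z] θ) D =
      MvPolynomial.aeval (fun i => (1 : κ) ⊗ₜ[Z] v i) q := by
    rw [← AlgEquiv.apply_symm_apply (MvPolynomial.finSuccEquiv κ m) D,
      MvPolynomial.aeval_finSuccEquiv]
    congr 2
    ext i
    refine Fin.cases rfl (fun i => ?_) i
    rw [Fin.cons_succ]
    change _ = 1 ⊗ₜ[Z] algebraMap (MvPolynomial (Fin m) Z) G (MvPolynomial.X i)
    rw [← hc, MvPolynomial.map_X]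
  refine ⟨fun α => q.coeff α.1, ?_⟩
  have hmon : ∀ α : Fin (m + 1) →₀ ℕ, algebraMap κ (κ ⊗[Z] G) (q.coeff α) *
      (∏ i, ((1 : κ) ⊗ₜ[Z] v i) ^ α i) = q.coeff α ⊗ₜ α.prod fun i n => v i ^ n := by
    intro α
    rw [Finsupp.prod_fintype _ _ (fun i => pow_zero _), Algebra.TensorProduct.algebraMap_apply]
    have : ∏ i, ((1 : κ) ⊗ₜ[Z] v i) ^ α i = 1 ⊗ₜ ∏ i, v i ^ α i := by
      simp only [Algebra.TensorProduct.tmul_pow, one_pow]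
      exact (map_prod (Algebra.TensorProduct.includeRight (R := Z) (A := κ) (B := G))
        (fun i => v i ^ α i) Finset.univ).symm
    rw [this, Algebra.TensorProduct.tmul_mul_tmul, one_mul]
    simp
  rw [heval, MvPolynomial.aeval_def, MvPolynomial.eval₂_eq']
  simp only [hmon]
  have hsub : q.support ⊆ hfin.toFinset := fun α hα => by
    rw [Set.Finite.mem_toFinset]
    exact (MvPolynomial.le_totalDegree hα).trans hdeg
  rw [Finset.sum_subset hsub (fun α _ hα => by
    rw [MvPolynomial.notMem_support_iff.1 hα, zero_tmul])]
  exact Finset.sum_subtype hfin.toFinset (fun α => by simp)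
    (fun α => q.coeff α ⊗ₜ[Z] α.prod fun i n => v i ^ n)

end

/-! ### Noether normalization, primitive elements and uniform fibres of domains -/

section

open Polynomial TensorProduct

/-- Clearing the denominators of the coefficients of a polynomial over `K[Y]`. -/
lemma MvPolynomial.exists_map_eq_C_mul (Z : Type*) {K σ : Type*} [CommRing Z] [IsDomain Z] [Field K]
    [Algebra Z K] [IsFractionRing Z K] (B : (MvPolynomial σ K)[X]) :
    ∃ z : Z, z ≠ 0 ∧ ∃ P : (MvPolynomial σ Z)[X],
      P.map (map (algebraMap Z K)) = Polynomial.C (C (algebraMap Z K z)) * B := by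
  let : Algebra (MvPolynomial σ Z) (MvPolynomial σ K) := algebraMvPolynomial
  obtain ⟨_, ⟨z, hz, rfl⟩, h⟩ := IsLocalization.integerNormalization_spec
    ((nonZeroDivisors Z).map (C (σ := σ))) B
  refine ⟨z, nonZeroDivisors.ne_zero hz, _, h.trans ?_⟩
  rw [← IsScalarTower.algebraMap_smul (MvPolynomial σ K), MvPolynomial.algebraMap_def, map_C,
    Polynomial.smul_eq_C_mul]

section NoetherNormalization

variable {Z G K L : Type u} [CommRing Z] [IsDomain Z] [CommRing G] [Algebra Z G]
  [Field K] [Algebra Z K] [IsFractionRing Z K] [Field L] [Algebra G L]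
  [Algebra K L] [Algebra Z L] [IsScalarTower Z G L] [IsScalarTower Z K L]

-- Scalars from `K` are fractions over `Z`; sums and products only multiply the denominators.
variable (Z) in
lemma exists_smul_eq_algebraMap_of_mem_adjoin {s : Set G} {e : L}
    (he : e ∈ Algebra.adjoin K (algebraMap G L '' s)) :
    ∃ z : Z, z ≠ 0 ∧ ∃ g : G, algebraMap Z L z * e = algebraMap G L g := by
  induction he using Algebra.adjoin_induction with
  | mem x hx =>
    obtain ⟨g, _, rfl⟩ := hx
    exact ⟨1, one_ne_zero, g, by simp⟩
  | algebraMap c =>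
    obtain ⟨a, b, hb, rfl⟩ := IsFractionRing.div_surjective (A := Z) c
    have hb' := IsFractionRing.to_map_ne_zero_of_mem_nonZeroDivisors (R := Z) (K := K) hb
    refine ⟨b, nonZeroDivisors.ne_zero hb, algebraMap Z G a, ?_⟩
    rw [IsScalarTower.algebraMap_apply Z K L, ← map_mul, mul_div_cancel₀ _ hb',
      ← IsScalarTower.algebraMap_apply, ← IsScalarTower.algebraMap_apply]
  | add x y _ _ hx hy =>
    obtain ⟨a, ha, g, hg⟩ := hx
    obtain ⟨b, hb, g', hg'⟩ := hy
    refine ⟨a * b, mul_ne_zero ha hb, algebraMap Z G b * g + algebraMap Z G a * g', ?_⟩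
    simp only [map_add, map_mul, ← hg, ← hg', ← IsScalarTower.algebraMap_apply]
    ring
  | mul x y _ _ hx hy =>
    obtain ⟨a, ha, g, hg⟩ := hx
    obtain ⟨b, hb, g', hg'⟩ := hy
    refine ⟨a * b, mul_ne_zero ha hb, g * g', ?_⟩
    simp only [map_mul, ← hg, ← hg']
    ring

variable (Z G K L) in
/-- Noether normalization of the generic fibre of `G`, by variables in `G`. -/
lemma exists_noetherNormalization [Algebra.FiniteType Z G] :
    ∃ (m : ℕ) (y : Fin m → G),
      Function.Injective (MvPolynomial.aeval (R := K) fun i => algebraMap G L (y i)) ∧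
      ∀ x : G, (MvPolynomial.aeval (R := K) fun i => algebraMap G L (y i)).toRingHom.IsIntegralElem
        (algebraMap G L x) := by
  obtain ⟨S, hS⟩ := Algebra.FiniteType.out (R := Z) (A := G)
  let GK := Algebra.adjoin K (algebraMap G L '' (S : Set G))
  have hG : ∀ x : G, algebraMap G L x ∈ GK := by
    intro x
    have hx : x ∈ Algebra.adjoin Z (S : Set G) := hS ▸ trivial
    induction hx using Algebra.adjoin_induction with
    | mem x hx => exact Algebra.subset_adjoin ⟨x, hx, rfl⟩
    | algebraMap z =>
      rw [← IsScalarTower.algebraMap_apply, IsScalarTower.algebraMap_apply Z K L]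
      exact GK.algebraMap_mem _
    | add x y _ _ hx hy => rw [map_add]; exact add_mem hx hy
    | mul x y _ _ hx hy => rw [map_mul]; exact mul_mem hx hy
  have : Algebra.FiniteType K GK := Algebra.FiniteType.adjoin_of_finite (S.finite_toSet.image _)
  obtain ⟨m, φ, hφ, hint⟩ := exists_integral_inj_algHom_of_fg K GK
  choose z hz y hy using fun i => exists_smul_eq_algebraMap_of_mem_adjoin Z (φ (MvPolynomial.X i)).2
  have hz' : ∀ i, algebraMap Z K (z i) ≠ 0 := fun i =>
    (map_ne_zero_iff _ (IsFractionRing.injective Z K)).2 (hz i)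
  -- The Noether variables lie in `GK` only. Rescaling them by the denominators `z i` moves them
  -- into `G`, and this scaling is an automorphism of the polynomial ring with inverse `τ`.
  let σ : MvPolynomial (Fin m) K →ₐ[K] MvPolynomial (Fin m) K :=
    MvPolynomial.aeval fun i => MvPolynomial.C (algebraMap Z K (z i)) * MvPolynomial.X i
  let τ : MvPolynomial (Fin m) K →ₐ[K] MvPolynomial (Fin m) K :=
    MvPolynomial.aeval fun i => MvPolynomial.C (algebraMap Z K (z i))⁻¹ * MvPolynomial.X i
  have hC : ∀ (ρ : MvPolynomial (Fin m) K →ₐ[K] MvPolynomial (Fin m) K) (c : K),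
      ρ (MvPolynomial.C c) = MvPolynomial.C c := fun ρ c => ρ.commutes c
  have hτσ : τ.comp σ = AlgHom.id K _ := by
    refine MvPolynomial.algHom_ext fun i => ?_
    rw [AlgHom.comp_apply, MvPolynomial.aeval_X, map_mul, hC, MvPolynomial.aeval_X, ← mul_assoc,
      ← MvPolynomial.C_mul, mul_inv_cancel₀ (hz' i), MvPolynomial.C_1, one_mul, AlgHom.id_apply]
  have hστ : σ.comp τ = AlgHom.id K _ := by
    refine MvPolynomial.algHom_ext fun i => ?_
    rw [AlgHom.comp_apply, MvPolynomial.aeval_X, map_mul, hC, MvPolynomial.aeval_X, ← mul_assoc,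
      ← MvPolynomial.C_mul, inv_mul_cancel₀ (hz' i), MvPolynomial.C_1, one_mul, AlgHom.id_apply]
  have h : MvPolynomial.aeval (R := K) (fun i => algebraMap G L (y i)) =
      GK.val.comp (φ.comp σ) := by
    refine MvPolynomial.algHom_ext fun i => ?_
    rw [AlgHom.comp_apply, AlgHom.comp_apply, MvPolynomial.aeval_X, MvPolynomial.aeval_X, ← hy,
      map_mul, map_mul, ← MvPolynomial.algebraMap_eq, AlgHom.commutes, AlgHom.commutes,
      ← IsScalarTower.algebraMap_apply]
    rfl
  refine ⟨m, y, ?_, fun x => ?_⟩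
  · rw [h]
    refine Subtype.val_injective.comp (hφ.comp ?_)
    exact Function.LeftInverse.injective (g := τ) fun p => DFunLike.congr_fun hτσ p
  · obtain ⟨p, hp, hpx⟩ := hint ⟨algebraMap G L x, hG x⟩
    refine ⟨p.map τ.toRingHom, hp.map _, ?_⟩
    rw [h, eval₂_map]
    have h1 : (GK.val.comp (φ.comp σ)).toRingHom.comp τ.toRingHom = GK.val.toRingHom.comp φ.toRingHom := by
      refine RingHom.ext fun p => ?_
      exact congrArg (fun q => GK.val (φ q)) (DFunLike.congr_fun hστ p)
    rw [h1]
    have h2 := congrArg GK.val.toRingHom hpx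
    rw [hom_eval₂, map_zero] at h2
    exact h2

end NoetherNormalization

section Presentation

variable {Z G K L : Type u} [CommRing Z] [IsDomain Z] [CommRing G] [IsDomain G] [Algebra Z G]
  [Field K] [Algebra Z K] [IsFractionRing Z K] [Field L] [Algebra G L] [IsFractionRing G L]
  {m : ℕ} [Algebra (MvPolynomial (Fin m) Z) G] [Algebra (MvPolynomial (Fin m) K) L]
  [FaithfulSMul (MvPolynomial (Fin m) K) L]

lemma aeval_map_fractionRing
    (hc : ∀ a : MvPolynomial (Fin m) Z, algebraMap (MvPolynomial (Fin m) K) L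
      (MvPolynomial.map (algebraMap Z K) a) = algebraMap G L (algebraMap _ G a))
    (x : G) (P : (MvPolynomial (Fin m) Z)[X]) :
    aeval (algebraMap G L x) (P.map (MvPolynomial.map (algebraMap Z K))) =
      algebraMap G L (aeval x P) := by
  rw [aeval_def, eval₂_map, aeval_def, hom_eval₂]
  congr 1
  exact RingHom.ext hc

/-- The minimal polynomial over `K[Y]`, with denominators cleared. -/
lemma exists_primitive_minpoly
    (hc : ∀ a : MvPolynomial (Fin m) Z, algebraMap (MvPolynomial (Fin m) K) L
      (MvPolynomial.map (algebraMap Z K) a) = algebraMap G L (algebraMap _ G a))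
    {x : G} (hx : _root_.IsIntegral (MvPolynomial (Fin m) K) (algebraMap G L x)) :
    ∃ F : (MvPolynomial (Fin m) Z)[X],
      (∃ z : Z, z ≠ 0 ∧ F.leadingCoeff = MvPolynomial.C z) ∧ aeval x F = 0 ∧
      ∀ q : (MvPolynomial (Fin m) Z)[X], aeval x q = 0 →
        ∃ z : Z, z ≠ 0 ∧ F ∣ C (MvPolynomial.C z) * q := by
  have hinj : Function.Injective (MvPolynomial.map (σ := Fin m) (algebraMap Z K)) :=
    MvPolynomial.map_injective _ (IsFractionRing.injective Z K)
  set μ := minpoly (MvPolynomial (Fin m) K) (algebraMap G L x)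
  obtain ⟨z, hz, F, hF⟩ := MvPolynomial.exists_map_eq_C_mul Z μ
  refine ⟨F, ⟨z, hz, hinj ?_⟩, IsFractionRing.injective G L ?_, fun q hq => ?_⟩
  · rw [← leadingCoeff_map_of_injective hinj, hF, leadingCoeff_mul, leadingCoeff_C,
      (minpoly.monic hx).leadingCoeff, mul_one, MvPolynomial.map_C]
  · rw [← aeval_map_fractionRing hc, hF, map_mul, minpoly.aeval, mul_zero, map_zero]
  · have h1 : μ ∣ q.map (MvPolynomial.map (algebraMap Z K)) := by
      refine minpoly.isIntegrallyClosed_dvd hx ?_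
      rw [aeval_map_fractionRing hc, hq, map_zero]
    obtain ⟨D, hD⟩ := h1
    obtain ⟨y, hy, D', hD'⟩ := MvPolynomial.exists_map_eq_C_mul Z D
    refine ⟨z * y, mul_ne_zero hz hy, D', map_injective _ hinj ?_⟩
    rw [Polynomial.map_mul, Polynomial.map_mul, hF, hD', hD, Polynomial.map_C, MvPolynomial.map_C,
      map_mul, MvPolynomial.C_mul, C_mul]
    ring

/-- In characteristic zero `L` has a primitive element `a / b` over the fraction field of the
polynomial ring. As `b` is algebraic it divides a nonzero polynomial `c`; then `c a / b` lies in `G`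
and is still primitive. -/
lemma exists_primitive_element_of_isIntegral [CharZero Z] [Algebra.FiniteType Z G]
    [FaithfulSMul (MvPolynomial (Fin m) Z) G] [IsScalarTower Z (MvPolynomial (Fin m) Z) G]
    (hc : ∀ a : MvPolynomial (Fin m) Z, algebraMap (MvPolynomial (Fin m) K) L
      (MvPolynomial.map (algebraMap Z K) a) = algebraMap G L (algebraMap _ G a))
    (hint : ∀ x : G, _root_.IsIntegral (MvPolynomial (Fin m) K) (algebraMap G L x)) :
    ∃ θ : G, ∀ x : G, ∃ w : MvPolynomial (Fin m) Z, w ≠ 0 ∧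
      ∃ B : (MvPolynomial (Fin m) Z)[X], w • x = aeval θ B := by
  have halg : ∀ x : G, IsAlgebraic (MvPolynomial (Fin m) Z) x := fun x => by
    obtain ⟨F, ⟨z, hz, hF⟩, hFx, _⟩ := exists_primitive_minpoly hc (hint x)
    refine ⟨F, fun h => ?_, hFx⟩
    rw [h, leadingCoeff_zero] at hF
    exact hz ((MvPolynomial.C_eq_zero).1 hF.symm)
  let : Algebra (MvPolynomial (Fin m) Z) L :=
    ((algebraMap G L).comp (algebraMap (MvPolynomial (Fin m) Z) G)).toAlgebra
  have : IsScalarTower (MvPolynomial (Fin m) Z) G L := IsScalarTower.of_algebraMap_eq' rfl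
  have : FaithfulSMul (MvPolynomial (Fin m) Z) L := (faithfulSMul_iff_algebraMap_injective _ _).2
    ((IsFractionRing.injective G L).comp (FaithfulSMul.algebraMap_injective _ _))
  let κ := FractionRing (MvPolynomial (Fin m) Z)
  let : Algebra κ L := FractionRing.liftAlgebra (MvPolynomial (Fin m) Z) L
  have : IsScalarTower (MvPolynomial (Fin m) Z) κ L := FractionRing.isScalarTower_liftAlgebra _ _
  have halgL : ∀ x : G, IsAlgebraic κ (algebraMap G L x) := fun x =>
    ((halg x).algebraMap (A := L)).extendScalars (FaithfulSMul.algebraMap_injective _ κ)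
  obtain ⟨S, hS⟩ := Algebra.FiniteType.out (R := Z) (A := G)
  have htop : IntermediateField.adjoin κ (algebraMap G L '' (S : Set G)) = ⊤ := by
    have hG : ∀ x : G, algebraMap G L x ∈ IntermediateField.adjoin κ (algebraMap G L '' (S : Set G)) := by
      intro x
      have hx : x ∈ Algebra.adjoin Z (S : Set G) := hS ▸ trivial
      induction hx using Algebra.adjoin_induction with
      | mem x hx => exact IntermediateField.subset_adjoin _ _ ⟨x, hx, rfl⟩
      | algebraMap z =>
        rw [IsScalarTower.algebraMap_apply Z (MvPolynomial (Fin m) Z) G,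
          ← IsScalarTower.algebraMap_apply _ G L, IsScalarTower.algebraMap_apply _ κ L]
        exact IntermediateField.algebraMap_mem _ _
      | add x y _ _ hx hy => rw [map_add]; exact add_mem hx hy
      | mul x y _ _ hx hy => rw [map_mul]; exact mul_mem hx hy
    refine eq_top_iff.2 fun x _ => ?_
    obtain ⟨a, b, _, rfl⟩ := IsFractionRing.div_surjective (A := G) x
    exact div_mem (hG a) (hG b)
  have : FiniteDimensional κ L := by
    have h1 : FiniteDimensional κ (IntermediateField.adjoin κ (algebraMap G L '' (S : Set G))) := by
      have := (S.finite_toSet.image (algebraMap G L)).to_subtype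
      refine IntermediateField.finiteDimensional_adjoin ?_
      rintro _ ⟨x, _, rfl⟩
      exact (halgL x).isIntegral
    rw [htop] at h1
    exact LinearEquiv.finiteDimensional IntermediateField.topEquiv.toLinearEquiv
  have : CharZero κ := by
    have : CharZero (MvPolynomial (Fin m) Z) :=
      charZero_of_injective_algebraMap (MvPolynomial.C_injective (Fin m) Z)
    exact charZero_of_injective_algebraMap (FaithfulSMul.algebraMap_injective (MvPolynomial (Fin m) Z) κ)
  obtain ⟨θ₀, hθ₀⟩ := Field.exists_primitive_element κ L
  obtain ⟨a, b, hb, rfl⟩ := IsFractionRing.div_surjective (A := G) θ₀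
  obtain ⟨c, hc0, b', hb'⟩ := (halg b).exists_nonzero_dvd hb
  refine ⟨a * b', fun x => ?_⟩
  have hb0 : algebraMap G L b ≠ 0 := IsFractionRing.to_map_ne_zero_of_mem_nonZeroDivisors hb
  have hcκ : algebraMap (MvPolynomial (Fin m) Z) κ c ≠ 0 :=
    (map_ne_zero_iff _ (FaithfulSMul.algebraMap_injective _ κ)).2 hc0
  have hab : algebraMap G L (a * b') = algebraMap κ L (algebraMap _ κ c) *
      (algebraMap G L a / algebraMap G L b) := by
    rw [← IsScalarTower.algebraMap_apply, IsScalarTower.algebraMap_apply (MvPolynomial (Fin m) Z) G L,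
      hb', map_mul, map_mul]
    field_simp
  have htop' : IntermediateField.adjoin κ {algebraMap G L (a * b')} = ⊤ := by
    rw [eq_top_iff, ← hθ₀, IntermediateField.adjoin_simple_le_iff]
    have h1 := IntermediateField.mem_adjoin_simple_self κ (algebraMap G L (a * b'))
    have h2 : algebraMap G L a / algebraMap G L b =
        algebraMap κ L (algebraMap _ κ c)⁻¹ * algebraMap G L (a * b') := by
      rw [hab, ← mul_assoc, ← map_mul, inv_mul_cancel₀ hcκ, map_one, one_mul]
    rw [h2]
    exact mul_mem (IntermediateField.algebraMap_mem _ _) h1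
  have hx : algebraMap G L x ∈ Algebra.adjoin κ {algebraMap G L (a * b')} := by
    rw [← IntermediateField.adjoin_simple_toSubalgebra_of_isAlgebraic (halgL _), htop']
    trivial
  rw [Algebra.adjoin_singleton_eq_range_aeval] at hx
  obtain ⟨B₀, hB₀⟩ := hx
  obtain ⟨w, hw, hB⟩ := IsLocalization.integerNormalization_spec
    (nonZeroDivisors (MvPolynomial (Fin m) Z)) B₀
  refine ⟨w, nonZeroDivisors.ne_zero hw,
    IsLocalization.integerNormalization (nonZeroDivisors (MvPolynomial (Fin m) Z)) B₀,
    IsFractionRing.injective G L ?_⟩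
  have h3 := congrArg (aeval (algebraMap G L (a * b'))) hB
  rw [aeval_map_algebraMap, aeval_algebraMap_apply] at h3
  have h4 : aeval (algebraMap G L (a * b')) B₀ = algebraMap G L x := hB₀
  rw [h3, Algebra.smul_def w x, map_mul, ← IsScalarTower.algebraMap_apply,
    ← IsScalarTower.algebraMap_smul κ w B₀, map_smul (aeval (algebraMap G L (a * b'))), h4,
    IsScalarTower.algebraMap_smul, Algebra.smul_def]

end Presentation

/-- A finitely generated domain over a domain of characteristic zero is generically a monogenic
integral extension of a polynomial ring. -/
theorem exists_genericPresentation (Z G : Type u) [CommRing Z] [IsDomain Z] [CharZero Z] [CommRing G]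
    [IsDomain G] [Algebra Z G] [FaithfulSMul Z G] [Algebra.FiniteType Z G] :
    ∃ (m : ℕ) (_ : Algebra (MvPolynomial (Fin m) Z) G)
      (_ : IsScalarTower Z (MvPolynomial (Fin m) Z) G) (θ : G) (F : (MvPolynomial (Fin m) Z)[X])
      (w : MvPolynomial (Fin m) Z) (S : Finset G), GenericPresentation Z G m θ F w S := by
  let K := FractionRing Z
  let L := FractionRing G
  have : FaithfulSMul Z L := (faithfulSMul_iff_algebraMap_injective _ _).2 (by
    rw [IsScalarTower.algebraMap_eq Z G L]
    exact (IsFractionRing.injective G L).comp (FaithfulSMul.algebraMap_injective Z G))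
  let : Algebra K L := FractionRing.liftAlgebra Z L
  have : IsScalarTower Z K L := FractionRing.isScalarTower_liftAlgebra _ _
  obtain ⟨m, y, hinj, hint⟩ := exists_noetherNormalization Z G K L
  let : Algebra (MvPolynomial (Fin m) Z) G := (MvPolynomial.aeval y).toAlgebra
  have : IsScalarTower Z (MvPolynomial (Fin m) Z) G :=
    IsScalarTower.of_algebraMap_eq fun z => ((MvPolynomial.aeval y).commutes z).symm
  let : Algebra (MvPolynomial (Fin m) K) L :=
    (MvPolynomial.aeval (R := K) fun i => algebraMap G L (y i)).toAlgebra
  have : FaithfulSMul (MvPolynomial (Fin m) K) L :=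
    (faithfulSMul_iff_algebraMap_injective _ _).2 hinj
  have hc : ∀ a : MvPolynomial (Fin m) Z, algebraMap (MvPolynomial (Fin m) K) L
      (MvPolynomial.map (algebraMap Z K) a) = algebraMap G L (algebraMap _ G a) := by
    intro a
    change MvPolynomial.aeval (R := K) (fun i => algebraMap G L (y i)) _ =
      algebraMap G L (MvPolynomial.aeval y a)
    rw [MvPolynomial.aeval_map_algebraMap]
    exact MvPolynomial.aeval_algebraMap_apply _ _ _
  have : FaithfulSMul (MvPolynomial (Fin m) Z) G := by
    refine (faithfulSMul_iff_algebraMap_injective _ _).2 fun a b hab => ?_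
    refine MvPolynomial.map_injective _ (IsFractionRing.injective Z K) (hinj ?_)
    exact ((hc a).trans (congrArg _ hab)).trans (hc b).symm
  obtain ⟨θ, hθ⟩ := exists_primitive_element_of_isIntegral hc hint
  obtain ⟨F, ⟨z, hz, hF⟩, hFθ, hdvd⟩ := exists_primitive_minpoly hc (hint θ)
  obtain ⟨S, hS⟩ := Algebra.FiniteType.out (R := Z) (A := G)
  choose w hw B hB using hθ
  have hinj' := FaithfulSMul.algebraMap_injective (MvPolynomial (Fin m) Z) G
  have hF0 : F ≠ 0 := fun h => by
    rw [h, leadingCoeff_zero] at hF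
    exact hz ((MvPolynomial.C_eq_zero).1 hF.symm)
  -- The product of the denominators of the generators works for the whole algebra, since powers of
  -- it are allowed.
  refine ⟨m, inferInstance, inferInstance, θ, F, ∏ x ∈ S, w x, S, hS, fun x _ => ?_, ⟨z, hz, hF⟩,
    hFθ, hdvd, fun e => ?_, ?_, fun h => ?_⟩
  · obtain ⟨P, ⟨t, ht, hP⟩, hPx, _⟩ := exists_primitive_minpoly hc (hint x)
    exact ⟨t, ht, P, hP, hPx⟩
  · have he : e ∈ Algebra.adjoin Z (S : Set G) := hS ▸ trivial
    induction he using Algebra.adjoin_induction with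
    | mem x hx =>
      classical
      refine ⟨1, C (∏ x ∈ S.erase x, w x) * B x, ?_⟩
      rw [pow_one, map_mul, aeval_C, ← hB, ← Algebra.smul_def, smul_smul, Finset.prod_erase_mul _ _ hx]
    | algebraMap z =>
      refine ⟨0, C (MvPolynomial.C z), ?_⟩
      rw [pow_zero, one_smul, aeval_C, IsScalarTower.algebraMap_apply Z (MvPolynomial (Fin m) Z) G,
        MvPolynomial.algebraMap_eq]
    | add x y _ _ hx hy =>
      obtain ⟨k, B, hB⟩ := hx
      obtain ⟨l, D, hD⟩ := hy
      refine ⟨k + l, C ((∏ x ∈ S, w x) ^ l) * B + C ((∏ x ∈ S, w x) ^ k) * D, ?_⟩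
      rw [map_add, map_mul, map_mul, ← hB, ← hD, aeval_C, aeval_C, ← Algebra.smul_def,
        ← Algebra.smul_def, smul_smul, smul_smul, smul_add, ← pow_add, ← pow_add, add_comm l k]
    | mul x y _ _ hx hy =>
      obtain ⟨k, B, hB⟩ := hx
      obtain ⟨l, D, hD⟩ := hy
      exact ⟨k + l, B * D, by rw [map_mul, ← hB, ← hD, pow_add, smul_mul_smul_comm]⟩
  · exact (map_ne_zero_iff _ hinj').2 (Finset.prod_ne_zero_iff.2 fun x _ => hw x)
  -- If `F'(θ) = 0`, then `F` divides a nonzero constant times `F'`, which has smaller degree. So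
  -- `F' = 0`, and in characteristic zero `F` is a constant vanishing at `θ`.
  · obtain ⟨t, ht, hFt⟩ := hdvd _ h
    have h1 : C (MvPolynomial.C t) * derivative F = 0 := by
      refine eq_zero_of_dvd_of_degree_lt hFt ?_
      rw [degree_C_mul ((map_ne_zero_iff _ (MvPolynomial.C_injective _ _)).2 ht)]
      exact degree_derivative_lt hF0
    have h2 : derivative F = 0 := (mul_eq_zero.1 h1).resolve_left
      ((map_ne_zero_iff _ C_injective).2 ((map_ne_zero_iff _ (MvPolynomial.C_injective _ _)).2 ht))
    have : CharZero (MvPolynomial (Fin m) Z) :=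
      charZero_of_injective_algebraMap (MvPolynomial.C_injective (Fin m) Z)
    have h3 := eq_C_of_natDegree_eq_zero (derivative_eq_zero.1 h2)
    rw [h3, aeval_C, map_eq_zero_iff _ hinj'] at hFθ
    rw [hFθ, C_0] at h3
    exact hF0 h3

/-- The fibres of `G` over a dense open subset of `Spec Z` are reduced, have normalizations bounded
uniformly, and their minimal primes are annihilators of members of one finite-dimensional family. -/
def HasUniformFibres (Z G : Type u) [CommRing Z] [CommRing G] [Algebra Z G] : Prop :=
  ∃ f : Z, f ≠ 0 ∧ ∃ d : G, d ≠ 0 ∧ ∃ (r : ℕ) (J : Type) (_ : Fintype J) (g : J → G),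
    ∀ (κ : Type u) [Field κ] [Algebra Z κ], algebraMap Z κ f ≠ 0 →
      _root_.IsReduced (κ ⊗[Z] G) ∧ BoundsNormalization (κ ⊗[Z] G) (1 ⊗ₜ d) r ∧
      ∀ P ∈ minimalPrimes (κ ⊗[Z] G), ∃ c : J → κ, ∀ x, x ∈ P ↔ x * ∑ j, c j ⊗ₜ[Z] g j = 0

namespace GenericPresentation

variable {Z G : Type u} [CommRing Z] [IsDomain Z] [IsNoetherianRing Z] [CommRing G] [IsDomain G]
    [Algebra Z G] [Algebra.FiniteType Z G] {m : ℕ}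
    [Algebra (MvPolynomial (Fin m) Z) G] [IsScalarTower Z (MvPolynomial (Fin m) Z) G]
    {θ : G} {F : (MvPolynomial (Fin m) Z)[X]} {w : MvPolynomial (Fin m) Z} {S : Finset G}

/-- In a domain `(0 : a)` is zero, and this colon ideal is generically compatible with the fibre. -/
lemma exists_regular {a : G} (ha : a ≠ 0) : ∃ f : Z, f ≠ 0 ∧ ∀ (κ : Type u) [Field κ] [Algebra Z κ],
    algebraMap Z κ f ≠ 0 → ∀ e : κ ⊗[Z] G, (1 ⊗ₜ a) * e = 0 → e = 0 := by
  obtain ⟨f, hf, h⟩ := exists_mem_fibre_colon (Z := Z) (⊥ : Ideal G) a ⊥ (fun x => by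
    rw [Ideal.mem_bot, Ideal.mem_bot, mul_eq_zero, or_iff_right ha])
  refine ⟨f, hf, fun κ _ _ hκ e he => ?_⟩
  have := h κ hκ e (by rw [he]; exact zero_mem _)
  rwa [Ideal.fibre, Ideal.map_bot, Ideal.mem_bot] at this

/-- The element `f` collects the finitely many conditions under which the presentation survives: the
constants and `w` stay nonzero, and `w` and `F'(θ)` stay regular. The fibre is then generically
monogenic and integral over the normal domain `κ[Y]`. -/
theorem hasUniformFibres (h : GenericPresentation Z G m θ F w S) : HasUniformFibres Z G := by
  classical
  obtain ⟨T, hT⟩ := IsNoetherian.noetherian (kernel Z m θ)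
  have hT0 : ∀ q : T, ∃ z : Z, z ≠ 0 ∧ F ∣ C (MvPolynomial.C z) * q.1 := fun q =>
    h.dvd_of_aeval_eq_zero q (RingHom.mem_ker.1 (hT.le (Submodule.subset_span q.2)))
  choose tz htz hTF using hT0
  have hS0 : ∀ x : S, ∃ z : Z, z ≠ 0 ∧ ∃ P : (MvPolynomial (Fin m) Z)[X],
      P.leadingCoeff = MvPolynomial.C z ∧ aeval x.1 P = 0 := fun x => h.integral x x.2
  choose sz hsz hSP using hS0
  obtain ⟨z, hz, hF⟩ := h.leadingCoeff_eq
  have hw0 : w ≠ 0 := fun h0 => h.smul_ne_zero (by rw [h0, map_zero])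
  obtain ⟨α, hα⟩ := MvPolynomial.ne_zero_iff.1 hw0
  obtain ⟨f₁, hf₁, h₁⟩ := exists_mem_fibre_colon (Z := Z) (kernel Z m θ) (C w) (kernel Z m θ)
    (fun x => by
      rw [kernel, RingHom.mem_ker, RingHom.mem_ker]
      change aeval θ x = 0 ↔ aeval θ (C w * x) = 0
      rw [map_mul, aeval_C, mul_eq_zero, or_iff_right h.smul_ne_zero])
  obtain ⟨f₂, hf₂, h₂⟩ := exists_regular (Z := Z) h.smul_ne_zero
  obtain ⟨f₃, hf₃, h₃⟩ := exists_regular (Z := Z) h.derivative_ne_zero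
  obtain ⟨J, hJ, g, hg⟩ := exists_sum_tmul_eq_aeval (Z := Z) θ F
  refine ⟨(∏ q, tz q) * (∏ x, sz x) * z * w.coeff α * f₁ * f₂ * f₃, ?_,
    aeval θ (derivative F), h.derivative_ne_zero, F.natDegree, J, hJ, g, ?_⟩
  · have h1 := Finset.prod_ne_zero_iff.2 fun q (_ : q ∈ Finset.univ) => htz q
    have h2 := Finset.prod_ne_zero_iff.2 fun q (_ : q ∈ Finset.univ) => hsz q
    simp only [ne_eq, mul_eq_zero, not_or]
    exact ⟨⟨⟨⟨⟨⟨h1, h2⟩, hz⟩, hα⟩, hf₁⟩, hf₂⟩, hf₃⟩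
  intro κ _ _ hκ
  simp only [map_mul, map_prod, ne_eq, mul_eq_zero, not_or] at hκ
  obtain ⟨⟨⟨⟨⟨⟨hκt, hκs⟩, hκz⟩, hκα⟩, hκ₁⟩, hκ₂⟩, hκ₃⟩ := hκ
  rw [← ne_eq, Finset.prod_ne_zero_iff] at hκt hκs
  let : Algebra (MvPolynomial (Fin m) κ) (κ ⊗[Z] G) := (MvPolynomial.aeval (R := κ) fun i =>
    (1 : κ) ⊗ₜ[Z] algebraMap (MvPolynomial (Fin m) Z) G (MvPolynomial.X i)).toAlgebra
  have : IsScalarTower κ (MvPolynomial (Fin m) κ) (κ ⊗[Z] G) :=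
    IsScalarTower.of_algebraMap_eq fun z => ((MvPolynomial.aeval _).commutes z).symm
  have hc : Compatible Z G m κ := by
    intro a
    change MvPolynomial.aeval (R := κ) (fun i => (1 : κ) ⊗ₜ[Z] algebraMap (MvPolynomial (Fin m) Z) G
      (MvPolynomial.X i)) (MvPolynomial.map (algebraMap Z κ) a) = _
    rw [MvPolynomial.aeval_map_algebraMap]
    have h1 : MvPolynomial.aeval (R := Z) (fun i => (1 : κ) ⊗ₜ[Z] algebraMap (MvPolynomial (Fin m) Z) G
        (MvPolynomial.X i)) = (Algebra.TensorProduct.includeRight (R := Z) (A := κ) (B := G)).comp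
        (IsScalarTower.toAlgHom Z (MvPolynomial (Fin m) Z) G) :=
      MvPolynomial.algHom_ext fun i => MvPolynomial.aeval_X _ _
    exact DFunLike.congr_fun h1 a
  have hF0 : F.map (MvPolynomial.map (algebraMap Z κ)) ≠ 0 := fun h0 => by
    have := congrArg (fun p => p.coeff F.natDegree) h0
    simp only [coeff_map, coeff_zero, coeff_natDegree, hF, MvPolynomial.map_C] at this
    exact hκz (MvPolynomial.C_eq_zero.1 this)
  have hmono := h.genericallyMonogenic hc (h₁ κ hκ₁) (h₂ κ hκ₂) (h₃ κ hκ₃) (fun h0 => hκα (by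
      rw [← MvPolynomial.coeff_map, h0, MvPolynomial.coeff_zero])) z hκz hF T hT
    (fun q hq => ⟨tz ⟨q, hq⟩, hκt _ (Finset.mem_univ _), hTF ⟨q, hq⟩⟩)
  have := h.isIntegral_fibre hc (fun x hx => ⟨sz ⟨x, hx⟩, hκs _ (Finset.mem_univ _), hSP ⟨x, hx⟩⟩)
  have hu : IsUnit (C (MvPolynomial.C (algebraMap Z κ z)⁻¹) : (MvPolynomial (Fin m) κ)[X]) :=
    ((inv_ne_zero hκz).isUnit.map MvPolynomial.C).map C
  refine ⟨hmono.isReduced, ?_, fun P hP => ?_⟩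
  -- The monic equation in the fibre is `F` divided by its leading coefficient. Multiplying back
  -- gives the bound `F'(θ)`, which is defined over `Z`.
  · have hb := hmono.boundsNormalization.mul_left
      (algebraMap (MvPolynomial (Fin m) κ) (κ ⊗[Z] G) (MvPolynomial.C (algebraMap Z κ z)))
    rw [derivative_C_mul, map_mul, derivative_map, aeval_map hc, aeval_C, ← mul_assoc, ← map_mul,
      ← MvPolynomial.C_mul, mul_inv_cancel₀ hκz, MvPolynomial.C_1, map_one, one_mul,
      natDegree_C_mul (by exact (map_ne_zero_iff _ (MvPolynomial.C_injective _ _)).2 (inv_ne_zero hκz))] at hb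
    have hdeg : (F.map (MvPolynomial.map (algebraMap Z κ))).natDegree = F.natDegree := by
      refine natDegree_map_of_leadingCoeff_ne_zero _ ?_
      rw [hF, MvPolynomial.map_C]
      exact (map_ne_zero_iff _ (MvPolynomial.C_injective _ _)).2 hκz
    rwa [hdeg] at hb
  · obtain ⟨D, hD, hPD⟩ := hmono.exists_factor_of_mem_minimalPrimes P hP
    obtain ⟨c, hcD⟩ := hg κ hc hF0 D (hu.dvd_mul_left.1 hD)
    exact ⟨c, fun x => by rw [hPD, hcD]⟩

end GenericPresentation

/-- If `Z → G` is not injective, a nonzero element of `Z` kills `G`, and the fibres where it is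
invertible are zero. -/
theorem HasUniformFibres.of_isDomain (Z G : Type u) [CommRing Z] [IsDomain Z] [CharZero Z]
    [IsNoetherianRing Z] [CommRing G] [IsDomain G] [Algebra Z G] [Algebra.FiniteType Z G] :
    HasUniformFibres Z G := by
  by_cases hinj : Function.Injective (algebraMap Z G)
  · have := (faithfulSMul_iff_algebraMap_injective Z G).2 hinj
    obtain ⟨m, _, _, θ, F, w, S, h⟩ := exists_genericPresentation Z G
    exact h.hasUniformFibres
  · obtain ⟨f, hf, hf0⟩ : ∃ f : Z, algebraMap Z G f = 0 ∧ f ≠ 0 := by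
      by_contra! h
      exact hinj ((injective_iff_map_eq_zero _).2 fun a ha => h a ha)
    refine ⟨f, hf0, 1, one_ne_zero, 0, Empty, inferInstance, Empty.elim, fun κ _ _ hκ => ?_⟩
    have h0 : (1 : κ ⊗[Z] G) = 0 := by
      have h1 : algebraMap Z κ f • (1 : κ ⊗[Z] G) = 0 := by
        rw [algebraMap_smul]
        change f • ((1 : κ) ⊗ₜ[Z] (1 : G)) = 0
        rw [← tmul_smul, Algebra.smul_def, hf, zero_mul, tmul_zero]
      exact (smul_eq_zero.1 h1).resolve_left hκ
    have hsub : Subsingleton (κ ⊗[Z] G) := subsingleton_of_zero_eq_one h0.symm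
    refine ⟨inferInstance, ?_, fun P hP => ?_⟩
    · intro Q _ _ M _ z _
      have : Subsingleton Q := (algebraMap (κ ⊗[Z] G) Q).codomain_trivial
      exact ⟨⟨0, Subsingleton.elim _ _⟩, 1, monic_one, by simp, Subsingleton.elim _ _⟩
    · exact absurd (Subsingleton.elim _ _) hP.1.1.ne_top

end

/-! ### Gluing the bounds over the components of a reduced algebra -/

section

open TensorProduct

namespace BoundsNormalization

variable {E E' : Type u} [CommRing E] [CommRing E']

lemma of_ringEquiv {d : E} {r : ℕ} (h : BoundsNormalization E d r) (φ : E ≃+* E') :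
    BoundsNormalization E' (φ d) r := by
  intro Q _ _ M _ z hz
  let : Algebra E Q := ((algebraMap E' Q).comp φ.toRingHom).toAlgebra
  have hφ : ∀ x, algebraMap E Q x = algebraMap E' Q (φ x) := fun _ => rfl
  have hloc : IsLocalization (M.map φ.symm) Q :=
    IsLocalization.isLocalization_of_base_ringEquiv M Q φ.symm
  have hz' : IsIntegral E z := by
    obtain ⟨p, hp, hpz⟩ := hz
    refine ⟨p.map φ.symm.toRingHom, hp.map _, ?_⟩
    rw [Polynomial.eval₂_map]
    convert hpz using 2
    ext x
    exact congrArg (algebraMap E' Q) (φ.apply_symm_apply x)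
  obtain ⟨⟨e, he⟩, χ, hχ, hr, hχz⟩ := h Q (M.map φ.symm) z hz'
  refine ⟨⟨φ e, he⟩, χ.map φ.toRingHom, hχ.map _, (Polynomial.natDegree_map_le).trans hr, ?_⟩
  rw [Polynomial.aeval_def, Polynomial.eval₂_map]
  exact hχz

/-- Bounds on the normalizations of the components of a ring give bounds on its normalization. -/
lemma of_quotients {ι : Type*} [Fintype ι] (I : ι → Ideal E) (H d : ι → E) (r : ι → ℕ)
    (hH : ∀ i, ∀ x ∈ I i, H i * x = 0) (hreg : ∑ i, H i ∈ nonZeroDivisors E)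
    (h : ∀ i, BoundsNormalization (E ⧸ I i) (Ideal.Quotient.mk (I i) (d i)) (r i)) :
    BoundsNormalization E (∑ i, H i * d i) (∑ i, r i) := by
  intro Q _ _ M _ z hz
  let M' : ∀ i, Submonoid (E ⧸ I i) := fun i => M.map (Ideal.Quotient.mk (I i))
  let π : ∀ i, Q →+* Localization (M' i) := fun i =>
    IsLocalization.map (M := M) (T := M' i) _ (Ideal.Quotient.mk (I i)) (Submonoid.le_comap_map M)
  have hπ : ∀ i x, π i (algebraMap E Q x) = algebraMap _ _ (Ideal.Quotient.mk (I i) x) :=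
    fun i x => IsLocalization.map_eq _ x
  -- An element of `Q` that dies on the `i`-th component is killed by `H i`, because `H i`
  -- annihilates `I i`.
  have hker : ∀ i q, π i q = 0 → algebraMap E Q (H i) * q = 0 := by
    intro i q hq
    obtain ⟨⟨a, m⟩, ha⟩ := IsLocalization.surj M q
    have h1 := congrArg (π i) ha
    rw [map_mul, hq, zero_mul, hπ] at h1
    obtain ⟨⟨_, m', hm', rfl⟩, h2⟩ := (IsLocalization.map_eq_zero_iff (M' i) _ _).1 h1.symm
    have h3 : m' * a ∈ I i := by
      rw [← Ideal.Quotient.eq_zero_iff_mem, map_mul]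
      exact h2
    have h4 := congrArg (algebraMap E Q) (hH i _ h3)
    rw [map_mul, map_mul, map_zero, ← ha] at h4
    refine (((IsLocalization.map_units Q ⟨m', hm'⟩).mul (IsLocalization.map_units Q m)).mul_right_eq_zero).1 ?_
    rw [← h4]
    ring
  have hint : ∀ i, IsIntegral (E ⧸ I i) (π i z) := fun i =>
    hz.map_of_comp_eq (Ideal.Quotient.mk (I i)) (π i) (RingHom.ext fun x => (hπ i x).symm)
  choose he hχ using fun i => h i (Localization (M' i)) (M' i) (π i z) (hint i)
  choose e he using he
  choose χ hχ hr hχz using hχ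
  choose e' he' using fun i => Ideal.Quotient.mk_surjective (e i)
  have hlift : ∀ i, ∃ χ' : Polynomial E, χ'.map (Ideal.Quotient.mk (I i)) = χ i ∧
      χ'.natDegree ≤ r i ∧ χ'.Monic := by
    intro i
    nontriviality E
    by_cases hI : I i = ⊤
    -- Over the zero ring all polynomials agree, so `1` is a monic lift of degree zero; the general
    -- lifting needs a nontrivial quotient.
    · refine ⟨1, ?_, by simp, Polynomial.monic_one⟩
      have : Subsingleton (E ⧸ I i) := Ideal.Quotient.subsingleton_iff.2 hI
      exact Subsingleton.elim _ _
    · have : Nontrivial (E ⧸ I i) := Ideal.Quotient.nontrivial_iff.2 hI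
      obtain ⟨q, hq, hd, hm⟩ := Polynomial.lifts_and_natDegree_eq_and_monic
        ((Polynomial.lifts_iff_coeff_lifts _).2 fun n => Ideal.Quotient.mk_surjective _) (hχ i)
      exact ⟨q, hq, hd.trans_le (hr i), hm⟩
  choose χ' hχ' hr' hm using hlift
  refine ⟨⟨∑ i, H i * e' i, ?_⟩, ∏ i, χ' i, Polynomial.monic_prod_of_monic _ _ fun i _ => hm i,
    (Polynomial.natDegree_prod_le _ _).trans (Finset.sum_le_sum fun i _ => hr' i), ?_⟩
  · rw [map_sum, map_sum, Finset.sum_mul]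
    refine Finset.sum_congr rfl fun i _ => ?_
    have h1 := hker i (algebraMap E Q (e' i) - algebraMap E Q (d i) * z) (by
      rw [map_sub, map_mul, hπ, hπ, he', he, sub_self])
    rw [map_mul, map_mul, mul_assoc, ← sub_eq_zero, ← mul_sub, h1]
  -- The factor `χ' i` makes the value at `z` die on the `i`-th component, so each `H i` kills it,
  -- and so does their regular sum.
  · have hreg' : algebraMap E Q (∑ i, H i) ∈ nonZeroDivisors Q :=
      IsLocalization.map_nonZeroDivisors_le M Q ⟨_, hreg, rfl⟩
    refine (mem_nonZeroDivisors_iff.1 hreg').1 _ ?_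
    rw [map_sum, Finset.sum_mul]
    refine Finset.sum_eq_zero fun i _ => hker i _ ?_
    rw [map_prod, map_prod]
    refine Finset.prod_eq_zero (Finset.mem_univ i) ?_
    rw [Polynomial.aeval_def, Polynomial.hom_eval₂]
    have h1 := hχz i
    rw [← hχ', Polynomial.aeval_def, Polynomial.eval₂_map] at h1
    have h2 : (π i).comp (algebraMap E Q) =
        (algebraMap (E ⧸ I i) (Localization (M' i))).comp (Ideal.Quotient.mk (I i)) :=
      RingHom.ext fun x => hπ i x
    rw [h2]
    exact h1

end BoundsNormalization

/-- The fibre of a quotient is the quotient of the fibre. -/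
noncomputable def Ideal.fibreQuotientEquiv {Z D : Type u} [CommRing Z] [CommRing D] [Algebra Z D]
    (κ : Type u) [Field κ] [Algebra Z κ] (I : Ideal D) :
    κ ⊗[Z] (D ⧸ I) ≃+* (κ ⊗[Z] D) ⧸ I.fibre (Z := Z) κ :=
  (Algebra.TensorProduct.tensorQuotientEquiv (R := Z) Z D κ I).toRingEquiv

lemma Ideal.fibreQuotientEquiv_tmul_mk {Z D : Type u} [CommRing Z] [CommRing D] [Algebra Z D]
    (κ : Type u) [Field κ] [Algebra Z κ] (I : Ideal D) (c : κ) (x : D) :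
    I.fibreQuotientEquiv (Z := Z) κ (c ⊗ₜ Ideal.Quotient.mk I x) =
      Ideal.Quotient.mk _ (c ⊗ₜ x) := by
  rfl

section Reduced

variable (Z D : Type u) [CommRing Z] [IsDomain Z] [IsNoetherianRing Z] [CommRing D] [Algebra Z D]
  [Algebra.FiniteType Z D]

variable {D} in
lemma exists_fibre_mem_nonZeroDivisors {a : D} (ha : a ∈ nonZeroDivisors D) :
    ∃ f : Z, f ≠ 0 ∧ ∀ (κ : Type u) [Field κ] [Algebra Z κ], algebraMap Z κ f ≠ 0 →
      (1 : κ) ⊗ₜ[Z] a ∈ nonZeroDivisors (κ ⊗[Z] D) := by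
  obtain ⟨f, hf, h⟩ := exists_mem_fibre_colon (Z := Z) (⊥ : Ideal D) a ⊥ (fun x => by
    rw [Ideal.mem_bot, Ideal.mem_bot, mul_left_mem_nonZeroDivisors_eq_zero_iff ha])
  refine ⟨f, hf, fun κ _ _ hκ => ?_⟩
  have h1 : ∀ e : κ ⊗[Z] D, (1 ⊗ₜ a) * e = 0 → e = 0 := by
    intro e he
    have := h κ hκ e (by rw [he]; exact zero_mem _)
    rwa [Ideal.fibre, Ideal.map_bot, Ideal.mem_bot] at this
  exact mem_nonZeroDivisors_iff.2 ⟨h1, fun e he => h1 e (by rwa [mul_comm])⟩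

/-- The fibres of a reduced algebra over a dense open subset of `Spec Z` are reduced and have
normalizations bounded uniformly. -/
theorem exists_boundsNormalization_fibre [CharZero Z] [_root_.IsReduced D] :
    ∃ f : Z, f ≠ 0 ∧ ∃ (d : D) (r : ℕ), ∀ (κ : Type u) [Field κ] [Algebra Z κ],
      algebraMap Z κ f ≠ 0 → _root_.IsReduced (κ ⊗[Z] D) ∧
        BoundsNormalization (κ ⊗[Z] D) (1 ⊗ₜ d) r ∧
        (1 : κ) ⊗ₜ[Z] d ∈ nonZeroDivisors (κ ⊗[Z] D) := by
  classical
  have : IsNoetherianRing D := Algebra.FiniteType.isNoetherianRing Z D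
  have hfin : (minimalPrimes D).Finite := minimalPrimes.finite_of_isNoetherianRing D
  let ι := minimalPrimes D
  have : Fintype ι := hfin.fintype
  have hprime : ∀ i : ι, i.1.IsPrime := fun i => i.2.1.1
  have hmin : ∀ i j : ι, i.1 ≤ j.1 → i = j := fun i j hij =>
    Subtype.ext (le_antisymm hij (j.2.2 i.2.1 hij))
  have hzero : ∀ x : D, (∀ i : ι, x ∈ i.1) → x = 0 := by
    intro x hx
    have h1 : x ∈ sInf (minimalPrimes D) := by
      rw [Submodule.mem_sInf]
      exact fun p hp => hx ⟨p, hp⟩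
    have h2 : sInf (minimalPrimes D) = nilradical D := Ideal.sInf_minimalPrimes
    rw [h2, nilradical_eq_zero] at h1
    exact h1
  have hreg : ∀ x : D, (∀ i : ι, x ∉ i.1) → x ∈ nonZeroDivisors D := by
    intro x hx
    have h1 : ∀ y, x * y = 0 → y = 0 := fun y hy => hzero y fun i =>
      ((hprime i).mem_or_mem (hy ▸ zero_mem i.1 : x * y ∈ i.1)).resolve_left (hx i)
    exact mem_nonZeroDivisors_iff.2 ⟨h1, fun e he => h1 e (by rwa [mul_comm])⟩
  -- Otherwise the intersection of the other minimal primes would lie in the prime `i`, and so would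
  -- one of them.
  have hh : ∀ i : ι, ∃ h : D, h ∉ i.1 ∧ ∀ j, j ≠ i → h ∈ j.1 := by
    intro i
    by_contra! hcon
    have h1 : (Finset.univ.erase i).inf (fun j : ι => j.1) ≤ i.1 := by
      intro x hx
      by_contra hxi
      obtain ⟨j, hj, hxj⟩ := hcon x hxi
      exact hxj ((Finset.inf_le (f := fun j : ι => j.1)
        (Finset.mem_erase.2 ⟨hj, Finset.mem_univ j⟩)) hx)
    obtain ⟨j, hj, hji⟩ := ((hprime i).inf_le').1 h1
    exact (Finset.mem_erase.1 hj).1 (hmin j i hji)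
  choose h hhi hhj using hh
  choose f hf d₀ hd₀ r J hJ g hg using fun i : ι => HasUniformFibres.of_isDomain Z (D ⧸ i.1)
  choose d hd using fun i : ι => Ideal.Quotient.mk_surjective (d₀ i)
  have hdi : ∀ i, d i ∉ i.1 := fun i hi => hd₀ i (by
    rw [← hd, Ideal.Quotient.eq_zero_iff_mem.2 hi])
  -- Modulo the prime `i` only the `i`-th summand remains, so the sum avoids every minimal prime of
  -- the reduced ring.
  have hsum : ∀ (c : ι → D), (∀ i, c i ∉ i.1) → ∑ i, h i * c i ∈ nonZeroDivisors D := by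
    intro c hc
    refine hreg _ fun i hi => ?_
    rw [← Finset.add_sum_erase _ _ (Finset.mem_univ i)] at hi
    have h1 : ∑ j ∈ Finset.univ.erase i, h j * c j ∈ i.1 := sum_mem fun j hj =>
      Ideal.mul_mem_right _ _ (hhj j i (Finset.mem_erase.1 hj).1.symm)
    rcases (hprime i).mem_or_mem ((Submodule.add_mem_iff_left _ h1).1 hi) with h2 | h2
    exacts [hhi i h2, hc i h2]
  have hs : ∑ i, h i ∈ nonZeroDivisors D := by
    have := hsum (fun _ => 1) fun i => (hprime i).one_notMem
    simpa using this
  obtain ⟨f₁, hf₁, h₁⟩ := exists_fibre_mem_nonZeroDivisors Z (hsum d hdi)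
  obtain ⟨f₂, hf₂, h₂⟩ := exists_fibre_mem_nonZeroDivisors Z hs
  refine ⟨(∏ i, f i) * f₁ * f₂, mul_ne_zero (mul_ne_zero (Finset.prod_ne_zero_iff.2 fun i _ => hf i)
    hf₁) hf₂, ∑ i, h i * d i, ∑ i, r i, fun κ _ _ hκ => ?_⟩
  simp only [map_mul, map_prod, ne_eq, mul_eq_zero, not_or] at hκ
  obtain ⟨⟨hκf, hκ₁⟩, hκ₂⟩ := hκ
  rw [← ne_eq, Finset.prod_ne_zero_iff] at hκf
  have hE := fun i => hg i κ (hκf i (Finset.mem_univ i))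
  let I : ι → Ideal (κ ⊗[Z] D) := fun i => i.1.fibre κ
  have hred : ∀ i, _root_.IsReduced ((κ ⊗[Z] D) ⧸ I i) := fun i =>
    have := (hE i).1
    isReduced_of_injective (i.1.fibreQuotientEquiv (Z := Z) κ).symm.toRingHom
      (i.1.fibreQuotientEquiv (Z := Z) κ).symm.injective
  have hb : ∀ i, BoundsNormalization ((κ ⊗[Z] D) ⧸ I i) (Ideal.Quotient.mk (I i) (1 ⊗ₜ d i)) (r i) := by
    intro i
    have := (hE i).2.1.of_ringEquiv (i.1.fibreQuotientEquiv (Z := Z) κ)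
    rwa [← hd, Ideal.fibreQuotientEquiv_tmul_mk] at this
  have htmul : ∀ c : ι → D, (1 : κ) ⊗ₜ[Z] (∑ i, c i) = ∑ i, (1 : κ) ⊗ₜ[Z] c i := fun c =>
    tmul_sum _ _ _
  have hH : ∀ i, ∀ x ∈ I i, (1 : κ) ⊗ₜ[Z] h i * x = 0 := by
    intro i x hx
    have h1 : I i ≤ LinearMap.ker (LinearMap.mulLeft (κ ⊗[Z] D) ((1 : κ) ⊗ₜ[Z] h i)) := by
      refine Ideal.map_le_iff_le_comap.2 fun y hy => ?_
      change (1 : κ) ⊗ₜ[Z] h i * 1 ⊗ₜ[Z] y = 0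
      rw [Algebra.TensorProduct.tmul_mul_tmul, hzero (h i * y), tmul_zero]
      intro j
      by_cases hji : j = i
      · exact Ideal.mul_mem_left _ _ (hji ▸ hy)
      · exact Ideal.mul_mem_right _ _ (hhj i j hji)
    exact h1 hx
  have hs' : ∑ i, (1 : κ) ⊗ₜ[Z] h i ∈ nonZeroDivisors (κ ⊗[Z] D) := htmul h ▸ h₂ κ hκ₂
  refine ⟨⟨fun x hx => ?_⟩, ?_, h₁ κ hκ₁⟩
  · refine (mem_nonZeroDivisors_iff.1 hs').1 x ?_
    rw [Finset.sum_mul]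
    refine Finset.sum_eq_zero fun i _ => hH i x ?_
    have := hred i
    exact Ideal.Quotient.eq_zero_iff_mem.1 ((hx.map (Ideal.Quotient.mk (I i))).eq_zero)
  · have := BoundsNormalization.of_quotients I _ _ r hH hs' hb
    simp only [Algebra.TensorProduct.tmul_mul_tmul, one_mul] at this
    rwa [htmul]

end Reduced

/-! ### Stratification of the base and induction on the dimension of the fibres -/

/-- All localizations of a ring have the stronger variant of hereditary surjective trace. -/
def LocallyStrongTrace (E : Type u) [CommRing E] : Prop :=
  ∀ (R : Type u) [CommRing R] [Algebra E R] (M : Submonoid E) [IsLocalization M R],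
    StrongHereditarySurjectiveTrace R

namespace LocallyStrongTrace

lemma of_ringEquiv {E E' : Type u} [CommRing E] [CommRing E'] (h : LocallyStrongTrace E)
    (φ : E ≃+* E') : LocallyStrongTrace E' := by
  intro R _ _ M _
  let : Algebra E R := ((algebraMap E' R).comp φ.toRingHom).toAlgebra
  have : IsLocalization (M.map φ.symm) R :=
    IsLocalization.isLocalization_of_base_ringEquiv M R φ.symm
  exact h R (M.map φ.symm)

lemma of_subsingleton (E : Type u) [CommRing E] [Subsingleton E] : LocallyStrongTrace E := by
  intro R _ _ M _
  have : Subsingleton R := (algebraMap E R).codomain_trivial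
  refine ⟨R, fun 𝔭 _ h𝔭 => ?_, fun 𝔭 _ h𝔭 => ?_⟩ <;>
  exact absurd (Subsingleton.elim _ _) h𝔭.ne_top

/-- The quotient of a localization by a prime is a localization of the quotient. -/
lemma quotient {E R : Type u} [CommRing E] [CommRing R] [Algebra E R] (M : Submonoid E)
    [IsLocalization M R] (p : Ideal R) (h : LocallyStrongTrace (E ⧸ p.comap (algebraMap E R))) :
    StrongHereditarySurjectiveTrace (R ⧸ p) := by
  let : Algebra (E ⧸ p.comap (algebraMap E R)) (R ⧸ p) :=
    (Ideal.quotientMap p (algebraMap E R) le_rfl).toAlgebra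
  have : IsLocalization (M.map (Ideal.Quotient.mk (p.comap (algebraMap E R)))) (R ⧸ p) := by
    refine IsLocalization.of_surjective M (S := R) _ Ideal.Quotient.mk_surjective
      (Ideal.Quotient.mk p) Ideal.Quotient.mk_surjective ?_ ?_
    · rfl
    · rw [Ideal.mk_ker, Ideal.mk_ker, IsLocalization.map_under M R]
  exact h (R ⧸ p) (M.map (Ideal.Quotient.mk (p.comap (algebraMap E R))))

end LocallyStrongTrace

/-- Noetherian induction on the base for a property of fields over it, up to finitely many
characteristics. -/
lemma exists_natCast_ne_zero_imp (Z : Type u) [CommRing Z] [IsNoetherianRing Z]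
    (Θ : ∀ (κ : Type u) [Field κ] [Algebra Z κ], Prop)
    (hΘ : ∀ (P : Ideal Z) [P.IsPrime], CharZero (Z ⧸ P) → ∃ f ∉ P, ∃ N : ℕ, N ≠ 0 ∧
      ∀ (κ : Type u) [Field κ] [Algebra Z κ], P ≤ RingHom.ker (algebraMap Z κ) →
        algebraMap Z κ f ≠ 0 → (N : κ) ≠ 0 → Θ κ) :
    ∃ N : ℕ, N ≠ 0 ∧ ∀ (κ : Type u) [Field κ] [Algebra Z κ], (N : κ) ≠ 0 → Θ κ := by
  suffices h : ∀ I : Ideal Z, ∃ N : ℕ, N ≠ 0 ∧ ∀ (κ : Type u) [Field κ] [Algebra Z κ],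
      I ≤ RingHom.ker (algebraMap Z κ) → (N : κ) ≠ 0 → Θ κ by
    obtain ⟨N, hN, h⟩ := h ⊥
    exact ⟨N, hN, fun κ _ _ => h κ bot_le⟩
  intro I
  induction I using WellFoundedGT.induction with
  | ind I ih =>
  have hlt : ∀ a ∉ I, I < I ⊔ Ideal.span {a} := fun a ha =>
    lt_of_le_of_ne le_sup_left fun h => ha (h ▸ Ideal.mem_sup_right (Ideal.mem_span_singleton_self a))
  have hle : ∀ (a : Z) (κ : Type u) [Field κ] [Algebra Z κ], I ≤ RingHom.ker (algebraMap Z κ) →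
      algebraMap Z κ a = 0 → I ⊔ Ideal.span {a} ≤ RingHom.ker (algebraMap Z κ) :=
    fun a κ _ _ h ha => sup_le h ((Ideal.span_singleton_le_iff_mem _).2 ha)
  by_cases hI : I.IsPrime
  · by_cases h0 : CharZero (Z ⧸ I)
    · obtain ⟨f, hf, N, hN, h⟩ := hΘ I h0
      obtain ⟨N', hN', h'⟩ := ih _ (hlt f hf)
      refine ⟨N * N', mul_ne_zero hN hN', fun κ _ _ hκ hNκ => ?_⟩
      rw [Nat.cast_mul, mul_ne_zero_iff] at hNκ
      by_cases hfκ : algebraMap Z κ f = 0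
      · exact h' κ (hle f κ hκ hfκ) hNκ.2
      · exact h κ hκ hfκ hNκ.1
    -- On a stratum of positive characteristic, taking `N` to be a multiple of that characteristic
    -- leaves no fields to consider.
    · obtain ⟨n, hn, hn0⟩ : ∃ n : ℕ, (n : Z ⧸ I) = 0 ∧ n ≠ 0 := by
        by_contra! hcon
        exact h0 (charZero_of_inj_zero hcon)
      refine ⟨n, hn0, fun κ _ _ hκ hnκ => absurd ?_ hnκ⟩
      have h1 : (n : Z) ∈ I := by
        rw [← Ideal.Quotient.eq_zero_iff_mem, map_natCast, hn]
      simpa using hκ h1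
  · by_cases htop : I = ⊤
    · refine ⟨1, one_ne_zero, fun κ _ _ hκ _ => ?_⟩
      have : (1 : Z) ∈ RingHom.ker (algebraMap Z κ) := hκ (htop ▸ trivial)
      exact absurd this (by simp)
    -- A reducible or nonreduced stratum is covered by the smaller ones of `I + (a)` and `I + (b)`.
    · obtain ⟨a, ha, b, hb, hab⟩ : ∃ a ∉ I, ∃ b ∉ I, a * b ∈ I := by
        by_contra! hcon
        exact hI ⟨htop, fun {a b} hab => by
          by_contra! h
          exact hcon a h.1 b h.2 hab⟩
      obtain ⟨N, hN, h⟩ := ih _ (hlt a ha)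
      obtain ⟨N', hN', h'⟩ := ih _ (hlt b hb)
      refine ⟨N * N', mul_ne_zero hN hN', fun κ _ _ hκ hNκ => ?_⟩
      rw [Nat.cast_mul, mul_ne_zero_iff] at hNκ
      have h1 : algebraMap Z κ a * algebraMap Z κ b = 0 := by
        rw [← map_mul]
        exact hκ hab
      rcases mul_eq_zero.1 h1 with h2 | h2
      · exact h κ (hle a κ hκ h2) hNκ.1
      · exact h' κ (hle b κ hκ h2) hNκ.2

/-- The dimension-bounded form of the local theorem: in almost all characteristics the reduced fibres
of dimension less than `n` of a finitely generated algebra have the trace property. -/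
def FibresHaveStrongTrace (n : ℕ) : Prop :=
  ∀ (Z D : Type u) [CommRing Z] [IsNoetherianRing Z] [CommRing D] [Algebra Z D]
    [Algebra.FiniteType Z D], ∃ N : ℕ, N ≠ 0 ∧ ∀ (κ : Type u) [Field κ] [Algebra Z κ],
      (N : κ) ≠ 0 → _root_.IsReduced (κ ⊗[Z] D) → ringKrullDim (κ ⊗[Z] D) < n →
        LocallyStrongTrace (κ ⊗[Z] D)

/-- A ring isomorphism induces an isomorphism of quotients by corresponding ideals. -/
noncomputable def Ideal.quotientComapEquiv {E E' : Type*} [CommRing E] [CommRing E'] (φ : E ≃+* E')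
    (A : Ideal E') : E ⧸ A.comap φ.toRingHom ≃+* E' ⧸ A :=
  Ideal.quotientEquiv _ A φ ((Ideal.map_comap_of_surjective φ.toRingHom φ.surjective A).symm)

/-- The analogue of `FibresHaveStrongTrace` for the quotients of the fibres by annihilators, over a
dense open subset. -/
lemma FibresHaveStrongTrace.quotient_annihilator_of_isDomain {n : ℕ}
    (hn : FibresHaveStrongTrace.{u} n) (Z G : Type u) [CommRing Z] [IsDomain Z] [IsNoetherianRing Z]
    [CommRing G] [Algebra Z G] [Algebra.FiniteType Z G] (h : G) :
    ∃ f : Z, f ≠ 0 ∧ ∃ N : ℕ, N ≠ 0 ∧ ∀ (κ : Type u) [Field κ] [Algebra Z κ],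
      algebraMap Z κ f ≠ 0 → (N : κ) ≠ 0 →
      ∀ A : Ideal (κ ⊗[Z] G), (∀ x, x ∈ A ↔ x * 1 ⊗ₜ h = 0) →
        _root_.IsReduced ((κ ⊗[Z] G) ⧸ A) → ringKrullDim ((κ ⊗[Z] G) ⧸ A) < n →
          LocallyStrongTrace ((κ ⊗[Z] G) ⧸ A) := by
  let I : Ideal G := LinearMap.ker (LinearMap.mulLeft G h)
  obtain ⟨f, hf, hcol⟩ := exists_mem_fibre_colon (Z := Z) (⊥ : Ideal G) h I (fun x => Iff.rfl)
  obtain ⟨N, hN, hT⟩ := hn Z (G ⧸ I)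
  refine ⟨f, hf, N, hN, fun κ _ _ hf₀ hNκ A hA hred hdim => ?_⟩
  -- Generically the annihilator of `h` commutes with the fibre, so the quotient by `A` is itself a
  -- fibre, that of `G ⧸ I`.
  have hI : I.fibre (Z := Z) κ = A := by
    ext x
    rw [hA, mul_comm]
    constructor
    · intro hx
      have h1 : I.fibre (Z := Z) κ ≤ LinearMap.ker (LinearMap.mulLeft (κ ⊗[Z] G) (1 ⊗ₜ h)) := by
        refine Ideal.map_le_iff_le_comap.2 fun y hy => ?_
        change (1 : κ) ⊗ₜ[Z] h * 1 ⊗ₜ[Z] y = 0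
        have hy' : h * y = 0 := hy
        rw [Algebra.TensorProduct.tmul_mul_tmul, hy', tmul_zero]
      exact h1 hx
    · intro hx
      refine hcol κ hf₀ x ?_
      rw [hx]
      exact zero_mem _
  subst hI
  let ψ := I.fibreQuotientEquiv (Z := Z) κ
  refine (hT κ hNκ (isReduced_of_injective ψ.toRingHom ψ.injective) ?_).of_ringEquiv ψ
  rwa [ringKrullDim_eq_of_ringEquiv ψ]

/-- The analogue of `FibresHaveStrongTrace` for the quotients of the fibres by annihilators. -/
lemma FibresHaveStrongTrace.quotient_annihilator {n : ℕ} (hn : FibresHaveStrongTrace.{u} n)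
    (Z G : Type u) [CommRing Z] [IsNoetherianRing Z] [CommRing G] [Algebra Z G]
    [Algebra.FiniteType Z G] (h : G) :
    ∃ N : ℕ, N ≠ 0 ∧ ∀ (κ : Type u) [Field κ] [Algebra Z κ], (N : κ) ≠ 0 →
      ∀ A : Ideal (κ ⊗[Z] G), (∀ x, x ∈ A ↔ x * 1 ⊗ₜ h = 0) →
        _root_.IsReduced ((κ ⊗[Z] G) ⧸ A) → ringKrullDim ((κ ⊗[Z] G) ⧸ A) < n →
          LocallyStrongTrace ((κ ⊗[Z] G) ⧸ A) := by
  refine exists_natCast_ne_zero_imp Z (fun κ _ _ => ∀ A : Ideal (κ ⊗[Z] G),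
    (∀ x, x ∈ A ↔ x * 1 ⊗ₜ h = 0) → _root_.IsReduced ((κ ⊗[Z] G) ⧸ A) →
      ringKrullDim ((κ ⊗[Z] G) ⧸ A) < n → LocallyStrongTrace ((κ ⊗[Z] G) ⧸ A)) ?_
  intro P _ _
  obtain ⟨f, hf, N, hN, hT⟩ :=
    hn.quotient_annihilator_of_isDomain (Z ⧸ P) ((Z ⧸ P) ⊗[Z] G) (1 ⊗ₜ h)
  obtain ⟨f₀, rfl⟩ := Ideal.Quotient.mk_surjective f
  refine ⟨f₀, fun hf₀ => hf (Ideal.Quotient.eq_zero_iff_mem.2 hf₀), N, hN, ?_⟩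
  intro κ _ _ hP hf₀ hNκ A hA hred hdim
  let : Algebra (Z ⧸ P) κ := (Ideal.Quotient.lift P (algebraMap Z κ) hP).toAlgebra
  have : IsScalarTower Z (Z ⧸ P) κ := IsScalarTower.of_algebraMap_eq fun _ => rfl
  let φ := (Algebra.TensorProduct.cancelBaseChange Z (Z ⧸ P) κ κ G).toRingEquiv
  have hφ : φ (1 ⊗ₜ (1 ⊗ₜ h)) = 1 ⊗ₜ h := by
    change Algebra.TensorProduct.cancelBaseChange Z (Z ⧸ P) κ κ G (1 ⊗ₜ (1 ⊗ₜ h)) = _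
    simp
  let ψ := Ideal.quotientComapEquiv φ A
  refine (hT κ hf₀ hNκ (A.comap φ.toRingHom) (fun x => ?_)
    (isReduced_of_injective ψ.toRingHom ψ.injective) ?_).of_ringEquiv ψ
  · rw [Ideal.mem_comap, hA, ← hφ]
    change φ x * φ _ = 0 ↔ _
    rw [← map_mul, map_eq_zero_iff _ φ.injective]
  · rwa [ringKrullDim_eq_of_ringEquiv ψ]

/-- In a reduced ring an annihilator that is a prime ideal is a minimal prime. -/
lemma mem_minimalPrimes_of_forall_mem_iff_mul_eq_zero {E : Type*} [CommRing E] [_root_.IsReduced E]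
    {p : Ideal E} [hp : p.IsPrime] {e : E} (he : ∀ x, x ∈ p ↔ x * e = 0) : p ∈ minimalPrimes E := by
  have hep : e ∉ p := fun h => hp.ne_top ((Ideal.eq_top_iff_one p).2 ((he 1).2 (by
    rw [one_mul]
    exact pow_eq_zero_iff two_ne_zero |>.1 ((pow_two e).trans ((he e).1 h)))))
  refine ⟨⟨hp, bot_le⟩, fun q hq hqp x hx => ?_⟩
  exact (hq.1.mem_or_mem ((he x).1 hx ▸ zero_mem q : x * e ∈ q)).resolve_right fun h => hep (hqp h)

/-- A reduced fibre is the fibre of the reduced algebra. -/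
noncomputable def fibreReductionEquiv (Z D : Type u) [CommRing Z] [CommRing D] [Algebra Z D]
    (κ : Type u) [Field κ] [Algebra Z κ] [_root_.IsReduced (κ ⊗[Z] D)] :
    κ ⊗[Z] (D ⧸ nilradical D) ≃+* κ ⊗[Z] D :=
  ((nilradical D).fibreQuotientEquiv (Z := Z) κ).trans
    ((Ideal.quotEquivOfEq (by
      rw [Ideal.fibre, eq_bot_iff, Ideal.map_le_iff_le_comap]
      intro x hx
      exact ((mem_nilradical.1 hx).map
        (Algebra.TensorProduct.includeRight (R := Z) (A := κ) (B := D))).eq_zero)).trans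
      (RingEquiv.quotientBot _))

/-- In almost all characteristics the irreducible components of the fibres of a domain have the
trace property, if their dimension is less than `n`. -/
lemma FibresHaveStrongTrace.quotient_minimalPrimes {n : ℕ} (hn : FibresHaveStrongTrace.{u} n)
    (Z G : Type u) [CommRing Z] [IsDomain Z] [CharZero Z] [IsNoetherianRing Z] [CommRing G]
    [IsDomain G] [Algebra Z G] [Algebra.FiniteType Z G] :
    ∃ f : Z, f ≠ 0 ∧ ∃ N : ℕ, N ≠ 0 ∧ ∀ (κ : Type u) [Field κ] [Algebra Z κ],
      algebraMap Z κ f ≠ 0 → (N : κ) ≠ 0 → _root_.IsReduced (κ ⊗[Z] G) ∧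
      ∀ P ∈ minimalPrimes (κ ⊗[Z] G), ringKrullDim ((κ ⊗[Z] G) ⧸ P) < n →
        LocallyStrongTrace ((κ ⊗[Z] G) ⧸ P) := by
  obtain ⟨f, hf, d, -, r, J, hJ, g, h⟩ := HasUniformFibres.of_isDomain Z G
  -- The universal member of the family: the coefficients `c j` become coordinates on a larger base.
  obtain ⟨N, hN, hT⟩ := hn.quotient_annihilator (MvPolynomial J Z) (MvPolynomial J Z ⊗[Z] G)
    (∑ j, MvPolynomial.X j ⊗ₜ g j)
  refine ⟨f, hf, N, hN, fun κ _ _ hfκ hNκ => ⟨(h κ hfκ).1, fun P hP hdim => ?_⟩⟩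
  obtain ⟨c, hc⟩ := (h κ hfκ).2.2 P hP
  -- Specialization of the coordinates to `c`. This may be any point of the larger base, so the
  -- induction hypothesis is needed beyond a dense open subset.
  let : Algebra (MvPolynomial J Z) κ := (MvPolynomial.aeval c).toAlgebra
  have : IsScalarTower Z (MvPolynomial J Z) κ :=
    IsScalarTower.of_algebraMap_eq fun z => ((MvPolynomial.aeval c).commutes z).symm
  let φ := (Algebra.TensorProduct.cancelBaseChange Z (MvPolynomial J Z) κ κ G).toRingEquiv
  have hφ : φ (1 ⊗ₜ ∑ j, MvPolynomial.X j ⊗ₜ g j) = ∑ j, c j ⊗ₜ g j := by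
    change Algebra.TensorProduct.cancelBaseChange Z (MvPolynomial J Z) κ κ G _ = _
    rw [tmul_sum, map_sum]
    refine Finset.sum_congr rfl fun j _ => ?_
    rw [Algebra.TensorProduct.cancelBaseChange_tmul, Algebra.smul_def, mul_one]
    exact congrArg (· ⊗ₜ g j) (MvPolynomial.aeval_X c j)
  have hPp : P.IsPrime := hP.1.1
  let ψ := Ideal.quotientComapEquiv φ P
  refine (hT κ hNκ (P.comap φ.toRingHom) (fun x => ?_)
    (isReduced_of_injective ψ.toRingHom ψ.injective) ?_).of_ringEquiv ψ
  · rw [Ideal.mem_comap, hc, ← hφ]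
    change φ x * φ _ = 0 ↔ _
    rw [← map_mul, map_eq_zero_iff _ φ.injective]
  · rwa [ringKrullDim_eq_of_ringEquiv ψ]

/-- Invertibility of `r!` settles the trace condition. A prime minimal over the conductor contracts
to an associated prime of the fibre modulo `d`, hence comes from an annihilator in the fibre of `D ⧸
P` for one of finitely many `P`. That fibre is reduced, so the prime is minimal there and the
induction hypothesis applies to its quotient. -/
lemma FibresHaveStrongTrace.succ_of_isReduced {n : ℕ} (hn : FibresHaveStrongTrace.{u} n)
    (Z D : Type u) [CommRing Z] [IsDomain Z] [CharZero Z] [IsNoetherianRing Z] [CommRing D]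
    [_root_.IsReduced D] [Algebra Z D] [Algebra.FiniteType Z D] :
    ∃ f : Z, f ≠ 0 ∧ ∃ N : ℕ, N ≠ 0 ∧ ∀ (κ : Type u) [Field κ] [Algebra Z κ],
      algebraMap Z κ f ≠ 0 → (N : κ) ≠ 0 → ringKrullDim (κ ⊗[Z] D) < (n + 1 : ℕ) →
        LocallyStrongTrace (κ ⊗[Z] D) := by
  classical
  obtain ⟨f₁, hf₁, d, r, h₁⟩ := exists_boundsNormalization_fibre Z D
  obtain ⟨f₂, hf₂, S, hS, hSP, h₂⟩ := exists_finset_primes_of_colon (Z := Z) (Ideal.span {d})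
  have : Fintype S := hS.fintype
  have : ∀ P : S, P.1.IsPrime := fun P => (hSP P P.2).1
  choose f hf N hN h₃ using fun P : S => hn.quotient_minimalPrimes Z (D ⧸ P.1)
  refine ⟨f₁ * f₂ * ∏ P, f P, mul_ne_zero (mul_ne_zero hf₁ hf₂)
    (Finset.prod_ne_zero_iff.2 fun P _ => hf P), r.factorial * ∏ P, N P,
    mul_ne_zero r.factorial_ne_zero (Finset.prod_ne_zero_iff.2 fun P _ => hN P), ?_⟩
  intro κ _ _ hκ hNκ hdim R _ _ M _
  simp only [map_mul, map_prod, ne_eq, mul_eq_zero, not_or] at hκ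
  obtain ⟨⟨hκ₁, hκ₂⟩, hκ₃⟩ := hκ
  rw [Nat.cast_mul, Nat.cast_prod, mul_ne_zero_iff, Finset.prod_ne_zero_iff] at hNκ
  rw [← ne_eq, Finset.prod_ne_zero_iff] at hκ₃
  obtain ⟨hr, hNκ⟩ := hNκ
  obtain ⟨hred, hb, hd⟩ := h₁ κ hκ₁
  have : IsNoetherianRing (κ ⊗[Z] D) := Algebra.FiniteType.isNoetherianRing κ _
  have hr' : IsUnit ((r.factorial : ℕ) : κ ⊗[Z] D) := by
    have := hr.isUnit.map (algebraMap κ (κ ⊗[Z] D))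
    rwa [map_natCast] at this
  refine ⟨R, fun 𝔭 𝔮 _ _ _ _ _ => hb.normalizedTraceSurjective hd hr' M 𝔭 𝔮, ?_⟩
  intro 𝔭 𝔮 _ _ _ h𝔭 _
  refine LocallyStrongTrace.quotient M 𝔭 ?_
  obtain ⟨e, he⟩ := hb.exists_colon_of_mem_minimalPrimes hd M 𝔭 h𝔭
  have hspan : (Ideal.span {d}).fibre (Z := Z) κ = Ideal.span {(1 : κ) ⊗ₜ[Z] d} := by
    rw [Ideal.fibre, Ideal.map_span, Set.image_singleton]
    rfl
  obtain ⟨P, hPS, e', he'⟩ := h₂ κ hκ₂ (𝔭.comap (algebraMap (κ ⊗[Z] D) R)) inferInstance e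
    (fun x => by rw [hspan]; exact he x)
  obtain ⟨hredP, hminP⟩ := h₃ ⟨P, hPS⟩ κ (hκ₃ _ (Finset.mem_univ _)) (hNκ _ (Finset.mem_univ _))
  have hdp : (1 : κ) ⊗ₜ[Z] d ∈ 𝔭.comap (algebraMap (κ ⊗[Z] D) R) := by
    rw [he]
    exact Ideal.mul_mem_right _ _ (Ideal.mem_span_singleton_self _)
  -- The contracted prime contains the regular element `d`, which lowers the dimension by at least
  -- one.
  have hdim' : ringKrullDim ((κ ⊗[Z] D) ⧸ 𝔭.comap (algebraMap (κ ⊗[Z] D) R)) < n := by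
    have h1 := ringKrullDim_quotient_succ_le_of_nonZeroDivisor hd
    have h2 := ringKrullDim_le_of_surjective (Ideal.Quotient.factor
      ((Ideal.span_singleton_le_iff_mem _).2 hdp)) (Ideal.Quotient.factor_surjective _)
    refine lt_of_le_of_lt h2 ?_
    have h3 := lt_of_le_of_lt h1 hdim
    rw [Nat.cast_add, Nat.cast_one] at h3
    exact lt_of_add_lt_add_right h3
  have hp : (𝔭.comap (algebraMap (κ ⊗[Z] D) R)).IsPrime := inferInstance
  clear he hdp
  generalize 𝔭.comap (algebraMap (κ ⊗[Z] D) R) = p at he' hdim' hp ⊢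
  let ρ : κ ⊗[Z] D →+* κ ⊗[Z] (D ⧸ P) := (P.fibreQuotientEquiv (Z := Z) κ).symm.toRingHom.comp
    (Ideal.Quotient.mk (P.fibre (Z := Z) κ))
  have hρ : Function.Surjective ρ :=
    (P.fibreQuotientEquiv (Z := Z) κ).symm.surjective.comp Ideal.Quotient.mk_surjective
  have hρ0 : ∀ x, ρ x = 0 ↔ x ∈ P.fibre (Z := Z) κ := fun x =>
    (map_eq_zero_iff _ (P.fibreQuotientEquiv (Z := Z) κ).symm.injective).trans
      Ideal.Quotient.eq_zero_iff_mem
  -- The ideal corresponding to `p` in the fibre of `D ⧸ P`, described as the annihilator of the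
  -- image of `e'`.
  obtain ⟨p', hp'⟩ : ∃ p' : Ideal (κ ⊗[Z] (D ⧸ P)), ∀ x, x ∈ p' ↔ x * ρ e' = 0 :=
    ⟨LinearMap.ker (LinearMap.mulRight _ (ρ e')), fun x => Iff.rfl⟩
  have hker : RingHom.ker ((Ideal.Quotient.mk p').comp ρ) = p := by
    ext x
    rw [RingHom.mem_ker, RingHom.comp_apply, Ideal.Quotient.eq_zero_iff_mem, hp', he', ← map_mul, hρ0]
  let ψ : (κ ⊗[Z] D) ⧸ p ≃+* (κ ⊗[Z] (D ⧸ P)) ⧸ p' := (Ideal.quotEquivOfEq hker.symm).trans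
    (RingHom.quotientKerEquivOfSurjective (Ideal.Quotient.mk_surjective.comp hρ))
  have hpp' : p'.IsPrime := by
    rw [← Ideal.Quotient.isDomain_iff_prime]
    exact ψ.symm.toMulEquiv.isDomain _
  refine (hminP p' (mem_minimalPrimes_of_forall_mem_iff_mul_eq_zero hp') ?_).of_ringEquiv ψ.symm
  rwa [← ringKrullDim_eq_of_ringEquiv ψ]

/-- For `n = 0` only the zero ring occurs. In the inductive step the base is stratified into domains
`Z ⧸ P` of characteristic zero; a reduced fibre depends only on the reduced algebra, so the
nilradical can be divided out. -/
theorem fibresHaveStrongTrace (n : ℕ) : FibresHaveStrongTrace.{u} n := by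
  induction n with
  | zero =>
    intro Z D _ _ _ _ _
    refine ⟨1, one_ne_zero, fun κ _ _ _ _ hdim => ?_⟩
    rcases subsingleton_or_nontrivial (κ ⊗[Z] D) with _ | _
    · exact LocallyStrongTrace.of_subsingleton _
    · exact absurd hdim (not_lt.2 ringKrullDim_nonneg_of_nontrivial)
  | succ n hn =>
    intro Z D _ _ _ _ _
    refine exists_natCast_ne_zero_imp Z (fun κ _ _ => _root_.IsReduced (κ ⊗[Z] D) →
      ringKrullDim (κ ⊗[Z] D) < (n + 1 : ℕ) → LocallyStrongTrace (κ ⊗[Z] D)) ?_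
    intro P _ _
    have : _root_.IsReduced (((Z ⧸ P) ⊗[Z] D) ⧸ nilradical ((Z ⧸ P) ⊗[Z] D)) :=
      (Ideal.isRadical_iff_quotient_reduced _).1 (Ideal.radical_isRadical _)
    obtain ⟨f, hf, N, hN, hT⟩ := hn.succ_of_isReduced (Z ⧸ P)
      (((Z ⧸ P) ⊗[Z] D) ⧸ nilradical ((Z ⧸ P) ⊗[Z] D))
    obtain ⟨f₀, rfl⟩ := Ideal.Quotient.mk_surjective f
    refine ⟨f₀, fun hf₀ => hf (Ideal.Quotient.eq_zero_iff_mem.2 hf₀), N, hN, ?_⟩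
    intro κ _ _ hP hf₀ hNκ hred hdim
    let : Algebra (Z ⧸ P) κ := (Ideal.Quotient.lift P (algebraMap Z κ) hP).toAlgebra
    have : IsScalarTower Z (Z ⧸ P) κ := IsScalarTower.of_algebraMap_eq fun _ => rfl
    let φ := (Algebra.TensorProduct.cancelBaseChange Z (Z ⧸ P) κ κ D).toRingEquiv
    have := isReduced_of_injective φ.toRingHom φ.injective
    let ψ := (fibreReductionEquiv (Z ⧸ P) ((Z ⧸ P) ⊗[Z] D) κ).trans φ
    refine (hT κ hf₀ hNκ ?_).of_ringEquiv ψ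
    rwa [ringKrullDim_eq_of_ringEquiv ψ]

/-- One bound valid for every fibre allows the dimension restriction to be dropped after the
induction. -/
lemma ringKrullDim_fibre_le {Z D : Type u} [CommRing Z] [CommRing D] [Algebra Z D] {m : ℕ}
    (φ : MvPolynomial (Fin m) Z →ₐ[Z] D) (hφ : Function.Surjective φ) (κ : Type u) [Field κ]
    [Algebra Z κ] : ringKrullDim (κ ⊗[Z] D) ≤ m := by
  have hsurj : Function.Surjective (Algebra.TensorProduct.map (AlgHom.id κ κ) φ) := by
    intro e
    induction e using TensorProduct.induction_on with
    | zero => exact ⟨0, map_zero _⟩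
    | add x y hx hy =>
      obtain ⟨a, rfl⟩ := hx
      obtain ⟨b, rfl⟩ := hy
      exact ⟨a + b, map_add _ _ _⟩
    | tmul c x =>
      obtain ⟨p, rfl⟩ := hφ x
      exact ⟨c ⊗ₜ p, Algebra.TensorProduct.map_tmul _ _ _ _⟩
  have h1 := ringKrullDim_le_of_surjective (Algebra.TensorProduct.map (AlgHom.id κ κ) φ).toRingHom hsurj
  refine h1.trans ?_
  have h2 := ringKrullDim_eq_of_ringEquiv
    (MvPolynomial.algebraTensorAlgEquiv (σ := Fin m) Z κ).toRingEquiv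
  rw [MvPolynomial.ringKrullDim_of_isNoetherianRing, ringKrullDim_eq_zero_of_field, zero_add,
    Nat.card_eq_fintype_card, Fintype.card_fin] at h2
  exact h2.le

/-- In almost all characteristics, the localizations of the reduced fibres of a finitely generated
algebra have the stronger variant of hereditary surjective trace. -/
theorem exists_locallyStrongTrace_fibre (Z D : Type u) [CommRing Z] [IsNoetherianRing Z] [CommRing D]
    [Algebra Z D] [Algebra.FiniteType Z D] :
    ∃ N : ℕ, N ≠ 0 ∧ ∀ (κ : Type u) [Field κ] [Algebra Z κ], (N : κ) ≠ 0 →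
      _root_.IsReduced (κ ⊗[Z] D) → LocallyStrongTrace (κ ⊗[Z] D) := by
  obtain ⟨m, φ, hφ⟩ := Algebra.FiniteType.iff_quotient_mvPolynomial''.1 ‹Algebra.FiniteType Z D›
  obtain ⟨N, hN, h⟩ := fibresHaveStrongTrace (m + 1) Z D
  refine ⟨N, hN, fun κ _ _ hNκ hred => h κ hNκ hred ?_⟩
  refine lt_of_le_of_lt (ringKrullDim_fibre_le φ hφ κ) ?_
  exact_mod_cast Nat.lt_succ_self m

end

/-! ### From the stronger variant to the weak one, and from algebras to schemes -/

section

open TensorProduct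

/-- A prime minimal over the conductor is dominated by a prime minimal over the conductor. -/
lemma exists_liesOver_mem_minimalPrimes_conductorIdealNorm {R : Type u} [CommRing R] {𝔭 : Ideal R}
    (h𝔭 : 𝔭 ∈ (conductorIdeal R).minimalPrimes) :
    ∃ 𝔮 ∈ (conductorIdealNorm R).minimalPrimes, 𝔮.LiesOver 𝔭 := by
  have hp : 𝔭.IsPrime := h𝔭.1.1
  have hinj : Function.Injective (algebraMap R (Normalization R)) := by
    have h1 : Function.Injective (algebraMap R (FractionRing R)) := IsFractionRing.injective _ _
    rw [IsScalarTower.algebraMap_eq R (Normalization R) (FractionRing R), RingHom.coe_comp] at h1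
    exact h1.of_comp
  obtain ⟨𝔮, -, h𝔮, h𝔮p⟩ := Ideal.exists_ideal_over_prime_of_isIntegral 𝔭 (⊥ : Ideal (Normalization R))
    (by
      intro x hx
      rw [Ideal.mem_comap, Ideal.mem_bot, map_eq_zero_iff _ hinj] at hx
      rw [hx]
      exact zero_mem _)
  refine ⟨𝔮, ⟨⟨h𝔮, Ideal.map_le_iff_le_comap.2 (h𝔮p ▸ h𝔭.1.2)⟩, ?_⟩, ⟨h𝔮p.symm⟩⟩
  intro 𝔮' h𝔮' hle
  by_contra hne
  have := h𝔮'.1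
  -- Incomparability in integral extensions: a strictly smaller prime would contract strictly inside
  -- `𝔭`, against its minimality.
  have hlt := Ideal.IsIntegral.comap_lt_comap (R := R) (lt_of_le_not_ge hle hne)
  rw [h𝔮p] at hlt
  exact hlt.not_ge (h𝔭.2 ⟨inferInstance, Ideal.map_le_iff_le_comap.1 h𝔮'.2⟩ hlt.le)

lemma isIntegrallyClosed_of_conductorIdeal_eq_top {R : Type u} [CommRing R]
    (h : conductorIdeal R = ⊤) : IsIntegrallyClosed R := by
  refine (isIntegrallyClosed_iff (FractionRing R)).2 fun {x} hx => ?_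
  have h1 : (1 : R) ∈ conductorIdeal R := h ▸ trivial
  rw [conductorIdeal, Module.mem_annihilator] at h1
  have h2 := h1 (Submodule.Quotient.mk (⟨x, hx⟩ : Normalization R))
  rw [one_smul, Submodule.Quotient.mk_eq_zero] at h2
  obtain ⟨y, hy⟩ := h2
  exact ⟨y, congrArg Subtype.val hy⟩

/-- If the conductor is the unit ideal the ring is normal and the recursion stops. Otherwise lying
over provides at least one pair of minimal primes to continue with. -/
theorem StrongHereditarySurjectiveTrace.hereditarySurjectiveTrace {R : Type u} [CommRing R]
    (h : StrongHereditarySurjectiveTrace R) : HereditarySurjectiveTrace R := by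
  induction h with
  | mk R htr _ ih =>
    by_cases hc : conductorIdeal R = ⊤
    · exact .of_normal R (isIntegrallyClosed_of_conductorIdeal_eq_top hc)
    · obtain ⟨𝔭, h𝔭⟩ := Ideal.nonempty_minimalPrimes hc
      obtain ⟨𝔮, h𝔮, hlies⟩ := exists_liesOver_mem_minimalPrimes_conductorIdealNorm h𝔭
      have := h𝔭.1.1
      have := h𝔮.1.1
      exact .step R 𝔭 𝔮 h𝔭 h𝔮 (htr 𝔭 𝔮 h𝔭 h𝔮) (ih 𝔭 𝔮 h𝔭 h𝔮)

section GenericReducedness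

variable (A D k : Type u) [CommRing A] [IsDomain A] [CommRing D] [Algebra A D] [Field k] [Algebra A k]
  [FaithfulSMul A k]

lemma flat_of_faithfulSMul_field : Module.Flat A k := by
  have : Module.Flat A (FractionRing A) := IsLocalization.flat _ (nonZeroDivisors A)
  let : Algebra (FractionRing A) k := FractionRing.liftAlgebra A k
  have : IsScalarTower A (FractionRing A) k := FractionRing.isScalarTower_liftAlgebra _ _
  exact Module.Flat.trans A (FractionRing A) k

variable {A D} in
/-- The nilpotent elements of an algebra with reduced generic fibre are torsion. -/
lemma exists_smul_eq_zero_of_isNilpotent [_root_.IsReduced (k ⊗[A] D)] {x : D}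
    (hx : IsNilpotent x) : ∃ f : A, f ≠ 0 ∧ f • x = 0 := by
  by_contra! hcon
  have := flat_of_faithfulSMul_field A k
  -- If `x` is not torsion, `a ↦ a • x` is injective and stays so over the flat `A`-module `k`. But
  -- `x` becomes nilpotent, hence zero, in the reduced generic fibre.
  have hinj : Function.Injective (LinearMap.toSpanSingleton A D x) :=
    (injective_iff_map_eq_zero _).2 fun a ha => by
      by_contra h
      exact hcon a h ha
  have h1 := Module.Flat.lTensor_preserves_injective_linearMap (M := k) _ hinj
  have h2 : (1 : k) ⊗ₜ[A] x = 0 :=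
    (hx.map (Algebra.TensorProduct.includeRight (R := A) (A := k) (B := D))).eq_zero
  have h3 : (1 : k) ⊗ₜ[A] (1 : A) = 0 := h1 (by
    rw [LinearMap.lTensor_tmul, LinearMap.toSpanSingleton_apply, one_smul, h2, map_zero])
  have h4 := congrArg (TensorProduct.rid A k) h3
  rw [TensorProduct.rid_tmul, one_smul, map_zero] at h4
  exact one_ne_zero h4

/-- A finitely generated algebra with reduced generic fibre has reduced fibres with the trace property
over a dense open subset, in almost all characteristics. -/
lemma exists_isReduced_and_locallyStrongTrace_fibre [IsNoetherianRing A] [CharZero A]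
    [Algebra.FiniteType A D] [_root_.IsReduced (k ⊗[A] D)] :
    ∃ f : A, f ≠ 0 ∧ ∀ (κ : Type u) [Field κ] [Algebra A κ], algebraMap A κ f ≠ 0 →
      _root_.IsReduced (κ ⊗[A] D) ∧ LocallyStrongTrace (κ ⊗[A] D) := by
  have : IsNoetherianRing D := Algebra.FiniteType.isNoetherianRing A D
  have hred : _root_.IsReduced (D ⧸ nilradical D) :=
    (Ideal.isRadical_iff_quotient_reduced _).1 (Ideal.radical_isRadical _)
  obtain ⟨f₁, hf₁, d, r, h₁⟩ := exists_boundsNormalization_fibre A (D ⧸ nilradical D)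
  obtain ⟨N, hN, h₂⟩ := exists_locallyStrongTrace_fibre A D
  obtain ⟨T, hT⟩ := IsNoetherian.noetherian (nilradical D)
  have hT0 : ∀ x : T, ∃ f : A, f ≠ 0 ∧ f • x.1 = 0 := fun x =>
    exists_smul_eq_zero_of_isNilpotent k (mem_nilradical.1 (hT.le (Submodule.subset_span x.2)))
  choose g hg hgx using hT0
  refine ⟨f₁ * N * ∏ x, g x, mul_ne_zero (mul_ne_zero hf₁ (Nat.cast_ne_zero.2 hN))
    (Finset.prod_ne_zero_iff.2 fun x _ => hg x), fun κ _ _ hκ => ?_⟩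
  simp only [map_mul, map_prod, map_natCast, ne_eq, mul_eq_zero, not_or] at hκ
  obtain ⟨⟨hκ₁, hκN⟩, hκg⟩ := hκ
  rw [← ne_eq, Finset.prod_ne_zero_iff] at hκg
  -- The finitely many generators of the nilradical are killed by elements that become units of `κ`,
  -- so the fibre agrees with that of the reduced algebra.
  have hbot : (nilradical D).fibre (Z := A) κ = ⊥ := by
    rw [Ideal.fibre, ← hT, eq_bot_iff, Ideal.map_le_iff_le_comap]
    refine Ideal.span_le.2 fun x hx => ?_
    change (1 : κ) ⊗ₜ[A] x = 0
    have h3 : algebraMap A κ (g ⟨x, hx⟩) • (1 : κ) ⊗ₜ[A] x = 0 := by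
      rw [algebraMap_smul, ← tmul_smul, hgx ⟨x, hx⟩, tmul_zero]
    exact (smul_eq_zero.1 h3).resolve_left (hκg _ (Finset.mem_univ _))
  have hE : _root_.IsReduced (κ ⊗[A] D) := by
    have := (h₁ κ hκ₁).1
    let ψ : κ ⊗[A] D ≃+* κ ⊗[A] (D ⧸ nilradical D) :=
      (((nilradical D).fibreQuotientEquiv (Z := A) κ).trans
        ((Ideal.quotEquivOfEq hbot).trans (RingEquiv.quotientBot _))).symm
    exact isReduced_of_injective ψ.toRingHom ψ.injective
  exact ⟨hE, h₂ κ hκN hE⟩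

end GenericReducedness

section Charts

/-- Base change of an affine chart. -/
lemma exists_isOpenImmersion_of_isPullback {A D K : Type u} [CommRing A] [CommRing D] [CommRing K]
    [Algebra A D] [Algebra A K] {P Y : Scheme.{u}} {p : P ⟶ Y} {q : P ⟶ Spec (.of K)}
    {f : Y ⟶ Spec (.of A)}
    (h : IsPullback p q f (Spec.map (CommRingCat.ofHom (algebraMap A K))))
    (j : Spec (.of D) ⟶ Y) [IsOpenImmersion j]
    (hj : j ≫ f = Spec.map (CommRingCat.ofHom (algebraMap A D))) :
    ∃ u : Spec (.of (K ⊗[A] D)) ⟶ P, IsOpenImmersion u ∧ ∀ x : P, p x ∈ Set.range j →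
      x ∈ Set.range u := by
  have h1 : IsPullback (pullback.snd p j) (pullback.fst p j ≫ q)
      (Spec.map (CommRingCat.ofHom (algebraMap A D)))
      (Spec.map (CommRingCat.ofHom (algebraMap A K))) := by
    have := (IsPullback.of_hasPullback p j).flip.paste_vert h
    rwa [hj] at this
  let ι := (h1.flip.isoPullback ≪≫ pullbackSpecIso A K D)
  refine ⟨ι.inv ≫ pullback.fst p j, inferInstance, fun x hx => ?_⟩
  have h2 : x ∈ Set.range (pullback.fst p j) := by
    rw [Scheme.Pullback.range_fst]
    exact hx
  obtain ⟨w, rfl⟩ := h2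
  refine ⟨ι.hom w, ?_⟩
  rw [← Scheme.Hom.comp_apply, Iso.hom_inv_id_assoc]

/-- The local rings of a scheme with an affine chart are localizations of the chart. -/
lemma exists_isLocalization_stalk {E : Type u} [CommRing E] {P : Scheme.{u}} (u : Spec (.of E) ⟶ P)
    [IsOpenImmersion u] (e : Spec (.of E)) :
    ∃ (_ : Algebra E (P.presheaf.stalk (u e))) (M : Submonoid E),
      IsLocalization M (P.presheaf.stalk (u e)) := by
  have : e.asIdeal.IsPrime := PrimeSpectrum.isPrime e
  let σ : Localization.AtPrime e.asIdeal ≃+* P.presheaf.stalk (u e) :=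
    ((asIso (u.stalkMap e)) ≪≫ (Spec.stalkIso (.of E) e)).commRingCatIsoToRingEquiv.symm
  let : Algebra E (P.presheaf.stalk (u e)) :=
    (σ.toRingHom.comp (algebraMap E (Localization.AtPrime e.asIdeal))).toAlgebra
  refine ⟨inferInstance, e.asIdeal.primeCompl, ?_⟩
  exact IsLocalization.isLocalization_of_algEquiv _
    (AlgEquiv.ofRingEquiv (f := σ) fun _ => rfl : Localization.AtPrime e.asIdeal ≃ₐ[E] _)

/-- A quasi-compact scheme is covered by finitely many affine charts. -/
lemma AlgebraicGeometry.Scheme.exists_finite_affine_charts (Y : Scheme.{u}) [CompactSpace Y] :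
    ∃ (I : Type u) (_ : Fintype I) (D : I → CommRingCat.{u}) (j : ∀ i, Spec (D i) ⟶ Y),
      (∀ i, IsOpenImmersion (j i)) ∧ ∀ y : Y, ∃ i, y ∈ Set.range (j i) := by
  let 𝒰 := Y.affineCover.finiteSubcover
  refine ⟨𝒰.I₀, inferInstance, fun i => Γ(𝒰.X i, ⊤), fun i => (𝒰.X i).isoSpec.inv ≫ 𝒰.f i,
    fun i => inferInstance, fun y => ?_⟩
  obtain ⟨i, x, hx⟩ := 𝒰.exists_eq y
  refine ⟨i, (𝒰.X i).isoSpec.hom x, ?_⟩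
  rw [← Scheme.Hom.comp_apply, Iso.hom_inv_id_assoc]
  exact hx

end Charts

/-- The model has a finite affine cover. The base change of each chart to `k` is open in `X`, hence
reduced, and the affine result provides one nonzero element of the base per chart; `U` is where
their product does not vanish. -/
theorem lemma4p1 {k : Type u} [Field k] [IsAlgClosed k] [CharZero k]
    (X : Scheme.{u}) [IsReduced X] (f : X ⟶ Spec (CommRingCat.of k))
    [LocallyOfFiniteType f] [QuasiCompact f] (M : ArithmeticModel f) :
    ∃ U : (Spec (CommRingCat.of M.A)).Opens,
      Dense (U : Set (Spec (CommRingCat.of M.A))) ∧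
      ∀ s : Spec (CommRingCat.of M.A), s ∈ U → IsClosed ({s} : Set (Spec (CommRingCat.of M.A))) →
        (M.toBase.fiber s).HasHereditarySurjectiveTrace ∧
        (M.toBase.fiber s).HasStrongHereditarySurjectiveTrace := by
  have : Algebra.FiniteType ℤ M.A := (Subalgebra.fg_iff_finiteType _).1 M.fg
  have : IsNoetherianRing M.A := Algebra.FiniteType.isNoetherianRing ℤ M.A
  have : CharZero M.A := charZero_of_injective_algebraMap (R := ℤ) (by
    have h1 : Function.Injective (algebraMap ℤ k) := (algebraMap ℤ k).injective_int
    rw [IsScalarTower.algebraMap_eq ℤ M.A k, RingHom.coe_comp] at h1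
    exact h1.of_comp)
  have := M.locallyOfFiniteType
  have := M.quasiCompact
  have : CompactSpace M.total := QuasiCompact.compactSpace_of_compactSpace M.toBase
  obtain ⟨I, _, D, j, hjopen, hcov⟩ := M.total.exists_finite_affine_charts
  have hφ : ∀ i, ∃ φ : CommRingCat.of M.A ⟶ D i, Spec.map φ = j i ≫ M.toBase := fun i =>
    Spec.map_surjective _
  choose φ hφ using hφ
  let (i : I) : Algebra M.A (D i) := (φ i).hom.toAlgebra
  have hft : ∀ i, Algebra.FiniteType M.A (D i) := fun i => by
    have h1 : LocallyOfFiniteType (Spec.map (φ i)) := by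
      rw [hφ]
      infer_instance
    exact (HasRingHomProperty.Spec_iff (P := @LocallyOfFiniteType)).1 h1
  have hred : ∀ i, _root_.IsReduced (k ⊗[M.A] D i) := fun i => by
    obtain ⟨u, hu, -⟩ := exists_isOpenImmersion_of_isPullback (D := D i) M.isPullback (j i) (hφ i).symm
    have := isReduced_of_isOpenImmersion u
    exact (affine_isReduced_iff (.of (k ⊗[M.A] D i))).1 this
  have : FaithfulSMul M.A k := inferInstance
  choose g hg hgκ using fun i => exists_isReduced_and_locallyStrongTrace_fibre M.A (D i) k
  have hg0 : ∏ i, g i ≠ 0 := Finset.prod_ne_zero_iff.2 fun i _ => hg i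
  refine ⟨PrimeSpectrum.basicOpen (∏ i, g i), ?_, fun s hs _ => ?_⟩
  · refine IsOpen.dense (PrimeSpectrum.basicOpen (∏ i, g i)).2 ?_
    -- The base is a domain, so a nonempty open subset is dense; the generic point witnesses
    -- nonemptiness.
    refine ⟨(⊥ : PrimeSpectrum M.A), ?_⟩
    change ∏ i, g i ∉ (⊥ : Ideal M.A)
    exact hg0
  · let κ := (Spec (CommRingCat.of M.A)).residueField s
    obtain ⟨ψ, hψ⟩ : ∃ ψ : CommRingCat.of M.A ⟶ κ,
      Spec.map ψ = (Spec (CommRingCat.of M.A)).fromSpecResidueField s := Spec.map_surjective _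
    let : Algebra M.A κ := ψ.hom.toAlgebra
    have hκ : ∀ a : M.A, a ∉ s.asIdeal → algebraMap M.A κ a ≠ 0 := by
      intro a ha h0
      have h1 := (Spec (CommRingCat.of M.A)).fromSpecResidueField_apply s (⊥ : PrimeSpectrum κ)
      rw [← hψ] at h1
      refine ha (h1 ▸ ?_)
      change ψ.hom a ∈ (⊥ : Ideal κ)
      exact h0
    have hgi : ∀ i, algebraMap M.A κ (g i) ≠ 0 := by
      have h1 := hκ _ hs
      rw [map_prod, Finset.prod_ne_zero_iff] at h1
      exact fun i => h1 i (Finset.mem_univ i)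
    have hpb : IsPullback (M.toBase.fiberι s) (M.toBase.fiberToSpecResidueField s) M.toBase
        (Spec.map ψ) := by
      rw [hψ]
      exact IsPullback.of_hasPullback _ _
    have hstalk : ∀ x : M.toBase.fiber s,
        _root_.IsReduced ((M.toBase.fiber s).presheaf.stalk x) ∧
        StrongHereditarySurjectiveTrace ((M.toBase.fiber s).presheaf.stalk x) := by
      intro x
      obtain ⟨i, hi⟩ := hcov (M.toBase.fiberι s x)
      obtain ⟨u, hu, hxu⟩ := exists_isOpenImmersion_of_isPullback (D := D i) (K := κ) hpb (j i) (hφ i).symm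
      obtain ⟨e, rfl⟩ := hxu x hi
      obtain ⟨_, N, hN⟩ := exists_isLocalization_stalk u e
      obtain ⟨hr, hT⟩ := hgκ i κ (hgi i)
      exact ⟨isReduced_localizationPreserves N _ hr, hT _ N⟩
    have : IsReduced (M.toBase.fiber s) :=
      have := fun x => (hstalk x).1
      isReduced_of_isReduced_stalk _
    exact ⟨⟨this, fun x => (hstalk x).2.hereditarySurjectiveTrace⟩, this, fun x => (hstalk x).2⟩

end
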